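/- All graphs are finite and simple. For a graph $G$ and $D\subseteq V(G)$, let $N[D]$ be the set of vertices that lie in $D$ or are adjacent to a vertex of $D$. For a set $\mathcal F$ of graphs, $D$ is $\mathcal F$-isolating if $G-N[D]$ has no subgraph (not necessarily induced) that is isomorphic to a member of $\mathcal F$; $\iota(G,\mathcal F)$ denotes the size of a smallest $\mathcal F$-isolating set of $G$. For an integer $k\ge 1$, let $\mathcal F_{1,k}$ be the set of regular graphs of degree at least $k-1$, let $\mathcal F_{2,k}$ be the set of graphs of chromatic number at least $k$ (members of these sets have at least one vertex), and let $\mathcal F_{3,k}=\mathcal F_{1,k}\cup\mathcal F_{2,k}$. A $k$-clique is a graph isomorphic to the complete graph $K_k$. For integers $m\ge 0$ and $k\ge 1$, let $t_k=\binom k2+2$ and write $m+1=qt_k+r$ with integers $q\ge 0$ and $0\le r\le t_k-1$. A graph $G$ is an $(m,k)$-special graph if either $q=0$ and $G$ is a tree with $m$ edges, or $q\ge 1$ and $G$ arises as follows. Take distinct vertices $v_1,\dots,v_q$ and pairwise disjoint $k$-element sets $U_1,\dots,U_q$ that contain none of the $v_i$. For each $i$, let $G_i$ be the graph on $U_i\cup\{v_i\}$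 consisting of all edges inside $U_i$ and exactly one edge joining $v_i$ to a vertex of $U_i$. Let $T$ be a tree with vertex set $\{v_1,\dots,v_q\}$, and let $T'$ be a tree with exactly $r$ edges that has exactly one vertex in common with $\bigcup_{i=1}^q V(G_i)$, this vertex being one of the $v_i$. Then $G$ is the union of $T$, $T'$ and $G_1,\dots,G_q$. An $(m,k)$-special graph is pure if $r=0$. **Theorem.** Let $k\ge 1$ and $\ell\in\{1,2,3\}$, and let $G$ be a connected graph with exactly $m$ edges that is not a $k$-clique. Then $$\iota(G,\mathcal F_{\ell,k})\le\frac{m+1}{\binom k2+2}.$$ Moreover: (i) Equality holds if and only if $G$ is a pure $(m,k)$-special graph, or $k=2$ and $G$ is a $5$-cycle, or $k=3$, $\ell\in\{1,3\}$ and $G$ is a $4$-cycle. (ii) If $G$ is an $(m,k)$-special graph, then $\iota(G,\mathcal F_{\ell,k})=\left\lfloor (m+1)/\left(\binom k2+2\right)\right\rfloor$. -/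

import Mathlib

open SimpleGraph

universe u

/-- A class of finite graphs (with vertex types in a fixed universe). -/
abbrev GraphFamily : Type (u + 1) :=
  ∀ (W : Type u) [Fintype W], SimpleGraph W → Prop

open Classical in
/-- Regular graphs of degree at least `k - 1` (on a non-empty vertex set). -/
def regularFamily (k : ℕ) : GraphFamily.{u} := fun W _ H =>
  Nonempty W ∧ ∃ d : ℕ, k ≤ d + 1 ∧ H.IsRegularOfDegree d

/-- Graphs of chromatic number at least `k` (on a non-empty vertex set). -/
def chromaticFamily (k : ℕ) : GraphFamily.{u} := fun W _ H =>
  Nonempty W ∧ (k : ℕ∞) ≤ H.chromaticNumber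

/-- The families `F_{1,k}`, `F_{2,k}` and `F_{3,k} = F_{1,k} ∪ F_{2,k}`; only the indices
`1, 2, 3` are meaningful. -/
def isolationFamily (l k : ℕ) : GraphFamily.{u} := fun W _ H =>
  match l with
  | 1 => regularFamily k W H
  | 2 => chromaticFamily k W H
  | 3 => regularFamily k W H ∨ chromaticFamily k W H
  | _ => False

namespace SimpleGraph

variable {V : Type u}

/-- The closed neighbourhood `N[D]` of a set of vertices. -/
def closedNbhd (G : SimpleGraph V) (D : Set V) : Set V :=
  {w | ∃ d ∈ D, w = d ∨ G.Adj d w}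

/-- `D` is `F`-isolating: `G - N[D]` contains no copy of a graph in `F` as a
(not necessarily induced) subgraph. -/
def IsIsolating (G : SimpleGraph V) (F : GraphFamily.{u}) (D : Set V) : Prop :=
  ∀ (W : Type u) [Fintype W] (H : SimpleGraph W),
    F W H → ¬ H.IsContained (G.induce (G.closedNbhd D)ᶜ)

/-- The isolation number `ι(G, F)`: the size of a smallest `F`-isolating set of `G`. -/
noncomputable def isolationNumber (G : SimpleGraph V) (F : GraphFamily.{u}) : ℕ :=
  sInf {n | ∃ D : Finset V, G.IsIsolating F (D : Set V) ∧ D.card = n}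

/-- The whole vertex set is isolating for each of the three families, so the infimum
defining the isolation number is over a non-empty set. -/
theorem isIsolating_univ (G : SimpleGraph V) (l k : ℕ) :
    G.IsIsolating (isolationFamily l k) Set.univ := by
  intro W _ H hF hc
  have hne : Nonempty W := by
    unfold isolationFamily at hF
    split at hF
    · exact hF.1
    · exact hF.1
    · exact hF.elim (fun h => h.1) (fun h => h.1)
    · exact hF.elim
  obtain ⟨f⟩ := hc
  obtain ⟨w⟩ := hne
  exact (f w).2 ⟨_, Set.mem_univ _, Or.inl rfl⟩

/-- `H` is a `k`-clique `U` together with a vertex `v ∉ U` joined to exactly one vertex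
`u₁` of `U`. -/
def IsCliqueConstituent {G : SimpleGraph V} (k : ℕ) (H : G.Subgraph) (U : Finset V) (v : V) :
    Prop :=
  U.card = k ∧ v ∉ U ∧ H.verts = insert v (U : Set V) ∧
    ∃ u₁ ∈ U, ∀ a b : V, H.Adj a b ↔
      (a ∈ U ∧ b ∈ U ∧ a ≠ b) ∨ (a = u₁ ∧ b = v) ∨ (a = v ∧ b = u₁)

/-- `G` is the union of a tree `T` on `q ≥ 1` vertices `v i`, pairwise disjoint `k`-clique
constituents `A i` (attached at the `v i`), and an `r`-edge remainder tree `T'` that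
meets the constituents in exactly one of the vertices `v i`. -/
def IsSpecialUnion (k q r : ℕ) (G : SimpleGraph V) : Prop :=
  ∃ (v : Fin q → V) (U : Fin q → Finset V) (A : Fin q → G.Subgraph) (T T' : G.Subgraph)
    (i₀ : Fin q),
    Function.Injective v ∧
    (∀ i j, i ≠ j → Disjoint (U i) (U j)) ∧
    (∀ i j, v i ∉ U j) ∧
    (∀ i, IsCliqueConstituent k (A i) (U i) (v i)) ∧
    T.verts = Set.range v ∧ T.coe.IsTree ∧
    T'.coe.IsTree ∧ T'.edgeSet.ncard = r ∧
    T'.verts ∩ (⋃ i, (A i).verts) = {v i₀} ∧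
    T'.verts ∪ (⋃ i, (A i).verts) = Set.univ ∧
    T.edgeSet ∪ T'.edgeSet ∪ (⋃ i, (A i).edgeSet) = G.edgeSet

/-- `G` is an `(m,k)`-special graph where `m + 1 = q * t + r`, `0 ≤ r < t`,
`t = (k choose 2) + 2`. If `q = 0`, such a graph is a tree with `m` edges. -/
def IsSpecialGraphWith (m k q r : ℕ) (G : SimpleGraph V) : Prop :=
  m + 1 = q * (k.choose 2 + 2) + r ∧ r < k.choose 2 + 2 ∧
    ((q = 0 ∧ G.IsTree ∧ G.edgeSet.ncard = m) ∨ (1 ≤ q ∧ G.IsSpecialUnion k q r))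

/-- `(m,k)`-special graphs. -/
def IsSpecialGraph (m k : ℕ) (G : SimpleGraph V) : Prop :=
  ∃ q r : ℕ, G.IsSpecialGraphWith m k q r

/-- Pure `(m,k)`-special graphs: those with `r = 0`. -/
def IsPureSpecialGraph (m k : ℕ) (G : SimpleGraph V) : Prop :=
  ∃ q : ℕ, G.IsSpecialGraphWith m k q 0

end SimpleGraph

/-! Put t = (k choose 2) + 2 and write e for numbers of edges. Call a non-empty vertex set inducing
minimum degree at least k - 1 a core. Every graph in one of the three families contains a core; for
the chromatic family this is greedy colouring. Hence a set whose closed neighbourhood meets all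
cores is isolating for all three families at once, and the upper bound is proved in this stronger
form. Conversely, K_k lies in each family, so an isolating set dominates a vertex of every k-clique;
in a special graph this forces a vertex of D in each of the q disjoint sets U_i ∪ {v_i}.

The bound is `Conn.bounded`, a strong induction over connected vertex sets A that records equality:
some D hits all cores of A and has t|D| ≤ e(A), or t|D| = e(A) + 1 with G[A] extremal. Each step
deletes a set X, applies induction to the components C of the rest, and compares the price t of a
new vertex with e(X) plus the surpluses e(C) + e(X,C) - t|D_C|. Since A is connected, e(X,C) ≥ 1, so
a surplus is never negative; only k-clique components, which violate the bound, need separate care.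

If a k-clique is a component of A - x, the vertex x is chosen. Clique and link repay at least t - 1,
and equality forces pure special graphs glued to x at their roots (`bounded_of_pendant_clique`).

If there is a k-clique U but no pendant one, choosing a vertex of U requires total surplus 2. When
this is missing, all components but at most one are extremal and joined to U by one edge
(`TightAt`). Smallest isolating sets of extremal graphs can be made to contain the ends of these
edges, and then no vertex of U is needed: a core that misses a vertex of U requires edges leaving U.
This argument can fail only for k = 2. There every edge is a clique, and an edge with both ends
linked to the same component (`Conn.exists_edge_linked`) yields a strict inequality or a 5-cycle.

If there is no k-clique, k ≤ 2 is trivial. For k ≥ 4, deleting N[v] for a vertex v of maximum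
degree, at times with one more vertex, removes t edges (`exists_hitsCores_of_cliqueFree`). For k = 3
the same idea works up to the 4-cycle (`bounded_of_triangleFree`). The 4-cycle counts as extremal
for cores; that it is not so for ℓ = 2 is sorted out at the end. -/

namespace SimpleGraph

/-! ### Degrees and edge counts within vertex sets -/

section Isolation

open scoped Classical

variable {V : Type u} (G : SimpleGraph V)

/-- The number of neighbours of `v` in `S`. -/
noncomputable def degIn (S : Finset V) (v : V) : ℕ := (S.filter (G.Adj v)).card

/-- The number of adjacent pairs in `A × B`. -/
noncomputable def links (A B : Finset V) : ℕ := ∑ a ∈ A, G.degIn B a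

/-- The number of edges of `G[A]`. -/
noncomputable def size (A : Finset V) : ℕ := G.links A A / 2

/-- `G[S]` is non-empty and has minimum degree at least `k - 1`. -/
def IsCore (k : ℕ) (S : Finset V) : Prop := S.Nonempty ∧ ∀ s ∈ S, k ≤ G.degIn S s + 1

/-- The closed neighbourhood of `D` meets `S`. -/
def Hits (D S : Finset V) : Prop := ∃ s ∈ S, ∃ d ∈ D, s = d ∨ G.Adj d s

/-- `N[D]` meets every core inside `A`. -/
def HitsCores (k : ℕ) (A D : Finset V) : Prop := ∀ S ⊆ A, G.IsCore k S → G.Hits D S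

/-- `G[A]` is connected. -/
def Conn (A : Finset V) : Prop :=
  A.Nonempty ∧ ∀ S ⊆ A, S.Nonempty → (∀ s ∈ S, ∀ a ∈ A, G.Adj s a → a ∈ S) → S = A

/-- The vertex sets of the components of `G[B]`. -/
noncomputable def pieces (B : Finset V) : Finset (Finset V) :=
  B.powerset.filter fun C => G.Conn C ∧ ∀ c ∈ C, ∀ b ∈ B, G.Adj c b → b ∈ C

/-- `G[U]` is a complete graph on `k` vertices. -/
def IsKClique (k : ℕ) (U : Finset V) : Prop :=
  U.card = k ∧ ∀ x ∈ U, ∀ y ∈ U, x ≠ y → G.Adj x y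

variable {G}

lemma degIn_mono {S T : Finset V} (h : S ⊆ T) (v : V) : G.degIn S v ≤ G.degIn T v :=
  Finset.card_le_card (Finset.filter_subset_filter _ h)

lemma degIn_union {S T : Finset V} (h : Disjoint S T) (v : V) :
    G.degIn (S ∪ T) v = G.degIn S v + G.degIn T v := by
  unfold degIn
  rw [Finset.filter_union, Finset.card_union_of_disjoint]
  exact Finset.disjoint_filter_filter h

lemma degIn_singleton (u v : V) : G.degIn {u} v = if G.Adj v u then 1 else 0 := by
  unfold degIn
  rw [Finset.filter_singleton]
  split_ifs <;> simp

lemma degIn_pos {S : Finset V} {v : V} : 0 < G.degIn S v ↔ ∃ s ∈ S, G.Adj v s := by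
  unfold degIn
  rw [Finset.card_pos]
  constructor
  · rintro ⟨s, hs⟩
    exact ⟨s, (Finset.mem_filter.1 hs).1, (Finset.mem_filter.1 hs).2⟩
  · rintro ⟨s, hs, h⟩
    exact ⟨s, Finset.mem_filter.2 ⟨hs, h⟩⟩

lemma degIn_le_card_erase (S : Finset V) (v : V) : G.degIn S v ≤ (S.erase v).card := by
  apply Finset.card_le_card
  intro w hw
  rw [Finset.mem_filter] at hw
  exact Finset.mem_erase.2 ⟨hw.2.ne', hw.1⟩

lemma degIn_add_one_le {S : Finset V} {v : V} (hv : v ∈ S) : G.degIn S v + 1 ≤ S.card := by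
  have := degIn_le_card_erase (G := G) S v
  rw [Finset.card_erase_of_mem hv] at this
  have : 0 < S.card := Finset.card_pos.2 ⟨v, hv⟩
  omega

lemma degIn_erase (S : Finset V) (v : V) : G.degIn (S.erase v) v = G.degIn S v := by
  unfold degIn
  congr 1
  ext w
  simp only [Finset.mem_filter, Finset.mem_erase]
  constructor
  · rintro ⟨⟨_, h⟩, h'⟩; exact ⟨h, h'⟩
  · rintro ⟨h, h'⟩; exact ⟨⟨h'.ne', h⟩, h'⟩

lemma links_eq_card (A B : Finset V) :
    G.links A B = ((A ×ˢ B).filter fun p => G.Adj p.1 p.2).card := by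
  unfold links degIn
  simp only [Finset.card_filter, Finset.sum_product]

lemma links_comm (A B : Finset V) : G.links A B = G.links B A := by
  unfold links degIn
  simp_rw [Finset.card_filter]
  rw [Finset.sum_comm]
  simp_rw [G.adj_comm]

lemma links_union_left {A A' : Finset V} (h : Disjoint A A') (B : Finset V) :
    G.links (A ∪ A') B = G.links A B + G.links A' B := Finset.sum_union h

lemma links_union_right {B B' : Finset V} (A : Finset V) (h : Disjoint B B') :
    G.links A (B ∪ B') = G.links A B + G.links A B' := by
  rw [links_comm, links_union_left h, links_comm B, links_comm B']

lemma links_mono {A A' B B' : Finset V} (hA : A ⊆ A') (hB : B ⊆ B') :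
    G.links A B ≤ G.links A' B' := by
  rw [links_eq_card, links_eq_card]
  exact Finset.card_le_card (Finset.filter_subset_filter _ (Finset.product_subset_product hA hB))

lemma links_pos {A B : Finset V} : 0 < G.links A B ↔ ∃ a ∈ A, ∃ b ∈ B, G.Adj a b := by
  unfold links
  rw [Finset.sum_pos_iff]
  simp [degIn_pos]

lemma links_eq_zero {A B : Finset V} (h : ∀ a ∈ A, ∀ b ∈ B, ¬ G.Adj a b) : G.links A B = 0 := by
  by_contra h0
  obtain ⟨a, ha, b, hb, hab⟩ := links_pos.1 (Nat.pos_of_ne_zero h0)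
  exact h a ha b hb hab

@[simp] lemma links_singleton_left (v : V) (B : Finset V) : G.links {v} B = G.degIn B v := by
  simp [links]

lemma links_singleton_right (v : V) (B : Finset V) : G.links B {v} = G.degIn B v := by
  rw [links_comm, links_singleton_left]

lemma links_eq_one {A B : Finset V} (h : G.links A B = 1) :
    ∃ a ∈ A, ∃ b ∈ B, G.Adj a b ∧ ∀ x ∈ A, ∀ y ∈ B, G.Adj x y → x = a ∧ y = b := by
  rw [links_eq_card, Finset.card_eq_one] at h
  obtain ⟨⟨a, b⟩, h⟩ := h
  have hab : (a, b) ∈ (A ×ˢ B).filter fun p => G.Adj p.1 p.2 := by rw [h]; simp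
  rw [Finset.mem_filter, Finset.mem_product] at hab
  refine ⟨a, hab.1.1, b, hab.1.2, hab.2, fun x hx y hy hxy => ?_⟩
  have : (x, y) ∈ (A ×ˢ B).filter fun p => G.Adj p.1 p.2 := by simp [hx, hy, hxy]
  rw [h] at this
  simpa using this

lemma links_eq_two {A B : Finset V} (h : G.links A B = 2) :
    ∃ a ∈ A, ∃ b ∈ B, ∃ a' ∈ A, ∃ b' ∈ B, G.Adj a b ∧ G.Adj a' b' ∧ (a ≠ a' ∨ b ≠ b') ∧
      ∀ x ∈ A, ∀ y ∈ B, G.Adj x y → (x = a ∧ y = b) ∨ (x = a' ∧ y = b') := by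
  rw [links_eq_card, Finset.card_eq_two] at h
  obtain ⟨⟨a, b⟩, ⟨a', b'⟩, hne, h⟩ := h
  have h1 : (a, b) ∈ (A ×ˢ B).filter fun p => G.Adj p.1 p.2 := by rw [h]; simp
  have h2 : (a', b') ∈ (A ×ˢ B).filter fun p => G.Adj p.1 p.2 := by rw [h]; simp
  rw [Finset.mem_filter, Finset.mem_product] at h1 h2
  refine ⟨a, h1.1.1, b, h1.1.2, a', h2.1.1, b', h2.1.2, h1.2, h2.2, ?_, fun x hx y hy hxy => ?_⟩
  · by_contra hc
    push Not at hc
    exact hne (by rw [hc.1, hc.2])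
  have : (x, y) ∈ (A ×ˢ B).filter fun p => G.Adj p.1 p.2 := by simp [hx, hy, hxy]
  rw [h] at this
  simpa using this

lemma links_insert_self {x : V} {A : Finset V} (hx : x ∉ A) :
    G.links (insert x A) (insert x A) = G.links A A + 2 * G.degIn A x := by
  have hd : Disjoint {x} A := by simpa using hx
  rw [Finset.insert_eq, links_union_left hd, links_union_right _ hd, links_union_right _ hd,
    links_singleton_left, links_singleton_left, links_singleton_right, degIn_singleton]
  simp
  ring

lemma two_mul_size (A : Finset V) : 2 * G.size A = G.links A A := by
  unfold size
  have : Even (G.links A A) := by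
    induction A using Finset.induction_on with
    | empty => simp [links]
    | insert x A hx ih =>
      rw [links_insert_self hx]
      exact ih.add (even_two_mul _)
  exact Nat.two_mul_div_two_of_even this

lemma size_union {A B : Finset V} (h : Disjoint A B) :
    G.size (A ∪ B) = G.size A + G.size B + G.links A B := by
  have := two_mul_size (G := G) (A ∪ B)
  rw [links_union_left h, links_union_right _ h, links_union_right _ h, links_comm B A,
    ← two_mul_size, ← two_mul_size] at this
  omega

@[simp] lemma size_singleton (v : V) : G.size {v} = 0 := by
  simp [size, degIn_singleton]

lemma size_insert {x : V} {A : Finset V} (hx : x ∉ A) :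
    G.size (insert x A) = G.size A + G.degIn A x := by
  have hd : Disjoint {x} A := by simpa using hx
  rw [Finset.insert_eq, size_union hd]
  simp

lemma size_erase {x : V} {A : Finset V} (hx : x ∈ A) :
    G.size A = G.size (A.erase x) + G.degIn A x := by
  conv_lhs => rw [← Finset.insert_erase hx]
  rw [size_insert (Finset.notMem_erase x A), degIn_erase]

lemma size_mono {A B : Finset V} (h : A ⊆ B) : G.size A ≤ G.size B := by
  have := links_mono (G := G) h h
  rw [← two_mul_size, ← two_mul_size] at this
  omega

lemma sum_degIn {X A : Finset V} (h : X ⊆ A) :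
    ∑ x ∈ X, G.degIn A x = 2 * G.size X + G.links X (A \ X) := by
  rw [two_mul_size, ← links_union_right _ Finset.disjoint_sdiff, Finset.union_sdiff_of_subset h]
  rfl

/-! ### Cores -/

lemma Hits.mono {D D' S S' : Finset V} (hD : D ⊆ D') (hS : S ⊆ S') (h : G.Hits D S) :
    G.Hits D' S' := by
  obtain ⟨s, hs, d, hd, h⟩ := h
  exact ⟨s, hS hs, d, hD hd, h⟩

lemma Hits.of_mem {D S : Finset V} {x : V} (h1 : x ∈ D) (h2 : x ∈ S) : G.Hits D S :=
  ⟨x, h2, x, h1, Or.inl rfl⟩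

lemma Hits.of_adj {D S : Finset V} {x y : V} (h1 : x ∈ D) (h2 : y ∈ S) (h : G.Adj x y) :
    G.Hits D S :=
  ⟨y, h2, x, h1, Or.inr h⟩

variable {k : ℕ}

lemma IsCore.le_card {S : Finset V} (h : G.IsCore k S) : k ≤ S.card := by
  obtain ⟨⟨s, hs⟩, h⟩ := h
  exact (h s hs).trans (degIn_add_one_le hs)

lemma HitsCores.mono {A A' D D' : Finset V} (hA : A' ⊆ A) (hD : D ⊆ D')
    (h : G.HitsCores k A D) : G.HitsCores k A' D' :=
  fun S hS hc => (h S (hS.trans hA) hc).mono hD subset_rfl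

/-- The part of a core in a subset without edges to the rest of the core is a core. -/
lemma IsCore.inter {S C : Finset V} (h : G.IsCore k S) (hne : (S ∩ C).Nonempty)
    (hcl : ∀ c ∈ S ∩ C, ∀ s ∈ S, G.Adj c s → s ∈ C) : G.IsCore k (S ∩ C) := by
  refine ⟨hne, fun s hs => (h.2 s (Finset.mem_inter.1 hs).1).trans ?_⟩
  gcongr
  apply Finset.card_le_card
  intro w hw
  rw [Finset.mem_filter] at hw ⊢
  exact ⟨Finset.mem_inter.2 ⟨hw.1, hcl s hs w hw.1 hw.2⟩, hw.2⟩

/-- A core inside `A` avoids vertices of small degree. -/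
lemma HitsCores.of_erase {A D : Finset V} {v : V} (hv : G.degIn A v + 1 < k)
    (h : G.HitsCores k (A.erase v) D) : G.HitsCores k A D := by
  intro S hS hc
  refine h S (fun s hs => Finset.mem_erase.2 ⟨?_, hS hs⟩) hc
  rintro rfl
  have := hc.2 s hs
  have := degIn_mono (G := G) hS s
  omega

/-! ### Components -/

lemma mem_pieces {B C : Finset V} : C ∈ G.pieces B ↔
    C ⊆ B ∧ G.Conn C ∧ ∀ c ∈ C, ∀ b ∈ B, G.Adj c b → b ∈ C := by
  simp [pieces]

/-- The component is a smallest closed set containing `b`. If it had a proper non-empty closed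
subset `S`, then `S` or its complement in `C` would be a smaller closed set containing `b`. -/
lemma exists_piece {B : Finset V} {b : V} (hb : b ∈ B) : ∃ C ∈ G.pieces B, b ∈ C := by
  have hne : (B.powerset.filter fun C => b ∈ C ∧ ∀ c ∈ C, ∀ b ∈ B, G.Adj c b → b ∈ C).Nonempty :=
    ⟨B, by simp [hb]; tauto⟩
  obtain ⟨C, hC, hmin⟩ := Finset.exists_min_image _ Finset.card hne
  simp only [Finset.mem_filter, Finset.mem_powerset] at hC hmin
  obtain ⟨hCB, hbC, hcl⟩ := hC
  refine ⟨C, mem_pieces.2 ⟨hCB, ⟨⟨b, hbC⟩, fun S hS hSne hScl => ?_⟩, hcl⟩, hbC⟩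
  by_cases hbS : b ∈ S
  · refine Finset.eq_of_subset_of_card_le hS (hmin S ⟨hS.trans hCB, hbS, fun c hc b hb hcb => ?_⟩)
    exact hScl c hc b (hcl c (hS hc) b hb hcb) hcb
  · exfalso
    have := hmin (C \ S) ⟨Finset.sdiff_subset.trans hCB, Finset.mem_sdiff.2 ⟨hbC, hbS⟩, ?_⟩
    · have h2 := Finset.card_sdiff_add_card_eq_card hS
      have h3 := Finset.card_pos.2 hSne
      omega
    · intro c hc b hb hcb
      rw [Finset.mem_sdiff] at hc ⊢
      refine ⟨hcl c hc.1 b hb hcb, fun hbS => hc.2 ?_⟩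
      exact hScl b hbS c hc.1 hcb.symm

lemma pieces_eq_of_mem {B C C' : Finset V} (hC : C ∈ G.pieces B) (hC' : C' ∈ G.pieces B) {b : V}
    (hb : b ∈ C) (hb' : b ∈ C') : C = C' := by
  rw [mem_pieces] at hC hC'
  have key : ∀ {C C' : Finset V}, C ⊆ B → G.Conn C →
      (∀ c ∈ C', ∀ b ∈ B, G.Adj c b → b ∈ C') → b ∈ C → b ∈ C' → C ⊆ C' := by
    intro C C' hB hconn hcl hb hb'
    have := hconn.2 (C ∩ C') Finset.inter_subset_left ⟨b, Finset.mem_inter.2 ⟨hb, hb'⟩⟩ ?_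
    · rw [← this]; exact Finset.inter_subset_right
    · intro s hs a ha hsa
      rw [Finset.mem_inter] at hs ⊢
      exact ⟨ha, hcl s hs.2 a (hB ha) hsa⟩
  exact (key hC.1 hC.2.1 hC'.2.2 hb hb').antisymm (key hC'.1 hC'.2.1 hC.2.2 hb' hb)

lemma pieces_disjoint {B C C' : Finset V} (hC : C ∈ G.pieces B) (hC' : C' ∈ G.pieces B)
    (h : C ≠ C') : Disjoint C C' :=
  Finset.disjoint_left.2 fun _ hb hb' => h (pieces_eq_of_mem hC hC' hb hb')

lemma biUnion_pieces (B : Finset V) : (G.pieces B).biUnion id = B := by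
  ext b
  simp only [Finset.mem_biUnion, id]
  constructor
  · rintro ⟨C, hC, hb⟩; exact (mem_pieces.1 hC).1 hb
  · intro hb
    obtain ⟨C, hC, h⟩ := exists_piece (G := G) hb
    exact ⟨C, hC, h⟩

lemma links_pieces (X B : Finset V) : G.links X B = ∑ C ∈ G.pieces B, G.links X C := by
  conv_lhs => rw [← biUnion_pieces (G := G) B]
  rw [links_comm]
  unfold links
  rw [Finset.sum_biUnion]
  · refine Finset.sum_congr rfl fun C _ => ?_
    exact links_comm C X
  · intro C hC C' hC' h
    exact pieces_disjoint hC hC' h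

lemma size_pieces (B : Finset V) : G.size B = ∑ C ∈ G.pieces B, G.size C := by
  have : 2 * G.size B = 2 * ∑ C ∈ G.pieces B, G.size C := by
    rw [two_mul_size, links_pieces, Finset.mul_sum]
    refine Finset.sum_congr rfl fun C hC => ?_
    rw [two_mul_size, links_comm, links_pieces]
    refine Finset.sum_eq_single_of_mem C hC fun C' hC' h => ?_
    refine links_eq_zero fun a ha b hb hab => h ?_
    exact pieces_eq_of_mem hC' hC hb ((mem_pieces.1 hC).2.2 a ha b ((mem_pieces.1 hC').1 hb) hab)
  omega

/-- The balance sheet of the deletion arguments: there are no edges between different components of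
the rest. -/
lemma size_eq_add_sum_pieces {X A : Finset V} (h : X ⊆ A) :
    G.size A = G.size X + ∑ C ∈ G.pieces (A \ X), (G.size C + G.links X C) := by
  conv_lhs => rw [← Finset.union_sdiff_of_subset h]
  rw [size_union Finset.disjoint_sdiff, size_pieces (A \ X), links_pieces, Finset.sum_add_distrib]
  ring

lemma Conn.exists_adj_piece {A X C : Finset V} (hA : G.Conn A) (hXA : X ⊆ A) (hX : X.Nonempty)
    (hC : C ∈ G.pieces (A \ X)) : ∃ x ∈ X, ∃ c ∈ C, G.Adj x c := by
  rw [mem_pieces] at hC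
  by_contra hcon
  push Not at hcon
  have hCA := hA.2 C (hC.1.trans Finset.sdiff_subset) hC.2.1.1 ?_
  · obtain ⟨x, hx⟩ := hX
    have : x ∈ C := hCA ▸ hXA hx
    exact (Finset.mem_sdiff.1 (hC.1 this)).2 hx
  · intro c hc a ha hca
    by_cases hax : a ∈ X
    · exact absurd hca.symm (hcon a hax c hc)
    · exact hC.2.2 c hc a (Finset.mem_sdiff.2 ⟨ha, hax⟩) hca

lemma Conn.links_piece_pos {A X C : Finset V} (hA : G.Conn A) (hXA : X ⊆ A) (hX : X.Nonempty)
    (hC : C ∈ G.pieces (A \ X)) : 0 < G.links X C :=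
  links_pos.2 (hA.exists_adj_piece hXA hX hC)

/-- A core that avoids `X` contains a core in some component of `A \ X`. -/
lemma IsCore.exists_piece {A X S : Finset V} (hS : G.IsCore k S) (hSA : S ⊆ A)
    (hSX : Disjoint S X) : ∃ C ∈ G.pieces (A \ X), G.IsCore k (S ∩ C) := by
  obtain ⟨s, hs⟩ := hS.1
  have hsub : S ⊆ A \ X := fun s hs =>
    Finset.mem_sdiff.2 ⟨hSA hs, Finset.disjoint_left.1 hSX hs⟩
  obtain ⟨C, hC, hsC⟩ := SimpleGraph.exists_piece (G := G) (hsub hs)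
  refine ⟨C, hC, hS.inter ⟨s, Finset.mem_inter.2 ⟨hs, hsC⟩⟩ fun c hc b hb hcb => ?_⟩
  exact (mem_pieces.1 hC).2.2 c (Finset.mem_inter.1 hc).2 b (hsub hb) hcb

/-- A core disjoint from `X` restricts to a core inside one component, so only cores meeting `X`
require an argument of their own. -/
lemma hitsCores_of_pieces {A X D : Finset V}
    (hX : ∀ S ⊆ A, G.IsCore k S → ¬ Disjoint S X → G.Hits D S)
    (hC : ∀ C ∈ G.pieces (A \ X), G.HitsCores k C D) : G.HitsCores k A D := by
  intro S hS hcore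
  by_cases hd : Disjoint S X
  · obtain ⟨C, hCm, hCc⟩ := hcore.exists_piece hS hd
    exact (hC C hCm (S ∩ C) Finset.inter_subset_right hCc).mono subset_rfl Finset.inter_subset_left
  · exact hX S hS hcore hd

/-! ### Cliques -/

lemma IsKClique.degIn {U : Finset V} (h : G.IsKClique k U) {x : V} (hx : x ∈ U) :
    G.degIn U x + 1 = k := by
  have : U.filter (G.Adj x) = U.erase x := by
    ext y
    simp only [Finset.mem_filter, Finset.mem_erase]
    constructor
    · rintro ⟨h1, h2⟩; exact ⟨h2.ne', h1⟩
    · rintro ⟨h1, h2⟩; exact ⟨h2, h.2 x hx y h2 h1.symm⟩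
  unfold SimpleGraph.degIn
  rw [this, Finset.card_erase_of_mem hx, h.1]
  have := Finset.card_pos.2 ⟨x, hx⟩
  have := h.1
  omega

lemma IsKClique.size {U : Finset V} (h : G.IsKClique k U) : G.size U = k.choose 2 := by
  have h1 : ∑ x ∈ U, G.degIn U x = U.card * (k - 1) := by
    rw [Finset.sum_congr rfl fun x hx => show G.degIn U x = k - 1 by have := h.degIn hx; omega]
    simp
  rw [Nat.choose_two_right, SimpleGraph.size]
  unfold links
  rw [h1, h.1]

lemma IsKClique.eq_of_core {U S : Finset V} (h : G.IsKClique k U) (hS : G.IsCore k S)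
    (hSU : S ⊆ U) : S = U :=
  Finset.eq_of_subset_of_card_le hSU (h.1.trans_le hS.le_card)

lemma IsKClique.hits {U S D : Finset V} (h : G.IsKClique k U) {x y : V} (hx : x ∈ U) (hy : y ∈ U)
    (hyS : y ∈ S) (hxD : x ∈ D) : G.Hits D S := by
  by_cases hxy : x = y
  · subst hxy; exact Hits.of_mem hxD hyS
  · exact Hits.of_adj hxD hyS (h.2 x hx y hy hxy)

/-- A graph with `k` vertices that is not a clique misses an edge. -/
lemma two_mul_size_of_not_isKClique {U : Finset V} (hc : U.card = k) (h : ¬ G.IsKClique k U) :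
    2 * G.size U + 2 ≤ k * (k - 1) := by
  unfold IsKClique at h
  push Not at h
  obtain ⟨x, hx, y, hy, hxy, hadj⟩ := h hc
  have h1 : ∀ v ∈ U, G.degIn U v ≤ k - 1 := fun v hv => by
    have := degIn_add_one_le (G := G) hv
    omega
  have h2 : ∀ {x y : V}, x ∈ U → y ∈ U → x ≠ y → ¬ G.Adj x y → G.degIn U x + 1 ≤ k - 1 := by
    intro x y hx hy hxy hadj
    have : U.filter (G.Adj x) ⊆ (U.erase x).erase y := by
      intro w hw
      rw [Finset.mem_filter] at hw
      refine Finset.mem_erase.2 ⟨?_, Finset.mem_erase.2 ⟨hw.2.ne', hw.1⟩⟩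
      rintro rfl
      exact hadj hw.2
    have := Finset.card_le_card this
    have hy' : y ∈ U.erase x := Finset.mem_erase.2 ⟨hxy.symm, hy⟩
    rw [Finset.card_erase_of_mem hy', Finset.card_erase_of_mem hx, hc] at this
    have h3 := Finset.card_pos.2 ⟨y, hy'⟩
    rw [Finset.card_erase_of_mem hx, hc] at h3
    unfold degIn
    omega
  rw [two_mul_size]
  unfold links
  have hxy' : y ∈ U.erase x := Finset.mem_erase.2 ⟨hxy.symm, hy⟩
  rw [← Finset.add_sum_erase _ _ hx, ← Finset.add_sum_erase _ _ hxy']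
  have h4 : ∑ v ∈ (U.erase x).erase y, G.degIn U v ≤ ((U.erase x).erase y).card * (k - 1) :=
    Finset.sum_le_card_nsmul _ _ _ fun v hv =>
      h1 v (Finset.mem_of_mem_erase (Finset.mem_of_mem_erase hv))
  have h5 := h2 hx hy hxy hadj
  have h6 := h2 hy hx hxy.symm (fun h => hadj h.symm)
  have h7 : ((U.erase x).erase y).card + 2 = k := by
    have a := Finset.card_erase_add_one hxy'
    have b := Finset.card_erase_add_one hx
    omega
  have h8 : k * (k - 1) = ((U.erase x).erase y).card * (k - 1) + 2 * (k - 1) := by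
    rw [← add_mul, h7]
  omega

end Isolation

/-! ### Pure special graphs -/

section Isolation

open scoped Classical

variable {V : Type u} (G : SimpleGraph V)

/-- The edges of `G[A]` form a pure special graph with set of roots `R`; the root `r` is joined
to the vertex `a r` of the `k`-clique `U r`. -/
structure IsPureWith (k : ℕ) (R A : Finset V) (U : V → Finset V) (a : V → V) : Prop where
  conn : G.Conn R
  size_roots : G.size R + 1 = R.card
  card_eq : ∀ r ∈ R, (U r).card = k
  att_mem : ∀ r ∈ R, a r ∈ U r
  disj_roots : ∀ r ∈ R, Disjoint (U r) R
  disj : ∀ r ∈ R, ∀ r' ∈ R, r ≠ r' → Disjoint (U r) (U r')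
  cover : A = R ∪ R.biUnion U
  adj_iff : ∀ r ∈ R, ∀ u ∈ U r, ∀ w ∈ A, G.Adj u w ↔ (w ∈ U r ∧ w ≠ u) ∨ (u = a r ∧ w = r)
  size_eq : G.size A + 1 = R.card * (k.choose 2 + 2)

/-- `G[A]` is a pure special graph with set of roots `R`. -/
def IsPure (k : ℕ) (R A : Finset V) : Prop := ∃ U a, G.IsPureWith k R A U a

/-- `G[A]` is a cycle on `n` vertices. -/
def IsCyc (n : ℕ) (A : Finset V) : Prop :=
  ∃ c : Fin n → V, Function.Injective c ∧ A = Finset.univ.image c ∧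
    ∀ i j, G.Adj (c i) (c j) ↔ (cycleGraph n).Adj i j

/-- `G[A]` is one of the graphs that attain the bound. -/
def Extremal (k : ℕ) (A : Finset V) : Prop :=
  (∃ R, G.IsPure k R A) ∨ (k = 2 ∧ G.IsCyc 5 A) ∨ (k = 3 ∧ G.IsCyc 4 A)

variable {G} {k : ℕ} {R A : Finset V} {U : V → Finset V} {a : V → V}

namespace IsPureWith

lemma roots_subset (h : G.IsPureWith k R A U a) : R ⊆ A := by
  rw [h.cover]; exact Finset.subset_union_left

lemma clique_subset (h : G.IsPureWith k R A U a) {r : V} (hr : r ∈ R) : U r ⊆ A := by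
  rw [h.cover]
  exact (Finset.subset_biUnion_of_mem U hr).trans Finset.subset_union_right

lemma clique (h : G.IsPureWith k R A U a) {r : V} (hr : r ∈ R) : G.IsKClique k (U r) :=
  ⟨h.card_eq r hr, fun x hx y hy hxy =>
    (h.adj_iff r hr x hx y (h.clique_subset hr hy)).2 (Or.inl ⟨hy, hxy.symm⟩)⟩

lemma adj_att (h : G.IsPureWith k R A U a) {r : V} (hr : r ∈ R) : G.Adj (a r) r :=
  (h.adj_iff r hr _ (h.att_mem r hr) r (h.roots_subset hr)).2 (Or.inr ⟨rfl, rfl⟩)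

lemma mem_cases (h : G.IsPureWith k R A U a) {x : V} (hx : x ∈ A) :
    x ∈ R ∨ ∃ r ∈ R, x ∈ U r := by
  rw [h.cover, Finset.mem_union, Finset.mem_biUnion] at hx
  exact hx

/-- A vertex `s` of the clique `U r` has small degree in a set `S` that misses a vertex of the
clique, unless `s` is the attachment vertex and `r ∈ S`. -/
lemma degIn_lt (h : G.IsPureWith k R A U a) {S : Finset V} (hS : S ⊆ A) {r s y : V} (hr : r ∈ R)
    (hs : s ∈ U r) (hsS : s ∈ S) (hy : y ∈ U r) (hyS : y ∉ S) (hrs : s = a r → r ∉ S) :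
    G.degIn S s + 1 < k := by
  have hsub : S.filter (G.Adj s) ⊆ ((U r).erase s).erase y := by
    intro w hw
    rw [Finset.mem_filter] at hw
    have hwy : w ≠ y := by rintro rfl; exact hyS hw.1
    rcases (h.adj_iff r hr s hs w (hS hw.1)).1 hw.2 with h1 | h1
    · exact Finset.mem_erase.2 ⟨hwy, Finset.mem_erase.2 ⟨h1.2, h1.1⟩⟩
    · exact absurd (h1.2 ▸ hw.1) (hrs h1.1)
  have := Finset.card_le_card hsub
  have hys : y ∈ (U r).erase s := Finset.mem_erase.2 ⟨by rintro rfl; exact hyS hsS, hy⟩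
  have h1 := Finset.card_erase_add_one hys
  have h2 := Finset.card_erase_add_one hs
  have h3 := h.card_eq r hr
  unfold degIn
  omega

/-- A transversal of the constituents that dominates all but one of the roots hits all cores. -/
lemma hitsCores_transversal (h : G.IsPureWith k R A U a) (hk : 1 ≤ k) (p : V → V)
    (hp : ∀ r ∈ R, p r = r ∨ p r ∈ U r) (r₀ : V)
    (hdom : ∀ r ∈ R, r ≠ r₀ → G.Hits (R.image p) {r}) : G.HitsCores k A (R.image p) := by
  intro S hS hc
  by_contra hh
  have hpD : ∀ r ∈ R, p r ∈ R.image p := fun r hr => Finset.mem_image_of_mem p hr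
  by_cases hU : ∃ r ∈ R, ∃ s ∈ U r, s ∈ S
  · obtain ⟨r, hr, s, hs, hsS⟩ := hU
    have hpr : p r = r := by
      refine (hp r hr).resolve_right fun hpr => hh ?_
      exact (h.clique hr).hits hpr hs hsS (hpD r hr)
    have hrD : r ∈ R.image p := by have := hpD r hr; rwa [hpr] at this
    -- The chosen vertex is `r`, so `r` and `a r` are both dominated and absent from `S`; then `s`
    -- has too few neighbours in `S`.
    have := h.degIn_lt hS hr hs hsS (h.att_mem r hr)
      (fun ha => hh (Hits.of_adj hrD ha (h.adj_att hr).symm)) fun _ hrS => hh (Hits.of_mem hrD hrS)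
    have := hc.2 s hsS
    omega
  · push Not at hU
    -- A core of roots can only be `{r₀}`, the one root possibly undominated. This forces `k = 1`,
    -- and then either choice of `p r₀` dominates `r₀`.
    have hSr : ∀ s ∈ S, s ∈ R ∧ s = r₀ := by
      intro s hs
      have hsR : s ∈ R := (h.mem_cases (hS hs)).resolve_right fun ⟨r, hr, hsr⟩ => hU r hr s hsr hs
      refine ⟨hsR, by_contra fun hne => hh ?_⟩
      exact (hdom s hsR hne).mono subset_rfl (by simpa using hs)
    obtain ⟨s, hs⟩ := hc.1
    have hS1 : S ⊆ {r₀} := fun s hs => by simpa using (hSr s hs).2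
    have h1 := hc.le_card
    have h2 := Finset.card_le_card hS1
    rw [Finset.card_singleton] at h2
    have hk1 : k = 1 := by omega
    obtain ⟨hsR, -⟩ := hSr s hs
    rcases hp s hsR with hps | hps
    · exact hh (Hits.of_mem (by have := hpD s hsR; rwa [hps] at this) hs)
    · obtain ⟨z, hz⟩ := Finset.card_eq_one.1 ((h.card_eq s hsR).trans hk1)
      have ha := h.att_mem s hsR
      rw [hz, Finset.mem_singleton] at ha hps
      exact hh (Hits.of_adj (hpD s hsR) hs (by rw [hps, ← ha]; exact h.adj_att hsR))

/-- The set consists of the roots, with `x` in place of the root of its constituent. Later `x` is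
the end of a link, so that the other end gets dominated at no cost. -/
lemma exists_mem_hitsCores (h : G.IsPureWith k R A U a) (hk : 1 ≤ k) {x : V} (hx : x ∈ A) :
    ∃ D, x ∈ D ∧ D.card ≤ R.card ∧ G.HitsCores k A D := by
  rcases h.mem_cases hx with hx | ⟨r, hr, hx⟩
  · refine ⟨R.image id, by simpa using hx, Finset.card_image_le, ?_⟩
    exact h.hitsCores_transversal hk id (fun _ _ => Or.inl rfl) x
      fun r hr _ => Hits.of_mem (x := r) (by simpa using hr) (by simp)
  · refine ⟨R.image fun r' => if r' = r then x else r',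
      Finset.mem_image.2 ⟨r, hr, by simp⟩, Finset.card_image_le, ?_⟩
    refine h.hitsCores_transversal hk _ (fun r' hr' => ?_) r fun r' hr' hne => ?_
    · by_cases hrr : r' = r
      · subst hrr; simp [hx]
      · simp [hrr]
    · exact Hits.of_mem (x := r') (Finset.mem_image.2 ⟨r', hr', by simp [hne]⟩) (by simp)

/-- Every root has a neighbour among the roots unless it is the only root. -/
lemma exists_adj_root (h : G.IsPureWith k R A U a) {r : V} (hr : r ∈ R) (hR : R ≠ {r}) :
    ∃ r' ∈ R, r' ≠ r ∧ G.Adj r' r := by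
  by_contra hcon
  push Not at hcon
  refine hR (h.conn.2 {r} (by simpa using hr) (by simp) ?_).symm
  intro s hs w hw hsw
  rw [Finset.mem_singleton] at hs ⊢
  subst hs
  by_contra hne
  exact hcon w hw hne hsw.symm

/-- The roots other than `r` suffice: `r` is dominated by another root if there is one, and without
`y` the remaining vertices of `U r` have too small a degree. This breaks down only for a path on
three vertices with end `y` (`k = 2`) and for a single edge (`k = 1`). -/
lemma erase_clique_vertex (h : G.IsPureWith k R A U a) {r y : V} (hr : r ∈ R)
    (hy : y ∈ U r) :
    (∃ D, D.card + 1 ≤ R.card ∧ G.HitsCores k (A.erase y) D) ∨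
      (R = {r} ∧ (k = 2 ∧ y ≠ a r ∨ k = 1)) := by
  by_cases hcase : R = {r} ∧ (k = 2 ∧ y ≠ a r ∨ k = 1)
  · exact Or.inr hcase
  refine Or.inl ⟨R.erase r, (Finset.card_erase_add_one hr).le, fun S hS hc => ?_⟩
  by_contra hh
  have hSA : S ⊆ A := hS.trans (Finset.erase_subset _ _)
  have hyS : y ∉ S := fun h => Finset.notMem_erase y A (hS h)
  have hrS : r ∈ S → R = {r} := by
    intro hrS
    by_contra hR
    obtain ⟨r', hr', hne, hadj⟩ := h.exists_adj_root hr hR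
    exact hh (Hits.of_adj (Finset.mem_erase.2 ⟨hne, hr'⟩) hrS hadj)
  have key : ∀ r' ∈ R, ∀ s ∈ U r', s ∈ S → r' = r ∧ s = a r ∧ r ∈ S := by
    intro r' hr' s hs hsS
    by_cases hrr : r' = r
    · subst hrr
      refine ⟨rfl, ?_⟩
      by_contra hcon
      push Not at hcon
      have := h.degIn_lt hSA hr hs hsS hy hyS hcon
      have := hc.2 s hsS
      omega
    · exfalso
      have hrD : r' ∈ R.erase r := Finset.mem_erase.2 ⟨hrr, hr'⟩
      have := h.degIn_lt hSA hr' hs hsS (h.att_mem r' hr')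
        (fun ha => hh (Hits.of_adj hrD ha (h.adj_att hr').symm))
        fun _ hrS => hh (Hits.of_mem hrD hrS)
      have := hc.2 s hsS
      omega
  have hS2 : ∀ s ∈ S, s = r ∨ (s = a r ∧ r ∈ S) := by
    intro s hs
    rcases h.mem_cases (hSA hs) with hsR | ⟨r', hr', hsr⟩
    · by_contra hcon
      push Not at hcon
      exact hh (Hits.of_mem (Finset.mem_erase.2 ⟨hcon.1, hsR⟩) hs)
    · exact Or.inr (key r' hr' s hsr hs).2
  obtain ⟨s, hs⟩ := hc.1
  have hrS' : r ∈ S := (hS2 s hs).elim (fun h => h ▸ hs) (fun h => h.2)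
  have hR := hrS hrS'
  have hk1 : 1 ≤ k := by rw [← h.card_eq r hr]; exact Finset.card_pos.2 ⟨y, hy⟩
  have hk2 : k ≤ 2 := by
    refine hc.le_card.trans ((Finset.card_le_card (t := {r, a r}) fun s hs => ?_).trans
      Finset.card_le_two)
    have := hS2 s hs
    simp only [Finset.mem_insert, Finset.mem_singleton]
    tauto
  have hk3 : k = 2 := by
    by_contra hne
    exact hcase ⟨hR, Or.inr (by omega)⟩
  refine hcase ⟨hR, Or.inl ⟨hk3, ?_⟩⟩
  rintro rfl
  have hS1 : S ⊆ {r} := by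
    intro s hs
    rcases hS2 s hs with h1 | ⟨h1, -⟩
    · simpa using h1
    · exact absurd (h1 ▸ hs) hyS
  have := Finset.card_le_card hS1
  have := hc.le_card
  rw [Finset.card_singleton] at *
  omega

end IsPureWith

/-- A vertex with a pendant `k`-clique. -/
lemma IsKClique.isPure_insert {W : Finset V} (h : G.IsKClique k W) {x y : V} (hx : x ∉ W)
    (hy : y ∈ W) (hxy : G.Adj x y) (huniq : ∀ w ∈ W, G.Adj x w → w = y) :
    G.IsPure k {x} (insert x W) := by
  refine ⟨fun _ => W, fun _ => y, ⟨⟨by simp, ?_⟩, by simp, fun _ _ => h.1, fun _ _ => hy,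
    fun r hr => ?_, ?_, ?_, ?_, ?_⟩⟩
  · intro S hS hne _
    exact (Finset.subset_singleton_iff.1 hS).resolve_left hne.ne_empty
  · rw [Finset.mem_singleton] at hr
    simpa using hx
  · intro r hr r' hr' hne
    simp only [Finset.mem_singleton] at hr hr'
    exact absurd (hr.trans hr'.symm) hne
  · rw [Finset.singleton_biUnion, Finset.insert_eq]
  · intro r hr u hu w hw
    rw [Finset.mem_singleton] at hr
    subst hr
    rw [Finset.mem_insert] at hw
    constructor
    · intro huw
      rcases hw with rfl | hw
      · exact Or.inr ⟨huniq u hu huw.symm, rfl⟩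
      · exact Or.inl ⟨hw, huw.ne'⟩
    · rintro (⟨hwW, hne⟩ | ⟨rfl, rfl⟩)
      · exact h.2 u hu w hwW hne.symm
      · exact hxy.symm
  · rw [size_insert hx, h.size]
    have : G.degIn W x = 1 := by
      unfold SimpleGraph.degIn
      rw [Finset.card_eq_one]
      refine ⟨y, ?_⟩
      ext w
      simp only [Finset.mem_filter, Finset.mem_singleton]
      exact ⟨fun hw => huniq w hw.1 hw.2, by rintro rfl; exact ⟨hy, hxy⟩⟩
    rw [this]
    simp

/-- In the exceptional cases a path or an edge can be read from its other end, which makes `y` the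
root. -/
lemma IsPureWith.exists_root_or_erase (h : G.IsPureWith k R A U a) {y : V} (hy : y ∈ A) :
    (∃ D, D.card + 1 ≤ R.card ∧ G.HitsCores k (A.erase y) D) ∨
      ∃ R', y ∈ R' ∧ G.IsPure k R' A := by
  rcases h.mem_cases hy with hyR | ⟨r, hr, hyU⟩
  · exact Or.inr ⟨R, hyR, U, a, h⟩
  rcases h.erase_clique_vertex hr hyU with h1 | ⟨rfl, hk⟩
  · exact Or.inl h1
  refine Or.inr ⟨{y}, by simp, ?_⟩
  have hA : A = insert r (U r) := by rw [h.cover, Finset.singleton_biUnion, Finset.insert_eq]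
  have hrU : r ∉ U r := fun hrU => Finset.disjoint_left.1 (h.disj_roots r hr) hrU hr
  rcases hk with ⟨rfl, hya⟩ | rfl
  · have hya' : a r ∈ (U r).erase y := Finset.mem_erase.2 ⟨hya.symm, h.att_mem r hr⟩
    have hUe : (U r).erase y = {a r} := by
      refine (Finset.eq_of_subset_of_card_le (by simpa using hya') ?_).symm
      rw [Finset.card_erase_of_mem hyU, h.card_eq r hr, Finset.card_singleton]
    have hU2 : U r = {y, a r} := by rw [← Finset.insert_erase hyU, hUe]
    have har : a r ≠ r := (h.adj_att hr).ne
    have hyr : y ≠ r := fun h => hrU (h ▸ hyU)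
    have hnyr : ¬ G.Adj y r := by
      rw [h.adj_iff r hr y hyU r (h.roots_subset hr)]
      rintro (h1 | h1)
      · exact hrU h1.1
      · exact hya h1.1
    have hcl : G.IsKClique 2 {r, a r} := by
      refine ⟨Finset.card_pair har.symm, ?_⟩
      have := h.adj_att hr
      simp only [Finset.mem_insert, Finset.mem_singleton]
      rintro x (rfl | rfl) z (rfl | rfl) hne
      · exact absurd rfl hne
      · exact this.symm
      · exact this
      · exact absurd rfl hne
    have := hcl.isPure_insert (x := y) (y := a r) (by simp [hyr, hya]) (by simp)
      ((h.clique hr).2 y hyU _ (h.att_mem r hr) hya) ?_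
    · rw [hA, hU2, Finset.insert_comm]
      exact this
    · simp only [Finset.mem_insert, Finset.mem_singleton]
      rintro w (rfl | rfl) hw
      · exact absurd hw hnyr
      · rfl
  · obtain ⟨z, hz⟩ := Finset.card_eq_one.1 (h.card_eq r hr)
    have ha := h.att_mem r hr
    rw [hz, Finset.mem_singleton] at ha hyU
    subst hyU
    have hadj := h.adj_att hr
    rw [ha] at hadj
    have hcl : G.IsKClique 1 {r} := ⟨rfl, fun x hx z hz hne => by
      rw [Finset.mem_singleton] at hx hz
      exact absurd (hx.trans hz.symm) hne⟩
    have := hcl.isPure_insert (x := y) (y := r) (by simpa using hadj.ne) (by simp) hadj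
      (fun w hw _ => by simpa using hw)
    rw [hA, hz, Finset.pair_comm]
    exact this

/-- Joining two pure special graphs by an edge between two roots. -/
lemma IsPure.union {R' A' : Finset V} (h : G.IsPure k R A) (h' : G.IsPure k R' A')
    (hd : Disjoint A A') {x y : V} (hx : x ∈ R) (hy : y ∈ R') (hxy : G.Adj x y)
    (huniq : ∀ z ∈ A, ∀ w ∈ A', G.Adj z w → z = x ∧ w = y) :
    G.IsPure k (R ∪ R') (A ∪ A') := by
  obtain ⟨U, a, h⟩ := h
  obtain ⟨U', a', h'⟩ := h'
  have hRA := h.roots_subset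
  have hRA' := h'.roots_subset
  have hdA : ∀ {z}, z ∈ A → z ∉ A' := fun hz => Finset.disjoint_left.1 hd hz
  have hdR : Disjoint R R' := Finset.disjoint_of_subset_left hRA
    (Finset.disjoint_of_subset_right hRA' hd)
  have hlink : ∀ {B B' : Finset V}, B ⊆ A → B' ⊆ A' → x ∈ B → y ∈ B' → G.links B B' = 1 := by
    intro B B' hB hB' hxB hyB
    rw [links_eq_card, Finset.card_eq_one]
    refine ⟨(x, y), ?_⟩
    ext ⟨z, w⟩
    simp only [Finset.mem_filter, Finset.mem_product, Finset.mem_singleton, Prod.mk.injEq]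
    constructor
    · rintro ⟨⟨hz, hw⟩, hzw⟩; exact huniq z (hB hz) w (hB' hw) hzw
    · rintro ⟨rfl, rfl⟩; exact ⟨⟨hxB, hyB⟩, hxy⟩
  have hnR : ∀ r ∈ R', r ∉ R := fun r hr hr' => Finset.disjoint_left.1 hdR hr' hr
  refine ⟨fun r => if r ∈ R then U r else U' r, fun r => if r ∈ R then a r else a' r,
    ⟨⟨⟨x, Finset.mem_union_left _ hx⟩, ?_⟩, ?_, ?_, ?_, ?_, ?_, ?_, ?_, ?_⟩⟩
  · intro S hS hne hcl
    have h1 : (S ∩ R).Nonempty → S ∩ R = R := fun hne => h.conn.2 _ Finset.inter_subset_right hne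
      fun s hs w hw hsw => Finset.mem_inter.2
        ⟨hcl s (Finset.mem_inter.1 hs).1 w (Finset.mem_union_left _ hw) hsw, hw⟩
    have h2 : (S ∩ R').Nonempty → S ∩ R' = R' := fun hne =>
      h'.conn.2 _ Finset.inter_subset_right hne
      fun s hs w hw hsw => Finset.mem_inter.2
        ⟨hcl s (Finset.mem_inter.1 hs).1 w (Finset.mem_union_right _ hw) hsw, hw⟩
    have h3 : (S ∩ R).Nonempty ∧ (S ∩ R').Nonempty := by
      obtain ⟨s, hs⟩ := hne
      rcases Finset.mem_union.1 (hS hs) with hsR | hsR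
      · have hne1 : (S ∩ R).Nonempty := ⟨s, Finset.mem_inter.2 ⟨hs, hsR⟩⟩
        have hxS : x ∈ S := Finset.inter_subset_left ((h1 hne1).symm ▸ hx)
        exact ⟨hne1, y, Finset.mem_inter.2 ⟨hcl x hxS y (Finset.mem_union_right _ hy) hxy, hy⟩⟩
      · have hne1 : (S ∩ R').Nonempty := ⟨s, Finset.mem_inter.2 ⟨hs, hsR⟩⟩
        have hyS : y ∈ S := Finset.inter_subset_left ((h2 hne1).symm ▸ hy)
        exact ⟨⟨x, Finset.mem_inter.2 ⟨hcl y hyS x (Finset.mem_union_left _ hx) hxy.symm, hx⟩⟩, hne1⟩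
    refine hS.antisymm (Finset.union_subset ?_ ?_)
    · rw [← h1 h3.1]; exact Finset.inter_subset_left
    · rw [← h2 h3.2]; exact Finset.inter_subset_left
  · rw [size_union hdR, hlink hRA hRA' hx hy, Finset.card_union_of_disjoint hdR]
    have := h.size_roots
    have := h'.size_roots
    omega
  · intro r hr
    by_cases hrR : r ∈ R
    · simpa [hrR] using h.card_eq r hrR
    · simpa [hrR] using h'.card_eq r ((Finset.mem_union.1 hr).resolve_left hrR)
  · intro r hr
    by_cases hrR : r ∈ R
    · simpa [hrR] using h.att_mem r hrR
    · simpa [hrR] using h'.att_mem r ((Finset.mem_union.1 hr).resolve_left hrR)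
  · intro r hr
    by_cases hrR : r ∈ R
    · simp only [hrR, if_true]
      exact Finset.disjoint_union_right.2 ⟨h.disj_roots r hrR, Finset.disjoint_of_subset_left
        (h.clique_subset hrR) (Finset.disjoint_of_subset_right hRA' hd)⟩
    · have hr' := (Finset.mem_union.1 hr).resolve_left hrR
      simp only [hrR, if_false]
      exact Finset.disjoint_union_right.2 ⟨Finset.disjoint_of_subset_left
        (h'.clique_subset hr') (Finset.disjoint_of_subset_right hRA hd.symm), h'.disj_roots r hr'⟩
  · intro r hr s hs hne
    by_cases hrR : r ∈ R <;> by_cases hsR : s ∈ R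
    · simpa [hrR, hsR] using h.disj r hrR s hsR hne
    · have hs' := (Finset.mem_union.1 hs).resolve_left hsR
      simp only [hrR, hsR, if_true, if_false]
      exact Finset.disjoint_of_subset_left (h.clique_subset hrR)
        (Finset.disjoint_of_subset_right (h'.clique_subset hs') hd)
    · have hr' := (Finset.mem_union.1 hr).resolve_left hrR
      simp only [hrR, hsR, if_true, if_false]
      exact Finset.disjoint_of_subset_left (h'.clique_subset hr')
        (Finset.disjoint_of_subset_right (h.clique_subset hsR) hd.symm)
    · have hr' := (Finset.mem_union.1 hr).resolve_left hrR
      have hs' := (Finset.mem_union.1 hs).resolve_left hsR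
      simpa [hrR, hsR] using h'.disj r hr' s hs' hne
  · ext z
    simp only [Finset.mem_union, Finset.mem_biUnion]
    rw [show z ∈ A ↔ z ∈ R ∨ ∃ r ∈ R, z ∈ U r by
        conv_lhs => rw [h.cover]
        simp,
      show z ∈ A' ↔ z ∈ R' ∨ ∃ r ∈ R', z ∈ U' r by
        conv_lhs => rw [h'.cover]
        simp]
    constructor
    · rintro ((h1 | ⟨r, hr, h1⟩) | (h1 | ⟨r, hr, h1⟩))
      · exact Or.inl (Or.inl h1)
      · exact Or.inr ⟨r, Or.inl hr, by simpa [hr] using h1⟩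
      · exact Or.inl (Or.inr h1)
      · exact Or.inr ⟨r, Or.inr hr, by simpa [hnR r hr] using h1⟩
    · rintro ((h1 | h1) | ⟨r, hr, h1⟩)
      · exact Or.inl (Or.inl h1)
      · exact Or.inr (Or.inl h1)
      · by_cases hrR : r ∈ R
        · exact Or.inl (Or.inr ⟨r, hrR, by simpa [hrR] using h1⟩)
        · exact Or.inr (Or.inr ⟨r, hr.resolve_left hrR, by simpa [hrR] using h1⟩)
  · intro r hr u hu w hw
    by_cases hrR : r ∈ R
    · simp only [hrR, if_true] at hu ⊢
      have huA := h.clique_subset hrR hu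
      rcases Finset.mem_union.1 hw with hwA | hwA
      · exact h.adj_iff r hrR u hu w hwA
      · refine iff_of_false (fun huw => ?_) ?_
        · obtain ⟨rfl, -⟩ := huniq u huA w hwA huw
          exact Finset.disjoint_left.1 (h.disj_roots r hrR) hu hx
        · rintro (h1 | ⟨-, rfl⟩)
          · exact hdA (h.clique_subset hrR h1.1) hwA
          · exact hdA (hRA hrR) hwA
    · have hr' := (Finset.mem_union.1 hr).resolve_left hrR
      simp only [hrR, if_false] at hu ⊢
      have huA := h'.clique_subset hr' hu
      rcases Finset.mem_union.1 hw with hwA | hwA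
      · refine iff_of_false (fun huw => ?_) ?_
        · obtain ⟨-, rfl⟩ := huniq w hwA u huA huw.symm
          exact Finset.disjoint_left.1 (h'.disj_roots r hr') hu hy
        · rintro (h1 | ⟨-, rfl⟩)
          · exact hdA hwA (h'.clique_subset hr' h1.1)
          · exact hdA hwA (hRA' hr')
      · exact h'.adj_iff r hr' u hu w hwA
  · rw [size_union hd, hlink subset_rfl subset_rfl (hRA hx) (hRA' hy),
      Finset.card_union_of_disjoint hdR, add_mul]
    have := h.size_eq
    have := h'.size_eq
    omega

end Isolation

/-! ### Smallest isolating sets of extremal graphs with prescribed vertices -/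

section Isolation

open scoped Classical

variable {V : Type u} {G : SimpleGraph V} {k n : ℕ} {R A : Finset V} {U : V → Finset V} {a : V → V}

lemma IsCyc.size_eq (h : G.IsCyc n A) (hn : ∀ i : Fin n, (cycleGraph n).degree i = 2) :
    G.size A = n := by
  obtain ⟨c, hinj, rfl, hadj⟩ := h
  have h1 : ∀ i, G.degIn (Finset.univ.image c) (c i) = 2 := by
    intro i
    rw [← hn i, ← card_neighborFinset_eq_degree, degIn, Finset.filter_image,
      Finset.card_image_of_injective _ hinj]
    congr 1
    ext j
    simp [hadj]
  have h2 := two_mul_size (G := G) (Finset.univ.image c)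
  unfold links at h2
  rw [Finset.sum_image fun i _ j _ h => hinj h, Finset.sum_congr rfl fun i _ => h1 i] at h2
  simp at h2
  omega

lemma IsCyc.size_five (h : G.IsCyc 5 A) : G.size A = 5 := h.size_eq (by decide)

lemma IsCyc.size_four (h : G.IsCyc 4 A) : G.size A = 4 := h.size_eq (by decide)

/-- A non-empty set without isolated vertices contains an edge. -/
lemma IsCore.exists_adj {S : Finset V} (h : G.IsCore 2 S) : ∃ s ∈ S, ∃ s' ∈ S, G.Adj s s' := by
  obtain ⟨s, hs⟩ := h.1
  have := h.2 s hs
  obtain ⟨s', hs', h'⟩ := degIn_pos.1 (show 0 < G.degIn S s by omega)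
  exact ⟨s, hs, s', hs', h'⟩

lemma IsCyc.hitsCores_pair (h : G.IsCyc 5 A) {x y : V} (hx : x ∈ A) (hy : y ∈ A) (hxy : x ≠ y) :
    G.HitsCores 2 A {x, y} := by
  obtain ⟨c, hinj, rfl, hadj⟩ := h
  have key : ∀ i j p q : Fin 5, i ≠ j → (cycleGraph 5).Adj p q →
      p = i ∨ p = j ∨ q = i ∨ q = j ∨ (cycleGraph 5).Adj i p ∨ (cycleGraph 5).Adj j p ∨
      (cycleGraph 5).Adj i q ∨ (cycleGraph 5).Adj j q := by decide
  simp only [Finset.mem_image, Finset.mem_univ, true_and] at hx hy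
  obtain ⟨i, rfl⟩ := hx
  obtain ⟨j, rfl⟩ := hy
  intro S hS hc
  obtain ⟨s, hs, s', hs', hss⟩ := hc.exists_adj
  obtain ⟨p, -, rfl⟩ := Finset.mem_image.1 (hS hs)
  obtain ⟨q, -, rfl⟩ := Finset.mem_image.1 (hS hs')
  have hi : c i ∈ ({c i, c j} : Finset V) := by simp
  have hj : c j ∈ ({c i, c j} : Finset V) := by simp
  rcases key i j p q (fun h => hxy (by rw [h])) ((hadj p q).1 hss) with
    rfl | rfl | rfl | rfl | h | h | h | h
  · exact Hits.of_mem hi hs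
  · exact Hits.of_mem hj hs
  · exact Hits.of_mem hi hs'
  · exact Hits.of_mem hj hs'
  · exact Hits.of_adj hi hs ((hadj _ _).2 h)
  · exact Hits.of_adj hj hs ((hadj _ _).2 h)
  · exact Hits.of_adj hi hs' ((hadj _ _).2 h)
  · exact Hits.of_adj hj hs' ((hadj _ _).2 h)

lemma IsCyc.hitsCores_erase_five (h : G.IsCyc 5 A) {y : V} (hy : y ∈ A) :
    ∃ x, G.HitsCores 2 (A.erase y) {x} := by
  obtain ⟨c, hinj, rfl, hadj⟩ := h
  have key : ∀ i : Fin 5, ∃ j : Fin 5, ∀ p q : Fin 5, p ≠ i → q ≠ i → (cycleGraph 5).Adj p q →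
      p = j ∨ q = j ∨ (cycleGraph 5).Adj j p ∨ (cycleGraph 5).Adj j q := by decide
  simp only [Finset.mem_image, Finset.mem_univ, true_and] at hy
  obtain ⟨i, rfl⟩ := hy
  obtain ⟨j, hj⟩ := key i
  refine ⟨c j, fun S hS hc => ?_⟩
  obtain ⟨s, hs, s', hs', hss⟩ := hc.exists_adj
  obtain ⟨hp, p, -, rfl⟩ := by simpa only [Finset.mem_erase, Finset.mem_image] using hS hs
  obtain ⟨hq, q, -, rfl⟩ := by simpa only [Finset.mem_erase, Finset.mem_image] using hS hs'
  have hj' : c j ∈ ({c j} : Finset V) := by simp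
  rcases hj p q (fun h => hp (by rw [h])) (fun h => hq (by rw [h])) ((hadj p q).1 hss) with
    rfl | rfl | h | h
  · exact Hits.of_mem hj' hs
  · exact Hits.of_mem hj' hs'
  · exact Hits.of_adj hj' hs ((hadj _ _).2 h)
  · exact Hits.of_adj hj' hs' ((hadj _ _).2 h)

/-- All degrees are 2, so a core contains every neighbour of each of its vertices. -/
lemma IsCyc.core_eq_four (h : G.IsCyc 4 A) {S : Finset V} (hS : S ⊆ A) (hc : G.IsCore 3 S) :
    S = A := by
  obtain ⟨c, hinj, rfl, hadj⟩ := h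
  have h1 : ∀ i, G.degIn (Finset.univ.image c) (c i) = 2 := by
    intro i
    have : (cycleGraph 4).degree i = 2 := by revert i; decide
    rw [← this, ← card_neighborFinset_eq_degree, degIn, Finset.filter_image,
      Finset.card_image_of_injective _ hinj]
    congr 1
    ext j
    simp [hadj]
  have hcl : ∀ i j, c i ∈ S → (cycleGraph 4).Adj i j → c j ∈ S := by
    intro i j hi hij
    have h2 := hc.2 _ hi
    have h3 := Finset.eq_of_subset_of_card_le (Finset.filter_subset_filter (G.Adj (c i)) hS)
      (by have := h1 i; unfold degIn at this h2; omega)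
    have : c j ∈ (Finset.univ.image c).filter (G.Adj (c i)) := by simp [hadj, hij]
    rw [← h3] at this
    exact (Finset.mem_filter.1 this).1
  refine hS.antisymm fun x hx => ?_
  obtain ⟨s, hs⟩ := hc.1
  obtain ⟨i, -, rfl⟩ := Finset.mem_image.1 (hS hs)
  obtain ⟨j, -, rfl⟩ := Finset.mem_image.1 hx
  have key : ∀ i j : Fin 4, i = j ∨ (cycleGraph 4).Adj i j ∨
      ∃ m, (cycleGraph 4).Adj i m ∧ (cycleGraph 4).Adj m j := by decide
  rcases key i j with rfl | h | ⟨m, h, h'⟩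
  · exact hs
  · exact hcl i j hs h
  · exact hcl m j (hcl i m hs h) h'

/-! ### Extremal graphs -/

lemma IsPureWith.card_roots (h : G.IsPureWith k R A U a)
    (ht : (k.choose 2 + 2) * n = G.size A + 1) : R.card = n := by
  have := h.size_eq
  rw [mul_comm, ← ht] at this
  exact (Nat.eq_of_mul_eq_mul_left (Nat.succ_pos _) this).symm

/-- Here `ht` says that `n` is the value of the bound: the number of roots, 2 for the 5-cycle and 1
for the 4-cycle. -/
lemma Extremal.exists_mem_hitsCores (h : G.Extremal k A) (hk : 1 ≤ k)
    (ht : (k.choose 2 + 2) * n = G.size A + 1) {x : V} (hx : x ∈ A) :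
    ∃ D, x ∈ D ∧ D.card ≤ n ∧ G.HitsCores k A D := by
  rcases h with ⟨R, U, a, h⟩ | ⟨rfl, h⟩ | ⟨rfl, h⟩
  · have : R.card = n := h.card_roots ht
    exact this ▸ h.exists_mem_hitsCores hk hx
  · have h5 := h.size_five
    rw [h5] at ht
    simp at ht
    obtain ⟨y, hy, hne⟩ : ∃ y ∈ A, x ≠ y := by
      obtain ⟨c, hinj, rfl, -⟩ := h
      obtain ⟨i, -, rfl⟩ := Finset.mem_image.1 hx
      exact ⟨c (i + 1), by simp, fun h => by simpa using hinj h⟩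
    refine ⟨{x, y}, by simp, Finset.card_le_two.trans (by omega), h.hitsCores_pair hx hy hne⟩
  · have h4 := h.size_four
    rw [h4] at ht
    simp [Nat.choose] at ht
    refine ⟨{x}, by simp, by simp; omega, fun S hS hc => ?_⟩
    exact Hits.of_mem (x := x) (by simp) (by rwa [h.core_eq_four hS hc])

/-- Used when `y` is dominated from outside `A`: one vertex is saved, unless `y` can serve as a root
for gluing. -/
lemma Extremal.exists_root_or_erase (h : G.Extremal k A)
    (ht : (k.choose 2 + 2) * n = G.size A + 1) {y : V} (hy : y ∈ A) :
    (∃ D, D.card + 1 ≤ n ∧ G.HitsCores k (A.erase y) D) ∨ ∃ R, y ∈ R ∧ G.IsPure k R A := by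
  rcases h with ⟨R, U, a, h⟩ | ⟨rfl, h⟩ | ⟨rfl, h⟩
  · have : R.card = n := h.card_roots ht
    exact this ▸ h.exists_root_or_erase hy
  · have h5 := h.size_five
    rw [h5] at ht
    simp at ht
    obtain ⟨x, hx⟩ := h.hitsCores_erase_five hy
    exact Or.inl ⟨{x}, by simp; omega, hx⟩
  · have h4 := h.size_four
    rw [h4] at ht
    simp [Nat.choose] at ht
    refine Or.inl ⟨∅, by simp; omega, fun S hS hc => ?_⟩
    have := h.core_eq_four (hS.trans (Finset.erase_subset _ _)) hc
    exact absurd (hS (this ▸ hy)) (Finset.notMem_erase y A)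

/-- A smallest isolating set of an extremal graph (`k = 2`) that dominates two given vertices and
contains one of them. -/
lemma Extremal.exists_hitsCores_pair (h : G.Extremal 2 A) (ht : 3 * n = G.size A + 1) {x y : V}
    (hx : x ∈ A) (hy : y ∈ A) (hxy : x ≠ y) :
    (∃ D, D.card ≤ n ∧ G.HitsCores 2 A D ∧ G.Hits D {x} ∧ G.Hits D {y} ∧ (x ∈ D ∨ y ∈ D)) ∨
      (n = 1 ∧ ∃ z, A = {x, z, y} ∧ z ≠ x ∧ z ≠ y ∧ G.Adj x z ∧ G.Adj z y ∧ ¬ G.Adj x y) := by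
  rcases h with ⟨R, U, a, h⟩ | ⟨-, h⟩ | ⟨h, -⟩
  · have hRn : R.card = n := h.card_roots ht
    have hitself : ∀ {D : Finset V} {v}, v ∈ D → G.Hits D {v} := fun hv =>
      Hits.of_mem hv (Finset.mem_singleton_self _)
    have hrep : ∀ z ∈ A, ∃ r ∈ R, z = r ∨ z ∈ U r := fun z hz => by
      rcases h.mem_cases hz with h1 | ⟨r, hr, h1⟩
      · exact ⟨z, h1, Or.inl rfl⟩
      · exact ⟨r, hr, Or.inr h1⟩
    -- The attachment vertex dominates its whole constituent.
    have hdomatt : ∀ {D : Finset V} {r z}, r ∈ R → (z = r ∨ z ∈ U r) → a r ∈ D → G.Hits D {z} := by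
      intro D r z hr hz ha
      rcases hz with rfl | hz
      · exact Hits.of_adj ha (Finset.mem_singleton_self _) (h.adj_att hr)
      · exact (h.clique hr).hits (h.att_mem r hr) hz (Finset.mem_singleton_self _) ha
    -- the representative of `r` is replaced by `v`, all others are roots
    have hone : ∀ r ∈ R, ∀ v, (v = r ∨ v ∈ U r) →
        ∃ D, D.card ≤ n ∧ G.HitsCores 2 A D ∧ v ∈ D ∧ ∀ r' ∈ R, r' ≠ r → r' ∈ D := by
      intro r hr v hv
      refine ⟨R.image fun r' => if r' = r then v else r', hRn ▸ Finset.card_image_le,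
        h.hitsCores_transversal (by omega) _ (fun r' hr' => ?_) r fun r' hr' hne => ?_,
        Finset.mem_image.2 ⟨r, hr, by simp⟩,
        fun r' hr' hne => Finset.mem_image.2 ⟨r', hr', by simp [hne]⟩⟩
      · by_cases hrr : r' = r
        · subst hrr; simpa using hv
        · simp [hrr]
      · exact hitself (Finset.mem_image.2 ⟨r', hr', by simp [hne]⟩)
    obtain ⟨r, hr, hxr⟩ := hrep x hx
    obtain ⟨s, hs, hys⟩ := hrep y hy
    -- For `k = 2` a constituent is a path on three vertices with middle `a r`. If `x` and `y` are
    -- its two ends, the one other than the root is chosen, and the root is dominated by a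
    -- neighbouring root; a sole constituent is the exceptional path.
    by_cases hrs : r = s
    · subst hrs
      by_cases hxa : x = a r
      · obtain ⟨D, h1, h2, h3, -⟩ := hone r hr x hxr
        exact Or.inl ⟨D, h1, h2, hitself h3, hdomatt hr hys (hxa ▸ h3), Or.inl h3⟩
      by_cases hya : y = a r
      · obtain ⟨D, h1, h2, h3, -⟩ := hone r hr y hys
        exact Or.inl ⟨D, h1, h2, hdomatt hr hxr (hya ▸ h3), hitself h3, Or.inr h3⟩
      have hpair : ∀ {z}, z ∈ U r → z ≠ a r → U r = {z, a r} := by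
        intro z hz hza
        refine (Finset.eq_of_subset_of_card_le ?_ ?_).symm
        · intro w hw
          rcases Finset.mem_insert.1 hw with rfl | hw
          · exact hz
          · rw [Finset.mem_singleton.1 hw]; exact h.att_mem r hr
        · rw [h.card_eq r hr, Finset.card_pair hza]
      have hrU : r ∉ U r := fun hrU => Finset.disjoint_left.1 (h.disj_roots r hr) hrU hr
      have hcase : (x = r ∧ y ∈ U r) ∨ (x ∈ U r ∧ y = r) := by
        rcases hxr with hxr | hxr <;> rcases hys with hys | hys
        · exact absurd (hxr.trans hys.symm) hxy
        · exact Or.inl ⟨hxr, hys⟩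
        · exact Or.inr ⟨hxr, hys⟩
        · rw [hpair hxr hxa] at hys
          simp only [Finset.mem_insert, Finset.mem_singleton] at hys
          rcases hys with hys | hys
          · exact absurd hys.symm hxy
          · exact absurd hys hya
      by_cases hR : R = {r}
      · refine Or.inr ⟨by rw [← hRn, hR]; rfl, a r, ?_, Ne.symm hxa, Ne.symm hya, ?_⟩
        · have hA : A = insert r (U r) := by
            rw [h.cover, hR, Finset.singleton_biUnion, Finset.insert_eq]
          rcases hcase with ⟨rfl, hyU⟩ | ⟨hxU, rfl⟩
          · rw [hA, hpair hyU hya, Finset.pair_comm]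
          · rw [hA, hpair hxU hxa, Finset.insert_comm, Finset.pair_comm]
        · rcases hcase with ⟨rfl, hyU⟩ | ⟨hxU, rfl⟩
          · refine ⟨(h.adj_att hr).symm, (h.clique hr).2 _ (h.att_mem _ hr) _ hyU (Ne.symm hya),
              fun hadj => ?_⟩
            rcases (h.adj_iff _ hr y hyU _ hx).1 hadj.symm with h1 | h1
            · exact hrU h1.1
            · exact hya h1.1
          · refine ⟨(h.clique hr).2 _ hxU _ (h.att_mem _ hr) hxa, h.adj_att hr, fun hadj => ?_⟩
            rcases (h.adj_iff _ hr x hxU _ hy).1 hadj with h1 | h1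
            · exact hrU h1.1
            · exact hxa h1.1
      · obtain ⟨r', hr', hne, hadj⟩ := h.exists_adj_root hr hR
        rcases hcase with ⟨rfl, hyU⟩ | ⟨hxU, rfl⟩
        · obtain ⟨D, h1, h2, h3, h4⟩ := hone _ hr y (Or.inr hyU)
          exact Or.inl ⟨D, h1, h2, Hits.of_adj (h4 r' hr' hne) (Finset.mem_singleton_self _) hadj,
            hitself h3, Or.inr h3⟩
        · obtain ⟨D, h1, h2, h3, h4⟩ := hone _ hr x (Or.inr hxU)
          exact Or.inl ⟨D, h1, h2, hitself h3,
            Hits.of_adj (h4 r' hr' hne) (Finset.mem_singleton_self _) hadj, Or.inl h3⟩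
    -- Different constituents: `x` represents its own, and `a s` represents the one of `y`. Only the
    -- root `r` may stay undominated, as the transversal lemma allows.
    · have hsr : s ≠ r := fun h => hrs h.symm
      set p : V → V := fun r' => if r' = r then x else if r' = s then a s else r' with hp
      have hxD : x ∈ R.image p := Finset.mem_image.2 ⟨r, hr, by simp [hp]⟩
      have haD : a s ∈ R.image p := Finset.mem_image.2 ⟨s, hs, by simp [hp, hsr]⟩
      refine Or.inl ⟨R.image p, hRn ▸ Finset.card_image_le,
        h.hitsCores_transversal (by omega) p (fun r' hr' => ?_) r fun r' hr' hne => ?_,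
        hitself hxD, hdomatt hs hys haD, Or.inl hxD⟩
      · by_cases h1 : r' = r
        · subst h1; simpa [hp] using hxr
        · by_cases h2 : r' = s
          · subst h2
            exact Or.inr (by simpa [hp, h1] using h.att_mem r' hs)
          · simp [hp, h1, h2]
      · by_cases h2 : r' = s
        · exact hdomatt hs (Or.inl h2) haD
        · exact hitself (Finset.mem_image.2 ⟨r', hr', by simp [hp, hne, h2]⟩)
  · rw [h.size_five] at ht
    refine Or.inl ⟨{x, y}, Finset.card_le_two.trans (by omega), h.hitsCores_pair hx hy hxy, ?_, ?_,
      Or.inl (by simp)⟩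
    · exact Hits.of_mem (x := x) (by simp) (by simp)
    · exact Hits.of_mem (x := y) (by simp) (by simp)
  · omega

end Isolation

/-! ### The bound with its equality case; graphs without `k`-cliques for `k ≥ 4` -/

section Isolation

open scoped Classical

variable {V : Type u} (G : SimpleGraph V)

/-- `G[A]` has an isolating set that attains the bound only if `G[A]` is extremal. -/
def Bounded (k : ℕ) (A : Finset V) : Prop :=
  ∃ D, G.HitsCores k A D ∧ ((k.choose 2 + 2) * D.card ≤ G.size A ∨
    ((k.choose 2 + 2) * D.card = G.size A + 1 ∧ G.Extremal k A))

variable {G} {k : ℕ} {A : Finset V}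

lemma two_mul_choose_two (k : ℕ) : 2 * k.choose 2 = k * (k - 1) := by
  rw [Nat.choose_two_right]
  exact Nat.two_mul_div_two_of_even (Nat.even_mul_pred_self k)

/-- Removing `N[v]` for a vertex `v`: the vertex `v` hits all cores that meet `N[v]`. -/
lemma HitsCores.of_closedNbhd {D : Finset V} {v : V} (hv : v ∈ A)
    (h : G.HitsCores k (A \ insert v (A.filter (G.Adj v))) D) :
    G.HitsCores k A (insert v D) := by
  intro S hS hc
  by_cases hd : Disjoint S (insert v (A.filter (G.Adj v)))
  · refine (h S (fun s hs => ?_) hc).mono (Finset.subset_insert _ _) subset_rfl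
    exact Finset.mem_sdiff.2 ⟨hS hs, Finset.disjoint_left.1 hd hs⟩
  · obtain ⟨s, hs, hs'⟩ := Finset.not_disjoint_iff.1 hd
    rcases Finset.mem_insert.1 hs' with rfl | hs'
    · exact Hits.of_mem (Finset.mem_insert_self _ _) hs
    · exact Hits.of_adj (Finset.mem_insert_self _ _) hs (Finset.mem_filter.1 hs').2

lemma card_closedNbhd (A : Finset V) (v : V) :
    (insert v (A.filter (G.Adj v))).card = G.degIn A v + 1 := by
  rw [Finset.card_insert_of_notMem (by simp)]
  rfl

lemma size_sdiff {X : Finset V} (h : X ⊆ A) :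
    G.size A = G.size X + G.size (A \ X) + G.links X (A \ X) := by
  conv_lhs => rw [← Finset.union_sdiff_of_subset h]
  exact size_union Finset.disjoint_sdiff

/-- A graph without `k`-cliques, `k ≥ 4`, satisfies a stronger bound. -/
lemma exists_hitsCores_of_cliqueFree (hk : 4 ≤ k) (A : Finset V)
    (hA : ∀ W ⊆ A, ¬ G.IsKClique k W) :
    ∃ D, G.HitsCores k A D ∧ (k.choose 2 + 2) * D.card ≤ G.size A := by
  induction A using Finset.strongInduction with
  | H A ih =>
  have hch := two_mul_choose_two k
  rcases A.eq_empty_or_nonempty with rfl | hne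
  · refine ⟨∅, fun S hS hc => ?_, by simp⟩
    obtain ⟨s, hs⟩ := hc.1
    simpa using hS hs
  by_cases hlow : ∃ v ∈ A, G.degIn A v + 1 < k
  · obtain ⟨v, hv, hdeg⟩ := hlow
    obtain ⟨D, hD, hcard⟩ := ih (A.erase v) (Finset.erase_ssubset hv)
      fun W hW => hA W (hW.trans (Finset.erase_subset _ _))
    exact ⟨D, hD.of_erase hdeg, hcard.trans (size_mono (Finset.erase_subset _ _))⟩
  push Not at hlow
  obtain ⟨v, hv, hmax⟩ := Finset.exists_max_image A (G.degIn A) hne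
  set X := insert v (A.filter (G.Adj v)) with hX
  have hXA : X ⊆ A := Finset.insert_subset hv (Finset.filter_subset _ _)
  have hXcard : X.card = G.degIn A v + 1 := card_closedNbhd A v
  have hXne : v ∈ X := Finset.mem_insert_self _ _
  have hsum := sum_degIn (G := G) hXA
  have hsize := size_sdiff (G := G) hXA
  have hvk := hlow v hv
  -- The vertex `v` is paid for as soon as deleting `Y` removes `(k.choose 2) + 2` edges.
  have step : ∀ Y, v ∈ Y → Y ⊆ A → (∀ D, G.HitsCores k (A \ Y) D → G.HitsCores k (A \ X) D) →
      k.choose 2 + 2 + G.size (A \ Y) ≤ G.size A →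
      ∃ D, G.HitsCores k A D ∧ (k.choose 2 + 2) * D.card ≤ G.size A := by
    intro Y hvY hYA hYX hY
    obtain ⟨D, hD, hcard⟩ := ih (A \ Y) (Finset.sdiff_ssubset hYA ⟨v, hvY⟩)
      fun W hW => hA W (hW.trans Finset.sdiff_subset)
    refine ⟨insert v D, (hYX D hD).of_closedNbhd hv, ?_⟩
    have := Nat.mul_le_mul_left (k.choose 2 + 2) (Finset.card_insert_le v D)
    rw [mul_add, mul_one] at this
    omega
  by_cases hbig : k ≤ G.degIn A v
  · refine step X hXne hXA (fun _ h => h) ?_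
    -- The number of edges meeting `X` is at least half of this degree sum, hence at least
    -- `(k.choose 2) + k / 2`; here `4 ≤ k` supplies the 2.
    have h1 : G.degIn A v + G.degIn A v * (k - 1) ≤ ∑ x ∈ X, G.degIn A x := by
      rw [hX, Finset.sum_insert (by simp)]
      refine Nat.add_le_add_left ?_ _
      have := Finset.card_nsmul_le_sum (A.filter (G.Adj v)) (G.degIn A) (k - 1) fun x hx => by
        have := hlow x (Finset.mem_filter.1 hx).1
        omega
      exact this
    have h2 : k + k * (k - 1) ≤ G.degIn A v + G.degIn A v * (k - 1) :=
      Nat.add_le_add hbig (Nat.mul_le_mul_right _ hbig)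
    omega
  · have hdeg : G.degIn A v + 1 = k := by omega
    have hreg : ∀ w ∈ A, G.degIn A w = k - 1 := fun w hw => by
      have := hmax w hw
      have := hlow w hw
      omega
    rw [Finset.sum_congr rfl fun x hx => hreg x (hXA hx), Finset.sum_const, smul_eq_mul, hXcard,
      hdeg] at hsum
    have hX2 := two_mul_size_of_not_isKClique (hXcard.trans hdeg) (hA X hXA)
    by_cases hl : 4 ≤ G.links X (A \ X)
    · exact step X hXne hXA (fun _ h => h) (by omega)
    -- By the degree sum the number of links is even, and the edge missing in `X` makes it positive.
    -- With two links, deleting `X` removes one edge too few. A linked vertex `w` outside has at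
    -- least `k - 3 ≥ 1` further edges and at most `k - 2` neighbours outside `X`; so it lies in no
    -- remaining core and its deletion supplies the missing edge.
    · have hl2 : G.links X (A \ X) = 2 := by omega
      obtain ⟨x, hx, w, hw, hxw⟩ := links_pos.1 (show 0 < G.links X (A \ X) by omega)
      have hwA := (Finset.mem_sdiff.1 hw).1
      have hdw : G.degIn A w = G.degIn X w + G.degIn (A \ X) w := by
        rw [← degIn_union Finset.disjoint_sdiff, Finset.union_sdiff_of_subset hXA]
      have hdw2 : G.degIn X w ≤ G.links X (A \ X) := by
        rw [← links_singleton_right]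
        exact links_mono subset_rfl (by simpa using hw)
      have hdw3 : 1 ≤ G.degIn X w := degIn_pos.2 ⟨x, hx, hxw.symm⟩
      have hregw := hreg w hwA
      have hse := size_erase (G := G) hw
      have hY : A \ insert w X = (A \ X).erase w := Finset.sdiff_insert A X w
      refine step (insert w X) (Finset.mem_insert_of_mem hXne) (Finset.insert_subset hwA hXA) ?_ ?_
      · intro D hD
        rw [hY] at hD
        exact hD.of_erase (by omega)
      · rw [hY]
        omega

/-! ### Pendant cliques -/

/-- A clique `C` is hit by `x` for free. If `C` is extremal and its only link ends at `y`, then `x`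
hits the cores through `y`, which saves a vertex unless `y` can be taken as a root. -/
lemma exists_hitsCores_piece_of_pendant {x : V} {C : Finset V}
    (ih : ¬ G.IsKClique k C → G.Bounded k C) (hlink : 0 < G.links {x} C) :
    ∃ D, G.HitsCores k C (insert x D) ∧
      ((k.choose 2 + 2) * D.card + 1 ≤ G.size C + G.links {x} C ∨
        ((k.choose 2 + 2) * D.card = G.size C + 1 ∧ G.links {x} C = 1 ∧
          ∃ R y, y ∈ R ∧ G.IsPure k R C ∧ G.Adj x y)) := by
  by_cases hC : G.IsKClique k C
  · refine ⟨∅, fun S hS hc => ?_, Or.inl (by rw [Finset.card_empty]; omega)⟩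
    obtain ⟨x', hx', y, hy, hxy⟩ := links_pos.1 hlink
    rw [Finset.mem_singleton] at hx'
    subst hx'
    rw [hC.eq_of_core hc hS]
    exact Hits.of_adj (Finset.mem_insert_self _ _) hy hxy
  · obtain ⟨D, hD, hcase⟩ := ih hC
    have hD' : G.HitsCores k C (insert x D) := hD.mono subset_rfl (Finset.subset_insert _ _)
    rcases hcase with h | ⟨ht, hE⟩
    · exact ⟨D, hD', Or.inl (by omega)⟩
    by_cases hl : G.links {x} C = 1
    · obtain ⟨x', hx', y, hy, hxy, huniq⟩ := links_eq_one hl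
      rw [Finset.mem_singleton] at hx'
      subst hx'
      rcases hE.exists_root_or_erase ht hy with ⟨D', hcard, hD'⟩ | ⟨R, hyR, hR⟩
      · refine ⟨D', fun S hS hc => ?_, Or.inl ?_⟩
        · by_cases hyS : y ∈ S
          · exact Hits.of_adj (Finset.mem_insert_self _ _) hyS hxy
          · exact (hD' S (Finset.subset_erase.2 ⟨hS, hyS⟩) hc).mono (Finset.subset_insert _ _)
              subset_rfl
        · have := Nat.mul_le_mul_left (k.choose 2 + 2) hcard
          rw [mul_add, mul_one] at this
          omega
      · exact ⟨D, hD', Or.inr ⟨ht, hl, R, y, hyR, hR, hxy⟩⟩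
    · exact ⟨D, hD', Or.inl (by omega)⟩

lemma pieces_ssubset {X C : Finset V} (hX : X ⊆ A) (hne : X.Nonempty)
    (hC : C ∈ G.pieces (A \ X)) : C ⊂ A :=
  (mem_pieces.1 hC).1.trans_ssubset (Finset.sdiff_ssubset hX hne)

lemma mul_card_biUnion_le (t : ℕ) (P : Finset (Finset V)) (D : Finset V → Finset V) :
    t * (P.biUnion D).card ≤ ∑ C ∈ P, t * (D C).card := by
  rw [← Finset.mul_sum]
  exact Nat.mul_le_mul_left _ Finset.card_biUnion_le

/-- The clique `K` and one link to it repay all but 1 of the price of `x`. Any surplus elsewhere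
makes the inequality strict; with none, `K` has one link and all other components are pure and
attached to `x` by one edge at a root. -/
lemma bounded_of_pendant_clique
    (ih : ∀ B, B ⊂ A → G.Conn B → ¬ G.IsKClique k B → G.Bounded k B) (hA : G.Conn A) {x : V}
    (hx : x ∈ A) {K : Finset V} (hK : K ∈ G.pieces (A \ {x})) (hKc : G.IsKClique k K) :
    G.Bounded k A := by
  have hxA : {x} ⊆ A := by simpa using hx
  have hpos := fun {C} hC => hA.links_piece_pos (C := C) hxA (Finset.singleton_nonempty x) hC
  have hex : ∀ C ∈ G.pieces (A \ {x}), ∃ D, G.HitsCores k C (insert x D) ∧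
      ((k.choose 2 + 2) * D.card + 1 ≤ G.size C + G.links {x} C ∨
        ((k.choose 2 + 2) * D.card = G.size C + 1 ∧ G.links {x} C = 1 ∧
          ∃ R y, y ∈ R ∧ G.IsPure k R C ∧ G.Adj x y)) := fun C hC =>
    exists_hitsCores_piece_of_pendant
      (ih C (pieces_ssubset hxA (Finset.singleton_nonempty x) hC) (mem_pieces.1 hC).2.1) (hpos hC)
  choose! D hD hcase using hex
  set P := (G.pieces (A \ {x})).erase K with hP
  have hPmem : ∀ C ∈ P, C ∈ G.pieces (A \ {x}) := fun C hC => Finset.mem_of_mem_erase hC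
  have hsize := size_eq_add_sum_pieces (G := G) hxA
  rw [size_singleton, zero_add, ← Finset.add_sum_erase _ _ hK, hKc.size, ← hP] at hsize
  have hlK := hpos hK
  obtain ⟨x', hx', y, hyK, hxy⟩ := links_pos.1 hlK
  rw [Finset.mem_singleton] at hx'
  subst hx'
  have hhit : G.HitsCores k A (insert x' (P.biUnion D)) := by
    refine hitsCores_of_pieces (X := {x'}) (fun S hS hc hd => ?_) fun C hC => ?_
    · refine Hits.of_mem (Finset.mem_insert_self _ _) ?_
      simpa using hd
    · by_cases hCK : C = K
      · subst hCK
        intro S hS hc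
        rw [hKc.eq_of_core hc hS]
        exact Hits.of_adj (Finset.mem_insert_self _ _) hyK hxy
      · refine (hD C hC).mono subset_rfl (Finset.insert_subset_insert _ ?_)
        exact Finset.subset_biUnion_of_mem D (Finset.mem_erase.2 ⟨hCK, hC⟩)
  have hcard : (k.choose 2 + 2) * (insert x' (P.biUnion D)).card ≤
      k.choose 2 + 2 + ∑ C ∈ P, (k.choose 2 + 2) * (D C).card := by
    refine (Nat.mul_le_mul_left _ (Finset.card_insert_le _ _)).trans ?_
    rw [mul_add, mul_one, add_comm]
    exact Nat.add_le_add_left (mul_card_biUnion_le _ _ _) _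
  have hle : ∀ C ∈ P, (k.choose 2 + 2) * (D C).card ≤ G.size C + G.links {x'} C := fun C hC => by
    rcases hcase C (hPmem C hC) with h | ⟨h, h', -⟩ <;> omega
  refine ⟨_, hhit, ?_⟩
  by_cases hlK1 : G.links {x'} K = 1
  swap
  · have := Finset.sum_le_sum hle
    left
    omega
  by_cases hstrict : ∃ C ∈ P, (k.choose 2 + 2) * (D C).card < G.size C + G.links {x'} C
  · have := Finset.sum_lt_sum hle hstrict
    left
    omega
  have hroot : ∀ C ∈ P, G.links {x'} C = 1 ∧ ∃ R y, y ∈ R ∧ G.IsPure k R C ∧ G.Adj x' y := by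
    intro C hC
    rcases hcase C (hPmem C hC) with h | ⟨-, h⟩
    · exact absurd ⟨C, hC, h⟩ hstrict
    · exact h
  by_cases hlt : (k.choose 2 + 2) * (insert x' (P.biUnion D)).card ≤ G.size A
  · exact Or.inl hlt
  right
  refine ⟨?_, Or.inl ?_⟩
  · have := Finset.sum_le_sum hle
    omega
  have hsubK := (mem_pieces.1 hK).1
  have hxK : x' ∉ K := fun h => by simpa using (Finset.mem_sdiff.1 (hsubK h)).2
  -- The components are glued on one at a time, starting from the constituent formed by `x'` and
  -- `K`; `x'` stays a root throughout.
  have hbuild : ∀ Q ⊆ P, ∃ R, x' ∈ R ∧ G.IsPure k R (insert x' K ∪ Q.biUnion id) := by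
    intro Q
    induction Q using Finset.induction_on with
    | empty =>
      intro _
      refine ⟨{x'}, by simp, ?_⟩
      obtain ⟨x'', hx'', y, hy, hadj, huniq⟩ := links_eq_one hlK1
      rw [Finset.mem_singleton] at hx''
      subst hx''
      simpa using hKc.isPure_insert hxK hy hadj
        fun w hw hxw => (huniq x'' (by simp) w hw hxw).2
    | insert C Q hCQ ihQ =>
      intro hQ
      obtain ⟨R, hxR, hR⟩ := ihQ ((Finset.subset_insert _ _).trans hQ)
      have hCP := hQ (Finset.mem_insert_self _ _)
      have hCm := hPmem C hCP
      obtain ⟨hl, R', y, hyR', hR', hxy'⟩ := hroot C hCP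
      obtain ⟨x'', hx'', y', hy', hadj, huniq⟩ := links_eq_one hl
      rw [Finset.mem_singleton] at hx''
      subst hx''
      have hyC : y ∈ C := by obtain ⟨_, _, h⟩ := hR'; exact h.roots_subset hyR'
      have hpiece : ∀ z ∈ insert x'' K ∪ Q.biUnion id, z = x'' ∨
          ∃ C' ∈ G.pieces (A \ {x''}), C' ≠ C ∧ z ∈ C' := by
        intro z hz
        simp only [Finset.mem_union, Finset.mem_insert, Finset.mem_biUnion, id] at hz
        rcases hz with (hz | hz) | ⟨C', hC', hz⟩
        · exact Or.inl hz
        · exact Or.inr ⟨K, hK, (Finset.ne_of_mem_erase hCP).symm, hz⟩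
        · refine Or.inr ⟨C', hPmem C' (hQ (Finset.mem_insert_of_mem hC')), ?_, hz⟩
          rintro rfl
          exact hCQ hC'
      have hxC : x'' ∉ C := fun h => by
        simpa using (Finset.mem_sdiff.1 ((mem_pieces.1 hCm).1 h)).2
      refine ⟨R ∪ R', Finset.mem_union_left _ hxR, ?_⟩
      have := hR.union hR' ?_ hxR hyR' hxy' ?_
      · rw [Finset.biUnion_insert, id, Finset.union_comm C, ← Finset.union_assoc]
        exact this
      · rw [Finset.disjoint_left]
        intro z hz hzC
        rcases hpiece z hz with rfl | ⟨C', hC', hne, hz'⟩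
        · exact hxC hzC
        · exact hne (pieces_eq_of_mem hC' hCm hz' hzC)
      · intro z hz w hw hzw
        rcases hpiece z hz with rfl | ⟨C', hC', hne, hz'⟩
        · refine ⟨rfl, ?_⟩
          rw [(huniq z (by simp) w hw hzw).2, (huniq z (by simp) y hyC hxy').2]
        · refine absurd ?_ hne
          refine pieces_eq_of_mem hC' hCm ?_ hw
          exact (mem_pieces.1 hC').2.2 z hz' w ((mem_pieces.1 hCm).1 hw) hzw
  obtain ⟨R, -, hR⟩ := hbuild P subset_rfl
  refine ⟨R, ?_⟩
  have hcov : insert x' K ∪ P.biUnion id = A := by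
    have h1 := biUnion_pieces (G := G) (A \ {x'})
    rw [← Finset.insert_erase hK, Finset.biUnion_insert, id] at h1
    rw [Finset.insert_union, h1, Finset.sdiff_singleton_eq_erase, Finset.insert_erase hx]
  rwa [hcov] at hR

end Isolation

/-! ### Deleting a `k`-clique -/

section Isolation

open scoped Classical

variable {V : Type u} {G : SimpleGraph V} {k : ℕ} {A U : Finset V}

/-- A component of `G[A \ X]` linked to `X` by only one edge is a component of `G[A \ {x}]`. -/
lemma mem_pieces_singleton {X C : Finset V} (hX : X ⊆ A) (hC : C ∈ G.pieces (A \ X))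
    (hl : G.links X C = 1) : ∃ x ∈ A, C ∈ G.pieces (A \ {x}) := by
  obtain ⟨x, hx, c, hc, hxc, huniq⟩ := links_eq_one hl
  rw [mem_pieces] at hC
  refine ⟨x, hX hx, mem_pieces.2 ⟨fun y hy => ?_, hC.2.1, fun y hy b hb hyb => ?_⟩⟩
  · have := Finset.mem_sdiff.1 (hC.1 hy)
    refine Finset.mem_sdiff.2 ⟨this.1, ?_⟩
    rw [Finset.mem_singleton]
    rintro rfl
    exact this.2 hx
  · rw [Finset.mem_sdiff, Finset.mem_singleton] at hb
    by_cases hbX : b ∈ X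
    · exact absurd (huniq b hbX y hy hyb.symm).1 hb.2
    · exact hC.2.2 y hy b (Finset.mem_sdiff.2 ⟨hb.1, hbX⟩) hyb

/-- Suppose that a core `S` is not hit by a set that hits all cores in the components of `A \ U`,
where `U` is a `k`-clique of which some vertex is not in `S`, and that at most one edge of `G[S]`
leaves `U`. Then `k = 2`, and this edge is present. -/
lemma IsKClique.core_leaves {S D : Finset V} (hU : G.IsKClique k U) (hS : S ⊆ A)
    (hc : G.IsCore k S) (hP : ∀ C ∈ G.pieces (A \ U), G.HitsCores k C D) (hh : ¬ G.Hits D S)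
    {v : V} (hv : v ∈ U) (hvS : v ∉ S) {u x : V}
    (hlink : ∀ z ∈ S, z ∈ U → ∀ w ∈ S, w ∉ U → G.Adj z w → z = u ∧ w = x) :
    k = 2 ∧ S ∩ U = {u} ∧ x ∈ S := by
  have hd : ¬ Disjoint S U := fun hd => by
    obtain ⟨C, hC, hcC⟩ := hc.exists_piece hS hd
    exact hh ((hP C hC _ Finset.inter_subset_right hcC).mono subset_rfl Finset.inter_subset_left)
  have hne : (S ∩ U).Nonempty := Finset.not_disjoint_iff_nonempty_inter.1 hd
  have hcard : (S ∩ U).card + 1 ≤ k := by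
    have h1 : S ∩ U ⊆ U.erase v := fun w hw => by
      rw [Finset.mem_inter] at hw
      exact Finset.mem_erase.2 ⟨by rintro rfl; exact hvS hw.1, hw.2⟩
    have := Finset.card_le_card h1
    rw [← hU.1, ← Finset.card_erase_add_one hv]
    omega
  have hdeg : ∀ z ∈ S ∩ U, G.degIn S z = G.degIn (S ∩ U) z + G.degIn (S \ U) z := by
    intro z _
    rw [← degIn_union (Finset.disjoint_left.2 fun w hw hw' =>
      (Finset.mem_sdiff.1 hw').2 (Finset.mem_inter.1 hw).2), Finset.union_comm,
      Finset.sdiff_union_inter]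
  -- As `v` is missing, a vertex of `S ∩ U` has at most `k - 2` neighbours there and needs one
  -- outside. Only one edge is available, so `S ∩ U` is a single vertex of degree at most 1 in `S`.
  have hout : ∀ z ∈ S ∩ U, 0 < G.degIn (S \ U) z := by
    intro z hz
    have h1 := hc.2 z (Finset.mem_inter.1 hz).1
    have h2 := hdeg z hz
    have h3 := degIn_add_one_le (G := G) hz
    omega
  have hout' : ∀ z ∈ S ∩ U, z = u ∧ x ∈ S := by
    intro z hz
    obtain ⟨w, hw, hzw⟩ := degIn_pos.1 (hout z hz)
    rw [Finset.mem_sdiff] at hw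
    rw [Finset.mem_inter] at hz
    obtain ⟨h1, rfl⟩ := hlink z hz.1 hz.2 w hw.1 hw.2 hzw
    exact ⟨h1, hw.1⟩
  have hSU : S ∩ U = {u} := Finset.eq_singleton_iff_nonempty_unique_mem.2
    ⟨hne, fun z hz => (hout' z hz).1⟩
  obtain ⟨z, hz⟩ := hne
  refine ⟨?_, hSU, (hout' z hz).2⟩
  have h1 := hc.2 z (Finset.mem_inter.1 hz).1
  have h2 := hdeg z hz
  have h3 := degIn_add_one_le (G := G) hz
  have h4 : G.degIn (S \ U) z ≤ ({x} : Finset V).card := by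
    refine Finset.card_le_card fun w hw => ?_
    rw [Finset.mem_filter, Finset.mem_sdiff] at hw
    rw [Finset.mem_inter] at hz
    exact Finset.mem_singleton.2 (hlink z hz.1 hz.2 w hw.1.1 hw.1.2 hw.2).2
  rw [hSU, Finset.card_singleton] at hcard h3
  rw [hSU] at h2
  rw [Finset.card_singleton] at h4
  omega

/-- The situation that remains when the deletion of a `k`-clique `U` does not yield a strict
inequality: the number `n C` of vertices suffices for the component `C` of `G[A \ U]`, and all
components, with the possible exception of `C₀`, are extremal and linked to `U` by one edge. -/
structure TightAt (G : SimpleGraph V) (k : ℕ) (A U : Finset V) (n : Finset V → ℕ)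
    (C₀ : Finset V) : Prop where
  mem : C₀ ∈ G.pieces (A \ U)
  sum_le : ∑ C ∈ G.pieces (A \ U), (k.choose 2 + 2) * n C ≤ G.size A
  hits : ∀ C ∈ G.pieces (A \ U), ∃ D : Finset V, D.card ≤ n C ∧ G.HitsCores k C D
  tight : ∀ C ∈ G.pieces (A \ U), C ≠ C₀ →
    (k.choose 2 + 2) * n C = G.size C + 1 ∧ G.Extremal k C ∧ G.links U C = 1
  exc : G.links U C₀ = 1 ∨
    (G.links U C₀ = 2 ∧ (k.choose 2 + 2) * n C₀ = G.size C₀ + 1 ∧ G.Extremal k C₀)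

lemma HitsCores.insert_clique {D : Finset V} {u : V} (hU : G.IsKClique k U) (hu : u ∈ U)
    (h : ∀ C ∈ G.pieces (A \ U), G.HitsCores k C (insert u D)) :
    G.HitsCores k A (insert u D) := by
  refine hitsCores_of_pieces (X := U) (fun S hS hc hd => ?_) h
  obtain ⟨s, hs, hsU⟩ := Finset.not_disjoint_iff.1 hd
  exact hU.hits hu hsU hs (Finset.mem_insert_self _ _)

/-- A vertex of `U` costs 2 more than `U` contributes, so a total surplus of 2 suffices. Otherwise
at most one component has positive surplus, and that surplus is 1. This leaves the alternatives
recorded in `TightAt`. -/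
lemma exists_hitsCores_or_tightAt
    (ih : ∀ B, B ⊂ A → G.Conn B → ¬ G.IsKClique k B → G.Bounded k B) (hA : G.Conn A)
    (hpend : ∀ x ∈ A, ∀ K ∈ G.pieces (A \ {x}), ¬ G.IsKClique k K) (hk : 1 ≤ k)
    (hUA : U ⊂ A) (hU : G.IsKClique k U) :
    (∃ D, G.HitsCores k A D ∧ (k.choose 2 + 2) * D.card ≤ G.size A) ∨
      ∃ n C₀, G.TightAt k A U n C₀ := by
  have hne : U.Nonempty := Finset.card_pos.1 (by rw [hU.1]; exact hk)
  have hpos := fun {C} hC => hA.links_piece_pos (C := C) hUA.1 hne hC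
  have hsize := size_eq_add_sum_pieces (G := G) hUA.1
  rw [hU.size] at hsize
  have hbad : ∀ C ∈ G.pieces (A \ U), G.IsKClique k C → 2 ≤ G.links U C := by
    intro C hC hCk
    have := hpos hC
    by_contra hlt
    obtain ⟨u, hu, hCu⟩ := mem_pieces_singleton hUA.1 hC (show G.links U C = 1 by omega)
    exact hpend u hu C hCu hCk
  have hex : ∀ C ∈ G.pieces (A \ U), ∃ D, G.HitsCores k C D ∧
      (k.choose 2 + 2) * D.card ≤ G.size C + G.links U C ∧
      (¬ G.IsKClique k C → (k.choose 2 + 2) * D.card + 1 ≤ G.size C + G.links U C ∨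
        (k.choose 2 + 2) * D.card = G.size C + 1 ∧ G.Extremal k C ∧ G.links U C = 1) ∧
      (¬ G.IsKClique k C → G.links U C = 1 ∨ G.links U C ≥ 3 ∨
        (k.choose 2 + 2) * D.card + 2 ≤ G.size C + G.links U C ∨
        (G.links U C = 2 ∧ (k.choose 2 + 2) * D.card = G.size C + 1 ∧ G.Extremal k C)) ∧
      (¬ G.IsKClique k C → (k.choose 2 + 2) * D.card ≤ G.size C + 1) := by
    intro C hC
    have hl := hpos hC
    by_cases hCk : G.IsKClique k C
    · have hl2 := hbad C hC hCk
      obtain ⟨c, hc⟩ := (mem_pieces.1 hC).2.1.1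
      refine ⟨{c}, fun S hS hcore => ?_, ?_, fun h => absurd hCk h, fun h => absurd hCk h,
        fun h => absurd hCk h⟩
      · rw [hCk.eq_of_core hcore hS]
        exact Hits.of_mem (Finset.mem_singleton_self c) hc
      · rw [hCk.size, Finset.card_singleton]
        omega
    · obtain ⟨D, hD, h⟩ := ih C (pieces_ssubset hUA.1 hne hC) (mem_pieces.1 hC).2.1 hCk
      refine ⟨D, hD, ?_, fun _ => ?_, fun _ => ?_, fun _ => ?_⟩
      · rcases h with h | ⟨h, -⟩ <;> omega
      · rcases h with h | ⟨h, hE⟩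
        · left; omega
        · by_cases hl1 : G.links U C = 1
          · exact Or.inr ⟨h, hE, hl1⟩
          · left; omega
      · rcases h with h | ⟨h, hE⟩
        · omega
        · by_cases hl1 : G.links U C = 2
          · exact Or.inr (Or.inr (Or.inr ⟨hl1, h, hE⟩))
          · omega
      · rcases h with h | ⟨h, -⟩ <;> omega
  choose! D hD hle htight hexc hle1 using hex
  -- A clique component is hit by a vertex `u` of `U` adjacent to it, without a vertex of its own.
  -- It is not pendant, so its two or more links close the gap.
  by_cases hb : ∃ C₁ ∈ G.pieces (A \ U), G.IsKClique k C₁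
  · obtain ⟨C₁, hC₁, hC₁k⟩ := hb
    obtain ⟨u, hu, c, hc, huc⟩ := links_pos.1 (hpos hC₁)
    left
    refine ⟨insert u (((G.pieces (A \ U)).erase C₁).biUnion D),
      HitsCores.insert_clique hU hu fun C hC => ?_, ?_⟩
    · by_cases hCC : C = C₁
      · subst hCC
        intro S hS hcore
        rw [hC₁k.eq_of_core hcore hS]
        exact Hits.of_adj (Finset.mem_insert_self _ _) hc huc
      · exact (hD C hC).mono subset_rfl ((Finset.subset_biUnion_of_mem D
          (Finset.mem_erase.2 ⟨hCC, hC⟩)).trans (Finset.subset_insert _ _))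
    · rw [← Finset.add_sum_erase _ _ hC₁, hC₁k.size] at hsize
      have h1 := hbad C₁ hC₁ hC₁k
      have h2 := Finset.sum_le_sum (s := (G.pieces (A \ U)).erase C₁)
        fun C hC => hle C (Finset.mem_of_mem_erase hC)
      have h3 := mul_card_biUnion_le (k.choose 2 + 2) ((G.pieces (A \ U)).erase C₁) D
      have h4 := Nat.mul_le_mul_left (k.choose 2 + 2)
        (Finset.card_insert_le u (((G.pieces (A \ U)).erase C₁).biUnion D))
      rw [mul_add, mul_one] at h4
      omega
  push Not at hb
  by_cases hsum : ∑ C ∈ G.pieces (A \ U), (k.choose 2 + 2) * (D C).card + 2 ≤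
      ∑ C ∈ G.pieces (A \ U), (G.size C + G.links U C)
  · obtain ⟨u, hu⟩ := hne
    left
    refine ⟨insert u ((G.pieces (A \ U)).biUnion D),
      HitsCores.insert_clique hU hu fun C hC => ?_, ?_⟩
    · exact (hD C hC).mono subset_rfl ((Finset.subset_biUnion_of_mem D hC).trans
        (Finset.subset_insert _ _))
    · have h3 := mul_card_biUnion_le (k.choose 2 + 2) (G.pieces (A \ U)) D
      have h4 := Nat.mul_le_mul_left (k.choose 2 + 2)
        (Finset.card_insert_le u ((G.pieces (A \ U)).biUnion D))
      rw [mul_add, mul_one] at h4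
      omega
  right
  have hsumle := Finset.sum_le_sum hle
  obtain ⟨b, hbA, hbU⟩ := Finset.exists_of_ssubset hUA
  obtain ⟨C₁, hC₁, -⟩ := exists_piece (G := G) (Finset.mem_sdiff.2 ⟨hbA, hbU⟩)
  -- the possible exception
  obtain ⟨C₀, hC₀, hmax⟩ : ∃ C₀ ∈ G.pieces (A \ U), ∀ C ∈ G.pieces (A \ U), C ≠ C₀ →
      (k.choose 2 + 2) * (D C).card = G.size C + 1 ∧ G.Extremal k C ∧ G.links U C = 1 := by
    by_contra hcon
    push Not at hcon
    -- `C₁` only starts the search: `C₂` and `C₃` are two distinct components with positive surplus,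
    -- which is excluded by `hsum`.
    obtain ⟨C₂, hC₂, hne₂, hnt₂⟩ := hcon C₁ hC₁
    obtain ⟨C₃, hC₃, hne₃, hnt₃⟩ := hcon C₂ hC₂
    have h2 := (htight C₂ hC₂ (hb C₂ hC₂)).resolve_right fun h => hnt₂ h.1 h.2.1 h.2.2
    have h3 := (htight C₃ hC₃ (hb C₃ hC₃)).resolve_right fun h => hnt₃ h.1 h.2.1 h.2.2
    have hm : C₃ ∈ (G.pieces (A \ U)).erase C₂ := Finset.mem_erase.2 ⟨hne₃, hC₃⟩
    have h4 := Finset.sum_le_sum (s := ((G.pieces (A \ U)).erase C₂).erase C₃)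
      fun C hC => hle C (Finset.mem_of_mem_erase (Finset.mem_of_mem_erase hC))
    rw [← Finset.add_sum_erase _ _ hC₂, ← Finset.add_sum_erase _ _ hC₂,
      ← Finset.add_sum_erase _ _ hm, ← Finset.add_sum_erase _ _ hm] at hsum
    omega
  refine ⟨fun C => (D C).card, C₀, hC₀, by omega, fun C hC => ⟨D C, le_rfl, hD C hC⟩, hmax, ?_⟩
  have h4 := Finset.sum_le_sum (s := (G.pieces (A \ U)).erase C₀)
      fun C hC => hle C (Finset.mem_of_mem_erase hC)
  rw [← Finset.add_sum_erase _ _ hC₀, ← Finset.add_sum_erase _ _ hC₀] at hsum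
  have h1 := hexc C₀ hC₀ (hb C₀ hC₀)
  have h2 := hle1 C₀ hC₀ (hb C₀ hC₀)
  rcases h1 with h1 | h1 | h1 | h1
  · exact Or.inl h1
  · omega
  · omega
  · exact Or.inr h1

end Isolation

/-! ### Tight deletions, and the case `k = 2` -/

section Isolation

open scoped Classical

variable {V : Type u} {G : SimpleGraph V} {k : ℕ} {A U C₀ : Finset V} {n : Finset V → ℕ}

namespace TightAt

/-- Isolating sets of the components can be chosen such that all links to components other than
`C₀` are dominated. -/
lemma extend (h : G.TightAt k A U n C₀) (hk : 1 ≤ k) {D₀ : Finset V} (hcard : D₀.card ≤ n C₀)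
    (hD₀ : G.HitsCores k C₀ D₀) :
    ∃ D, D₀ ⊆ D ∧ (k.choose 2 + 2) * D.card ≤ G.size A ∧
      (∀ C ∈ G.pieces (A \ U), G.HitsCores k C D) ∧
      ∀ C ∈ G.pieces (A \ U), C ≠ C₀ → ∀ u ∈ U, ∀ x ∈ C, G.Adj u x → x ∈ D := by
  have hex : ∀ C ∈ G.pieces (A \ U), ∃ D : Finset V, D.card ≤ n C ∧ G.HitsCores k C D ∧
      (C = C₀ → D = D₀) ∧ (C ≠ C₀ → ∀ u ∈ U, ∀ x ∈ C, G.Adj u x → x ∈ D) := by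
    intro C hC
    by_cases hCC : C = C₀
    · subst hCC
      exact ⟨D₀, hcard, hD₀, fun _ => rfl, fun h => absurd rfl h⟩
    · obtain ⟨ht, hE, hl⟩ := h.tight C hC hCC
      obtain ⟨u, hu, x, hx, hux, huniq⟩ := links_eq_one hl
      obtain ⟨D, hxD, hDc, hD⟩ := hE.exists_mem_hitsCores hk ht hx
      refine ⟨D, hDc, hD, fun h => absurd h hCC, fun _ u' hu' x' hx' hadj => ?_⟩
      rw [(huniq u' hu' x' hx' hadj).2]
      exact hxD
  choose! D hD1 hD2 hD3 hD4 using hex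
  refine ⟨(G.pieces (A \ U)).biUnion D, ?_, ?_, fun C hC => ?_, fun C hC hne u hu x hx hux => ?_⟩
  · rw [← hD3 C₀ h.mem rfl]
    exact Finset.subset_biUnion_of_mem D h.mem
  · refine (mul_card_biUnion_le _ _ _).trans (le_trans ?_ h.sum_le)
    exact Finset.sum_le_sum fun C hC => Nat.mul_le_mul_left _ (hD1 C hC)
  · exact (hD2 C hC).mono subset_rfl (Finset.subset_biUnion_of_mem D hC)
  · exact Finset.mem_biUnion.2 ⟨C, hC, hD4 C hC hne u hu x hx hux⟩

/-- A core that is not hit has edges between `U` and `C₀` only. -/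
lemma mem_of_adj {S D : Finset V}
    (hD : ∀ C ∈ G.pieces (A \ U), C ≠ C₀ → ∀ u ∈ U, ∀ x ∈ C, G.Adj u x → x ∈ D)
    (hS : S ⊆ A) (hh : ¬ G.Hits D S) {z w : V} (hz : z ∈ U) (hw : w ∈ S) (hwU : w ∉ U)
    (hzw : G.Adj z w) : w ∈ C₀ := by
  obtain ⟨C, hC, hwC⟩ := exists_piece (G := G) (Finset.mem_sdiff.2 ⟨hS hw, hwU⟩)
  by_cases hne : C = C₀
  · exact hne ▸ hwC
  · exact absurd (Hits.of_mem (hD C hC hne z hz w hwC hzw) hw) hh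

/-- No vertex of `U` is used. A chosen end of a link dominates a vertex of `U`, which an unhit core
must then miss, while at most one link remains for it. By `IsKClique.core_leaves` this leaves `k =
2`, with two different vertices of `U` linked to the outside. -/
lemma exists_hitsCores_or_eq_two (h : G.TightAt k A U n C₀) (hk : 1 ≤ k) (hUA : U ⊆ A)
    (hUc : G.IsKClique k U) (hA : G.Conn A)
    (hpend : ∀ x ∈ A, ∀ K ∈ G.pieces (A \ {x}), ¬ G.IsKClique k K) :
    (∃ D, G.HitsCores k A D ∧ (k.choose 2 + 2) * D.card ≤ G.size A) ∨
      (k = 2 ∧ ∃ a ∈ U, ∃ a' ∈ U, a ≠ a' ∧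
        (∃ b ∈ A \ U, G.Adj a b) ∧ ∃ b ∈ A \ U, G.Adj a' b) := by
  have hUne : U.Nonempty := Finset.card_pos.1 (by rw [hUc.1]; exact hk)
  have hCsub : ∀ {C}, C ∈ G.pieces (A \ U) → C ⊆ A \ U := fun hC => (mem_pieces.1 hC).1
  rcases h.exc with hl | ⟨hl, ht, hE⟩
  · obtain ⟨u, hu, x, hx, hux, huniq⟩ := links_eq_one hl
    by_cases hoth : ∃ C₁ ∈ G.pieces (A \ U), C₁ ≠ C₀
    · obtain ⟨C₁, hC₁, hne⟩ := hoth
      obtain ⟨u₁, hu₁, x₁, hx₁, hux₁⟩ := hA.exists_adj_piece hUA hUne hC₁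
      obtain ⟨D₀, hD₀c, hD₀⟩ := h.hits C₀ h.mem
      obtain ⟨D, -, hDc, hDP, hDl⟩ := h.extend hk hD₀c hD₀
      by_cases hDA : G.HitsCores k A D
      · exact Or.inl ⟨D, hDA, hDc⟩
      simp only [HitsCores, not_forall] at hDA
      obtain ⟨S, hS, hc, hh⟩ := hDA
      have hu₁S : u₁ ∉ S := fun hu₁S =>
        hh (Hits.of_adj (hDl C₁ hC₁ hne u₁ hu₁ x₁ hx₁ hux₁) hu₁S hux₁.symm)
      obtain ⟨hk2, hSU, -⟩ := hUc.core_leaves hS hc hDP hh hu₁ hu₁S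
        fun z hz hzU w hw hwU hzw => huniq z hzU w (mem_of_adj hDl hS hh hzU hw hwU hzw) hzw
      refine Or.inr ⟨hk2, u, hu, u₁, hu₁, ?_, ⟨x, hCsub h.mem hx, hux⟩, x₁, hCsub hC₁ hx₁, hux₁⟩
      rintro rfl
      have : u ∈ S ∩ U := by rw [hSU]; exact Finset.mem_singleton_self _
      exact hu₁S (Finset.mem_inter.1 this).1
    -- If `C₀` is the only component and has a single link, then `U` is a pendant clique at the far
    -- end `x` of that link.
    · exfalso
      push Not at hoth
      have hxAU := Finset.mem_sdiff.1 (hCsub h.mem hx)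
      refine hpend x hxAU.1 U (mem_pieces.2 ⟨fun v hv => ?_, ⟨hUne, fun S hS hne hcl => ?_⟩, ?_⟩) hUc
      · refine Finset.mem_sdiff.2 ⟨hUA hv, ?_⟩
        rw [Finset.mem_singleton]
        rintro rfl
        exact hxAU.2 hv
      · obtain ⟨s, hs⟩ := hne
        refine hS.antisymm fun v hv => ?_
        by_cases hsv : s = v
        · exact hsv ▸ hs
        · exact hcl s hs v hv (hUc.2 s (hS hs) v hv hsv)
      · intro v hv b hb hvb
        rw [Finset.mem_sdiff, Finset.mem_singleton] at hb
        by_contra hbU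
        obtain ⟨C, hC, hbC⟩ := exists_piece (G := G) (Finset.mem_sdiff.2 ⟨hb.1, hbU⟩)
        rw [hoth C hC] at hbC
        exact hb.2 (huniq v hv b hbC hvb).2
  · obtain ⟨a, ha, b, hb, a', ha', b', hb', hab, hab', -, huniq⟩ := links_eq_two hl
    obtain ⟨D₀, hbD₀, hD₀c, hD₀⟩ := hE.exists_mem_hitsCores hk ht hb
    obtain ⟨D, hDD, hDc, hDP, hDl⟩ := h.extend hk hD₀c hD₀
    by_cases hDA : G.HitsCores k A D
    · exact Or.inl ⟨D, hDA, hDc⟩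
    simp only [HitsCores, not_forall] at hDA
    obtain ⟨S, hS, hc, hh⟩ := hDA
    have haS : a ∉ S := fun haS => hh (Hits.of_adj (hDD hbD₀) haS hab.symm)
    obtain ⟨hk2, hSU, -⟩ := hUc.core_leaves (u := a') (x := b') hS hc hDP hh ha haS
      fun z hz hzU w hw hwU hzw => by
        refine (huniq z hzU w (mem_of_adj hDl hS hh hzU hw hwU hzw) hzw).resolve_left ?_
        rintro ⟨rfl, -⟩
        exact haS hz
    refine Or.inr ⟨hk2, a, ha, a', ha', ?_, ⟨b, hCsub h.mem hb, hab⟩, b', hCsub h.mem hb', hab'⟩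
    rintro rfl
    have : a ∈ S ∩ U := by rw [hSU]; exact Finset.mem_singleton_self _
    exact haS (Finset.mem_inter.1 this).1

end TightAt

lemma isCyc_five_of_path {x y z u v : V} (hxyz : [x, y, z, u, v].Nodup) (h1 : G.Adj x y)
    (h2 : G.Adj y z) (h3 : G.Adj z u) (h4 : G.Adj u v) (h5 : G.Adj v x) (n1 : ¬ G.Adj x z)
    (n2 : ¬ G.Adj x u) (n3 : ¬ G.Adj y u) (n4 : ¬ G.Adj y v) (n5 : ¬ G.Adj z v) :
    G.IsCyc 5 {x, y, z, u, v} := by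
  refine ⟨![x, y, z, u, v], ?_, ?_, ?_⟩
  · rw [← List.nodup_ofFn]
    simpa using hxyz
  · ext w
    simp only [Finset.mem_insert, Finset.mem_singleton, Finset.mem_image, Finset.mem_univ, true_and,
      Fin.exists_fin_succ, Matrix.cons_val_zero, Matrix.cons_val_succ]
    simp [eq_comm]
  · have key : ∀ i j : Fin 5, (cycleGraph 5).Adj i j ↔ (j = i + 1 ∨ i = j + 1) := by decide
    intro i j
    rw [key]
    have m1 : ¬ G.Adj z x := fun h => n1 h.symm
    have m2 : ¬ G.Adj u x := fun h => n2 h.symm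
    have m3 : ¬ G.Adj u y := fun h => n3 h.symm
    have m4 : ¬ G.Adj v y := fun h => n4 h.symm
    have m5 : ¬ G.Adj v z := fun h => n5 h.symm
    fin_cases i <;> fin_cases j <;>
      simp [h1, h2, h3, h4, h5, n1, n2, n3, n4, n5, h1.symm, h2.symm, h3.symm, h4.symm, h5.symm,
        m1, m2, m3, m4, m5]

/-- The case of an edge both of whose ends are linked to the same component of the rest. -/
lemma TightAt.bounded_two (h : G.TightAt 2 A U n C₀) (hUA : U ⊆ A) (hU : G.IsKClique 2 U)
    (hA : G.Conn A) {C : Finset V} (hC : C ∈ G.pieces (A \ U)) {u u' : V} (hu : u ∈ U)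
    (hu' : u' ∈ U) (hne : u ≠ u') (hl : ∃ x ∈ C, G.Adj u x) (hl' : ∃ x ∈ C, G.Adj u' x) :
    G.Bounded 2 A := by
  obtain ⟨x, hx, hux⟩ := hl
  obtain ⟨x', hx', hux'⟩ := hl'
  have hnot1 : G.links U C ≠ 1 := by
    intro h1
    obtain ⟨_, _, _, _, _, huniq⟩ := links_eq_one h1
    exact hne ((huniq u hu x hx hux).1.trans (huniq u' hu' x' hx' hux').1.symm)
  have hCC : C = C₀ := by
    by_contra hCC
    exact hnot1 (h.tight C hC hCC).2.2
  subst hCC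
  obtain ⟨hl2, ht, hE⟩ := h.exc.resolve_left hnot1
  have huniq : ∀ z ∈ U, ∀ w ∈ C, G.Adj z w → (z = u ∧ w = x) ∨ (z = u' ∧ w = x') := by
    obtain ⟨a, ha, b, hb, a', ha', b', hb', -, -, -, huniq⟩ := links_eq_two hl2
    intro z hz w hw hzw
    have e1 := huniq u hu x hx hux
    have e2 := huniq u' hu' x' hx' hux'
    have e3 := huniq z hz w hw hzw
    rcases e1 with ⟨rfl, rfl⟩ | ⟨rfl, rfl⟩ <;> rcases e2 with ⟨rfl, rfl⟩ | ⟨rfl, rfl⟩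
    · exact absurd rfl hne
    · exact e3
    · exact e3.symm
    · exact absurd rfl hne
  have hUne : U.Nonempty := ⟨u, hu⟩
  -- Once `x` and `x'` are dominated, no edge of an unhit core leaves `U`; the last hypothesis
  -- ensures that some vertex of `U` is dominated and hence missing from the core.
  have finish : ∀ D₀ : Finset V, D₀.card ≤ n C → G.HitsCores 2 C D₀ → G.Hits D₀ {x} →
      G.Hits D₀ {x'} → (x ∈ D₀ ∨ x' ∈ D₀ ∨ ∃ C₁ ∈ G.pieces (A \ U), C₁ ≠ C) → G.Bounded 2 A := by
    intro D₀ hc₀ hD₀ hhx hhx' hcase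
    obtain ⟨D, hDD, hDc, hDP, hDl⟩ := h.extend (by omega) hc₀ hD₀
    refine ⟨D, ?_, Or.inl hDc⟩
    intro S hS hcore
    by_contra hh
    have hxS : x ∉ S := fun hxS => hh (hhx.mono hDD (by simpa using hxS))
    have hxS' : x' ∉ S := fun hxS => hh (hhx'.mono hDD (by simpa using hxS))
    obtain ⟨v, hv, hvS⟩ : ∃ v ∈ U, v ∉ S := by
      rcases hcase with hD | hD | ⟨C₁, hC₁, hne₁⟩
      · exact ⟨u, hu, fun huS => hh (Hits.of_adj (hDD hD) huS hux.symm)⟩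
      · exact ⟨u', hu', fun huS => hh (Hits.of_adj (hDD hD) huS hux'.symm)⟩
      · obtain ⟨v, hv, y, hy, hvy⟩ := hA.exists_adj_piece hUA hUne hC₁
        exact ⟨v, hv, fun hvS => hh (Hits.of_adj (hDl C₁ hC₁ hne₁ v hv y hy hvy) hvS hvy.symm)⟩
    -- The link condition holds vacuously, so the choice of `u` and `x` is free; the conclusion `x ∈
    -- S` is absurd.
    have := (hU.core_leaves (u := v) (x := x) hS hcore hDP hh hv hvS
      fun z hz hzU w hw hwU hzw => by
        rcases huniq z hzU w (mem_of_adj hDl hS hh hzU hw hwU hzw) hzw with ⟨-, rfl⟩ | ⟨-, rfl⟩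
        · exact absurd hw hxS
        · exact absurd hw hxS').2.2
    exact hxS this
  by_cases hxx : x = x'
  · subst hxx
    obtain ⟨D₀, hxD₀, hc₀, hD₀⟩ := hE.exists_mem_hitsCores (by omega) ht hx
    have := Hits.of_mem (G := G) hxD₀ (Finset.mem_singleton_self x)
    exact finish D₀ hc₀ hD₀ this this (Or.inl hxD₀)
  rcases hE.exists_hitsCores_pair ht hx hx' hxx with
    ⟨D₀, hc₀, hD₀, hhx, hhx', hD⟩ | ⟨hn1, z, hCz, hzx, hzx', hxz, hzx2, hnadj⟩
  · exact finish D₀ hc₀ hD₀ hhx hhx' (hD.elim Or.inl fun h => Or.inr (Or.inl h))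
  -- Now `C` is a path with ends `x`, `x'` and middle `z`. The vertex `z` dominates it but no vertex
  -- of `U`; this is enough if there is another component, and otherwise the path closes up with `u`
  -- and `u'` to a 5-cycle.
  have hhit : ∀ w ∈ C, G.Hits {z} {w} := by
    intro w hw
    rw [hCz] at hw
    simp only [Finset.mem_insert, Finset.mem_singleton] at hw
    rcases hw with rfl | rfl | rfl
    · exact Hits.of_adj (Finset.mem_singleton_self _) (Finset.mem_singleton_self _) hxz.symm
    · exact Hits.of_mem (Finset.mem_singleton_self _) (Finset.mem_singleton_self _)
    · exact Hits.of_adj (Finset.mem_singleton_self _) (Finset.mem_singleton_self _) hzx2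
  by_cases hoth : ∃ C₁ ∈ G.pieces (A \ U), C₁ ≠ C
  · refine finish {z} (by rw [hn1, Finset.card_singleton]) (fun S hS hc => ?_) (hhit x hx)
      (hhit x' hx') (Or.inr (Or.inr hoth))
    obtain ⟨s, hs⟩ := hc.1
    exact (hhit s (hS hs)).mono subset_rfl (by simpa using hs)
  push Not at hoth
  have hAU : A \ U = C := by
    rw [← biUnion_pieces (G := G) (A \ U), Finset.eq_singleton_iff_unique_mem.2 ⟨h.mem, hoth⟩,
      Finset.singleton_biUnion, id]
  have hU2 : U = {u, u'} := by
    refine (Finset.eq_of_subset_of_card_le ?_ ?_).symm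
    · intro w hw
      simp only [Finset.mem_insert, Finset.mem_singleton] at hw
      rcases hw with rfl | rfl <;> assumption
    · rw [hU.1, Finset.card_pair hne]
  have hdisj : ∀ {v w}, v ∈ U → w ∈ C → v ≠ w := by
    rintro v w hv hw rfl
    rw [← hAU, Finset.mem_sdiff] at hw
    exact hw.2 hv
  have hz : z ∈ C := by rw [hCz]; simp
  have hcyc : G.IsCyc 5 A := by
    have hA5 : A = {u, x, z, x', u'} := by
      rw [← Finset.union_sdiff_of_subset hUA, hAU, hCz, hU2]
      ext w
      simp only [Finset.mem_union, Finset.mem_insert, Finset.mem_singleton]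
      tauto
    rw [hA5]
    refine isCyc_five_of_path ?_ hux hxz hzx2 hux'.symm (hU.2 u' hu' u hu hne.symm) ?_ ?_ hnadj ?_ ?_
    · have := hdisj hu hx
      have := hdisj hu hz
      have := hdisj hu hx'
      have := hdisj hu' hx
      have := hdisj hu' hz
      have := hdisj hu' hx'
      simp
      tauto
    · intro hadj
      rcases huniq u hu z hz hadj with ⟨-, h⟩ | ⟨h, -⟩
      · exact hzx h
      · exact hne h
    · intro hadj
      rcases huniq u hu x' hx' hadj with ⟨-, h⟩ | ⟨h, -⟩
      · exact hxx h.symm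
      · exact hne h
    · intro hadj
      rcases huniq u' hu' x hx hadj.symm with ⟨h, -⟩ | ⟨-, h⟩
      · exact hne h.symm
      · exact hxx h
    · intro hadj
      rcases huniq u' hu' z hz hadj.symm with ⟨h, -⟩ | ⟨-, h⟩
      · exact hne h.symm
      · exact hzx' h
  refine ⟨{u, u'}, hcyc.hitsCores_pair (hUA hu) (hUA hu') hne, Or.inr ⟨?_, Or.inr (Or.inl ⟨rfl, hcyc⟩)⟩⟩
  rw [hcyc.size_five, Finset.card_pair hne]
  rfl

/-- In a connected graph of minimum degree at least two, some edge has both ends linked to the same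
component of the rest. -/
lemma Conn.exists_edge_linked (hA : G.Conn A) (hdeg : ∀ v ∈ A, 2 ≤ G.degIn A v) (m : ℕ) :
    ∀ u ∈ A, ∀ u' ∈ A, G.Adj u u' → ∀ C ∈ G.pieces (A \ {u, u'}), C.card ≤ m →
      ∃ u ∈ A, ∃ u' ∈ A, G.Adj u u' ∧ ∃ C ∈ G.pieces (A \ {u, u'}),
        (∃ x ∈ C, G.Adj u x) ∧ ∃ x ∈ C, G.Adj u' x := by
  induction m with
  | zero =>
    intro u _ u' _ _ C hC hcard
    have := Finset.card_pos.2 (mem_pieces.1 hC).2.1.1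
    omega
  | succ m ih =>
    -- Descent: if `C` is linked to `u` only, let `c` be a neighbour of `u` in `C`. Its second
    -- neighbour `w` lies in `C`, and the component of `w` after deleting the edge's ends `c` and
    -- `u` lies in `C` without `c`.
    have key : ∀ u ∈ A, ∀ u' ∈ A, G.Adj u u' → ∀ C ∈ G.pieces (A \ {u, u'}), C.card ≤ m + 1 →
        (∃ x ∈ C, G.Adj u x) → (∀ x ∈ C, ¬ G.Adj u' x) →
        ∃ u ∈ A, ∃ u' ∈ A, G.Adj u u' ∧ ∃ C ∈ G.pieces (A \ {u, u'}),
        (∃ x ∈ C, G.Adj u x) ∧ ∃ x ∈ C, G.Adj u' x := by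
      intro u hu u' hu' huu C hC hcard hl hl'
      obtain ⟨c, hc, huc⟩ := hl
      have hC' := mem_pieces.1 hC
      have hcA := Finset.mem_sdiff.1 (hC'.1 hc)
      have hclosed : ∀ s ∈ C, ∀ b ∈ A, b ≠ u → G.Adj s b → b ∈ C := by
        intro s hs b hb hbu hsb
        refine hC'.2.2 s hs b (Finset.mem_sdiff.2 ⟨hb, ?_⟩) hsb
        simp only [Finset.mem_insert, Finset.mem_singleton, not_or]
        refine ⟨hbu, ?_⟩
        rintro rfl
        exact hl' s hs hsb.symm
      obtain ⟨w, hwA, hwu, hcw⟩ : ∃ w ∈ A, w ≠ u ∧ G.Adj c w := by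
        by_contra hcon
        push Not at hcon
        have h1 : A.filter (G.Adj c) ⊆ {u} := fun w hw => by
          rw [Finset.mem_filter] at hw
          by_contra hwu
          exact hcon w hw.1 (by simpa using hwu) hw.2
        have h2 := Finset.card_le_card h1
        have h3 := hdeg c hcA.1
        unfold degIn at h3
        rw [Finset.card_singleton] at h2
        omega
      have hwC := hclosed c hc w hwA hwu hcw
      obtain ⟨C', hC'm, hwC'⟩ := exists_piece (G := G) (B := A \ {c, u}) (b := w)
        (by simp [hwA, hcw.ne', hwu])
      have hC'' := mem_pieces.1 hC'm
      have hsub : C' ∩ C = C' := by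
        refine hC''.2.1.2 _ Finset.inter_subset_left ⟨w, Finset.mem_inter.2 ⟨hwC', hwC⟩⟩ ?_
        intro s hs b hb hsb
        have hbA := Finset.mem_sdiff.1 (hC''.1 hb)
        refine Finset.mem_inter.2 ⟨hb, hclosed s (Finset.mem_inter.1 hs).2 b hbA.1 ?_ hsb⟩
        rintro rfl
        simp at hbA
      have hcC' : c ∉ C' := fun h => by simpa using (Finset.mem_sdiff.1 (hC''.1 h)).2
      have hss : C' ⊂ C := (Finset.ssubset_iff_of_subset (Finset.inter_eq_left.1 hsub)).2
        ⟨c, hc, hcC'⟩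
      have := Finset.card_lt_card hss
      exact ih c hcA.1 u hu huc.symm C' hC'm (by omega)
    intro u hu u' hu' huu C hC hcard
    have hsub : {u, u'} ⊆ A := by
      intro w hw
      simp only [Finset.mem_insert, Finset.mem_singleton] at hw
      rcases hw with rfl | rfl <;> assumption
    by_cases h1 : ∃ x ∈ C, G.Adj u x <;> by_cases h2 : ∃ x ∈ C, G.Adj u' x
    · exact ⟨u, hu, u', hu', huu, C, hC, h1, h2⟩
    · push Not at h2
      exact key u hu u' hu' huu C hC hcard h1 h2
    · push Not at h1
      exact key u' hu' u hu huu.symm C (by rwa [Finset.pair_comm]) hcard h2 h1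
    · exfalso
      obtain ⟨v, hv, c, hc, hvc⟩ := hA.exists_adj_piece hsub (by simp) hC
      simp only [Finset.mem_insert, Finset.mem_singleton] at hv
      rcases hv with rfl | rfl
      · exact h1 ⟨c, hc, hvc⟩
      · exact h2 ⟨c, hc, hvc⟩

lemma isKClique_pair {u v : V} (h : G.Adj u v) : G.IsKClique 2 {u, v} := by
  refine ⟨Finset.card_pair h.ne, ?_⟩
  simp only [Finset.mem_insert, Finset.mem_singleton]
  rintro x (rfl | rfl) y (rfl | rfl) hne
  · exact absurd rfl hne
  · exact h
  · exact h.symm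
  · exact absurd rfl hne

/-- If the bound failed, every `k`-clique of `A` would be tight. This gives `k = 2`, so tightness is
available for every edge, in particular for one to which `TightAt.bounded_two` applies. -/
lemma bounded_of_clique (hk : 1 ≤ k)
    (ih : ∀ B, B ⊂ A → G.Conn B → ¬ G.IsKClique k B → G.Bounded k B) (hA : G.Conn A)
    (hnA : ¬ G.IsKClique k A) (hUA : U ⊆ A) (hU : G.IsKClique k U) : G.Bounded k A := by
  by_cases hpend : ∃ x ∈ A, ∃ K ∈ G.pieces (A \ {x}), G.IsKClique k K
  · obtain ⟨x, hx, K, hK, hKc⟩ := hpend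
    exact bounded_of_pendant_clique ih hA hx hK hKc
  push Not at hpend
  have hss : ∀ {W}, W ⊆ A → G.IsKClique k W → W ⊂ A := fun hW hWc =>
    hW.ssubset_of_ne (by rintro rfl; exact hnA hWc)
  by_contra hcon
  have hstrict : ¬ ∃ D, G.HitsCores k A D ∧ (k.choose 2 + 2) * D.card ≤ G.size A :=
    fun ⟨D, h1, h2⟩ => hcon ⟨D, h1, Or.inl h2⟩
  have htight : ∀ {W}, W ⊆ A → G.IsKClique k W → ∃ n C₀, G.TightAt k A W n C₀ := fun hW hWc =>
    (exists_hitsCores_or_tightAt ih hA hpend hk (hss hW hWc) hWc).resolve_left hstrict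
  have htwo : ∀ {W}, W ⊆ A → G.IsKClique k W → k = 2 ∧ ∃ a ∈ W, ∃ a' ∈ W, a ≠ a' ∧
      (∃ b ∈ A \ W, G.Adj a b) ∧ ∃ b ∈ A \ W, G.Adj a' b := fun hW hWc => by
    obtain ⟨n, C₀, h⟩ := htight hW hWc
    exact (h.exists_hitsCores_or_eq_two hk hW hWc hA hpend).resolve_left hstrict
  obtain ⟨rfl, -⟩ := htwo hUA hU
  have hpairs : ∀ {u v}, u ∈ A → v ∈ A → ({u, v} : Finset V) ⊆ A := fun hu hv w hw => by
    simp only [Finset.mem_insert, Finset.mem_singleton] at hw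
    rcases hw with rfl | rfl <;> assumption
  -- By `htwo` both ends of each edge have further neighbours, which rules out leaves.
  have hdeg : ∀ v ∈ A, 2 ≤ G.degIn A v := by
    intro v hv
    by_contra hlt
    have hne : {v} ≠ A := by
      intro h
      have h1 := Finset.card_le_card hUA
      rw [hU.1, ← h, Finset.card_singleton] at h1
      omega
    obtain ⟨w, hw, hvw⟩ : ∃ w ∈ A, G.Adj v w := by
      by_contra hno
      push Not at hno
      refine hne (hA.2 {v} (by simpa using hv) (by simp) fun s hs b hb hsb => ?_)
      rw [Finset.mem_singleton] at hs
      subst hs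
      exact absurd hsb (hno b hb)
    have huniq : ∀ b ∈ A, G.Adj v b → b = w := by
      have h1 : (A.filter (G.Adj v)).card ≤ 1 := by unfold degIn at hlt; omega
      intro b hb hvb
      exact Finset.card_le_one.1 h1 b (by simp [hb, hvb]) w (by simp [hw, hvw])
    obtain ⟨-, a, ha, a', ha', hne', ⟨b, hb, hab⟩, b', hb', hab'⟩ :=
      htwo (hpairs hv hw) (isKClique_pair hvw)
    have hcl : ∀ {a b}, a = v → b ∈ A \ {v, w} → ¬ G.Adj a b := by
      rintro a b rfl hb hab
      rw [Finset.mem_sdiff] at hb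
      exact hb.2 (by simp [huniq b hb.1 hab])
    simp only [Finset.mem_insert, Finset.mem_singleton] at ha ha'
    rcases ha with ha | ha
    · exact hcl ha hb hab
    · rcases ha' with ha' | ha'
      · exact hcl ha' hb' hab'
      · exact hne' (ha.trans ha'.symm)
  obtain ⟨u, u', huu, hU2⟩ := Finset.card_eq_two.1 hU.1
  subst hU2
  obtain ⟨c, hc, hcU⟩ := Finset.exists_of_ssubset (hss hUA hU)
  obtain ⟨C, hC, -⟩ := exists_piece (G := G) (Finset.mem_sdiff.2 ⟨hc, hcU⟩)
  obtain ⟨u, hu, u', hu', huu, C, hC, hl, hl'⟩ := hA.exists_edge_linked hdeg C.card u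
    (hUA (by simp)) u' (hUA (by simp)) (hU.2 u (by simp) u' (by simp) huu) C hC le_rfl
  obtain ⟨n, C₀, h⟩ := htight (hpairs hu hu') (isKClique_pair huu)
  exact hcon (h.bounded_two (hpairs hu hu') (isKClique_pair huu) hA hC (by simp) (by simp) huu.ne
    hl hl')

end Isolation

/-! ### Triangle-free graphs for `k = 3`, and the conclusion of the induction -/

section Isolation

open scoped Classical

variable {V : Type u} {G : SimpleGraph V} {k : ℕ} {A U C₀ : Finset V} {n : Finset V → ℕ}

lemma isCyc_four_of_path {x y z u : V} (hnd : [x, y, z, u].Nodup) (h1 : G.Adj x y)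
    (h2 : G.Adj y z) (h3 : G.Adj z u) (h4 : G.Adj u x) (n1 : ¬ G.Adj x z) (n2 : ¬ G.Adj y u) :
    G.IsCyc 4 {x, y, z, u} := by
  refine ⟨![x, y, z, u], ?_, ?_, ?_⟩
  · rw [← List.nodup_ofFn]
    simpa using hnd
  · ext w
    simp only [Finset.mem_insert, Finset.mem_singleton, Finset.mem_image, Finset.mem_univ, true_and,
      Fin.exists_fin_succ, Matrix.cons_val_zero, Matrix.cons_val_succ]
    simp [eq_comm]
  · have key : ∀ i j : Fin 4, (cycleGraph 4).Adj i j ↔ (j = i + 1 ∨ i = j + 1) := by decide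
    intro i j
    rw [key]
    have m1 : ¬ G.Adj z x := fun h => n1 h.symm
    have m2 : ¬ G.Adj u y := fun h => n2 h.symm
    fin_cases i <;> fin_cases j <;>
      simp [h1, h2, h3, h4, n1, n2, h1.symm, h2.symm, h3.symm, h4.symm, m1, m2]

lemma Conn.erase_leaf (hA : G.Conn A) {v : V} (hdeg : G.degIn A v ≤ 1)
    (hne : (A.erase v).Nonempty) : G.Conn (A.erase v) := by
  refine ⟨hne, fun S hS hSne hcl => ?_⟩
  have hSA := Finset.subset_erase.1 hS
  by_contra hSe
  by_cases hadj : ∃ s ∈ S, G.Adj v s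
  · obtain ⟨s, hs, hvs⟩ := hadj
    have h1 := hA.2 (insert v S) ?_ (Finset.insert_nonempty _ _) ?_
    · exact hSe (by rw [← h1, Finset.erase_insert hSA.2])
    · by_cases hv : v ∈ A
      · exact Finset.insert_subset hv hSA.1
      · exact absurd (hA.2 S hSA.1 hSne fun s hs a ha hsa => hcl s hs a
          (Finset.mem_erase.2 ⟨by rintro rfl; exact hv ha, ha⟩) hsa)
          (by rw [Finset.erase_eq_of_notMem hv] at hSe; exact hSe)
    · intro w hw b hb hwb
      by_cases hbv : b = v
      · exact hbv ▸ Finset.mem_insert_self _ _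
      refine Finset.mem_insert_of_mem ?_
      rcases Finset.mem_insert.1 hw with rfl | hw
      · have : b = s := Finset.card_le_one.1 hdeg b (by simp [hb, hwb]) s (by simp [hSA.1 hs, hvs])
        exact this ▸ hs
      · exact hcl w hw b (Finset.mem_erase.2 ⟨hbv, hb⟩) hwb
  · push Not at hadj
    have h1 := hA.2 S hSA.1 hSne fun s hs a ha hsa =>
      hcl s hs a (Finset.mem_erase.2 ⟨by rintro rfl; exact hadj s hs hsa.symm, ha⟩) hsa
    refine hSe (hS.antisymm ?_)
    rw [h1]
    exact Finset.erase_subset _ _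

lemma Bounded.exists_le (h : G.Bounded k A) :
    ∃ D, G.HitsCores k A D ∧ (k.choose 2 + 2) * D.card ≤ G.size A + 1 := by
  obtain ⟨D, hD, h | h⟩ := h
  · exact ⟨D, hD, by omega⟩
  · exact ⟨D, hD, by omega⟩

/-- Removing a vertex with a pendant `4`-cycle. -/
lemma exists_hitsCores_of_pendant_cycle (hA : G.Conn A)
    (ih : ∀ B, B ⊂ A → G.Conn B → G.Bounded 3 B) {x : V} (hx : x ∈ A) {K : Finset V}
    (hK : K ∈ G.pieces (A \ {x})) (hKc : G.IsCyc 4 K) :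
    ∃ D, G.HitsCores 3 A D ∧ 5 * D.card ≤ G.size A := by
  have hxA : {x} ⊆ A := by simpa using hx
  have hne := Finset.singleton_nonempty x
  have hex : ∀ C ∈ G.pieces (A \ {x}), ∃ D, G.HitsCores 3 C D ∧
      5 * D.card ≤ G.size C + G.links {x} C := fun C hC => by
    obtain ⟨D, hD, h⟩ := (ih C (pieces_ssubset hxA hne hC) (mem_pieces.1 hC).2.1).exists_le
    have := hA.links_piece_pos hxA hne hC
    refine ⟨D, hD, ?_⟩
    rw [show Nat.choose 3 2 + 2 = 5 from rfl] at h
    omega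
  choose! D hD hle using hex
  refine ⟨insert x (((G.pieces (A \ {x})).erase K).biUnion D),
    hitsCores_of_pieces (X := {x}) (fun S hS hc hd => ?_) (fun C hC => ?_), ?_⟩
  · exact Hits.of_mem (Finset.mem_insert_self _ _) (by simpa using hd)
  · by_cases hCK : C = K
    · subst hCK
      intro S hS hc
      rw [hKc.core_eq_four hS hc]
      obtain ⟨x', hx', c, hcC, hxc⟩ := hA.exists_adj_piece hxA hne hC
      rw [Finset.mem_singleton] at hx'
      subst hx'
      exact Hits.of_adj (Finset.mem_insert_self _ _) hcC hxc
    · exact (hD C hC).mono subset_rfl ((Finset.subset_biUnion_of_mem D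
          (Finset.mem_erase.2 ⟨hCK, hC⟩)).trans (Finset.subset_insert _ _))
  -- The four edges of the cycle and one link repay the price 5 of `x`.
  · have hsize := size_eq_add_sum_pieces (G := G) hxA
    rw [← Finset.add_sum_erase _ _ hK, hKc.size_four] at hsize
    have := hA.links_piece_pos hxA hne hK
    have h2 := Finset.sum_le_sum (s := (G.pieces (A \ {x})).erase K)
        fun C hC => hle C (Finset.mem_of_mem_erase hC)
    have h3 := mul_card_biUnion_le 5 ((G.pieces (A \ {x})).erase K) D
    have h4 := Finset.card_insert_le x (((G.pieces (A \ {x})).erase K).biUnion D)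
    omega

lemma isKClique_triple {x y z : V} (h1 : G.Adj x y) (h2 : G.Adj y z) (h3 : G.Adj x z) :
    G.IsKClique 3 {x, y, z} := by
  refine ⟨Finset.card_eq_three.2 ⟨x, y, z, h1.ne, h3.ne, h2.ne, rfl⟩, ?_⟩
  simp only [Finset.mem_insert, Finset.mem_singleton]
  rintro a (rfl | rfl | rfl) b (rfl | rfl | rfl) hne
  all_goals first | exact absurd rfl hne | assumption | (apply G.adj_symm; assumption)

lemma isCyc_four_of_regular (hfree : ∀ W ⊆ A, ¬ G.IsKClique 3 W)
    (hreg : ∀ v ∈ A, G.degIn A v = 2) (hcard : A.card = 4) : G.IsCyc 4 A := by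
  have hnb : ∀ v ∈ A, ∃ x ∈ A, ∃ y ∈ A, x ≠ y ∧ G.Adj v x ∧ G.Adj v y ∧
      ∀ w ∈ A, G.Adj v w → w = x ∨ w = y := by
    intro v hv
    obtain ⟨x, y, hxy, h⟩ := Finset.card_eq_two.1 (hreg v hv)
    have hx : x ∈ A.filter (G.Adj v) := by rw [h]; simp
    have hy : y ∈ A.filter (G.Adj v) := by rw [h]; simp
    rw [Finset.mem_filter] at hx hy
    refine ⟨x, hx.1, y, hy.1, hxy, hx.2, hy.2, fun w hw hvw => ?_⟩
    have : w ∈ A.filter (G.Adj v) := by simp [hw, hvw]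
    rw [h] at this
    simpa using this
  have htri : ∀ {x y z}, x ∈ A → y ∈ A → z ∈ A → G.Adj x y → G.Adj y z → ¬ G.Adj x z := by
    intro x y z hx hy hz h1 h2 h3
    refine hfree {x, y, z} (fun w hw => ?_) (isKClique_triple h1 h2 h3)
    simp only [Finset.mem_insert, Finset.mem_singleton] at hw
    rcases hw with rfl | rfl | rfl <;> assumption
  obtain ⟨v, hv⟩ : A.Nonempty := Finset.card_pos.1 (by omega)
  obtain ⟨x, hx, y, hy, hxy, hvx, hvy, huv⟩ := hnb v hv
  have hnxy : ¬ G.Adj x y := htri hx hv hy hvx.symm hvy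
  obtain ⟨w, hw, hwv, hxw⟩ : ∃ w ∈ A, w ≠ v ∧ G.Adj x w := by
    obtain ⟨p, hp, q, hq, hpq, hxp, hxq, -⟩ := hnb x hx
    by_cases hpv : p = v
    · exact ⟨q, hq, fun h => hpq (hpv.trans h.symm), hxq⟩
    · exact ⟨p, hp, hpv, hxp⟩
  have hwy : w ≠ y := by rintro rfl; exact hnxy hxw
  have hsub : {v, x, w, y} ⊆ A := by
    intro z hz
    simp only [Finset.mem_insert, Finset.mem_singleton] at hz
    rcases hz with rfl | rfl | rfl | rfl <;> assumption
  have hnd : [v, x, w, y].Nodup := by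
    have := hvx.ne
    have := hvy.ne
    have := hxw.ne
    simp
    tauto
  have hA : {v, x, w, y} = A := by
    refine Finset.eq_of_subset_of_card_le hsub ?_
    have := List.toFinset_card_of_nodup hnd
    simp only [List.toFinset_cons, List.toFinset_nil, insert_empty_eq, List.length_cons,
      List.length_nil] at this
    omega
  have hnvw : ¬ G.Adj v w := htri hv hx hw hvx hxw
  have hyw : G.Adj w y := by
    obtain ⟨p, hp, q, hq, hpq, hyp, hyq, -⟩ := hnb y hy
    have : ∀ z ∈ A, G.Adj y z → z = v ∨ z = w := by
      intro z hz hyz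
      rw [← hA] at hz
      simp only [Finset.mem_insert, Finset.mem_singleton] at hz
      rcases hz with rfl | rfl | rfl | rfl
      · exact Or.inl rfl
      · exact absurd hyz.symm hnxy
      · exact Or.inr rfl
      · exact absurd hyz (G.loopless.irrefl _)
    rcases this p hp hyp with rfl | rfl
    · rcases this q hq hyq with rfl | rfl
      · exact absurd rfl hpq
      · exact hyq.symm
    · exact hyp.symm
  rw [← hA]
  exact isCyc_four_of_path hnd hvx hxw hyw hvy.symm hnvw hnxy

/-- A leaf lies in no core, and its edge absorbs the 1 lost in the induction. A connected 2-regular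
graph has no core but itself, so one vertex suffices. Otherwise some `v` has degree at least 3, and
`N[v]` contains three edges of the price 5. -/
lemma bounded_of_triangleFree (hA : G.Conn A) (hfree : ∀ W ⊆ A, ¬ G.IsKClique 3 W)
    (ih : ∀ B, B ⊂ A → G.Conn B → G.Bounded 3 B) : G.Bounded 3 A := by
  have h5 : Nat.choose 3 2 + 2 = 5 := rfl
  by_cases hpend : ∃ x ∈ A, ∃ K ∈ G.pieces (A \ {x}), G.IsCyc 4 K
  · obtain ⟨x, hx, K, hK, hKc⟩ := hpend
    obtain ⟨D, hD, hc⟩ := exists_hitsCores_of_pendant_cycle hA ih hx hK hKc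
    exact ⟨D, hD, Or.inl hc⟩
  push Not at hpend
  by_cases hleaf : ∃ v ∈ A, G.degIn A v ≤ 1
  · obtain ⟨v, hv, hdeg⟩ := hleaf
    rcases (A.erase v).eq_empty_or_nonempty with he | hne
    · refine ⟨∅, fun S hS hc => ?_, Or.inl (by simp)⟩
      have h1 := Finset.card_le_card hS
      have h2 := Finset.card_erase_add_one hv
      have h3 := hc.le_card
      rw [he, Finset.card_empty] at h2
      omega
    · obtain ⟨D, hD, hc⟩ := (ih _ (Finset.erase_ssubset hv) (hA.erase_leaf hdeg hne)).exists_le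
      refine ⟨D, hD.of_erase (by omega), Or.inl (hc.trans ?_)⟩
      have hC : A \ {v} = A.erase v := Finset.sdiff_singleton_eq_erase v A
      obtain ⟨b, hb⟩ := hne
      obtain ⟨C, hC, -⟩ := exists_piece (G := G) (B := A \ {v}) (hC ▸ hb)
      have h1 := links_pos.2 (hA.exists_adj_piece (by simpa using hv) (by simp) hC)
      have h2 := links_mono (G := G) (subset_refl {v})
        ((mem_pieces.1 hC).1.trans Finset.sdiff_subset)
      rw [links_singleton_left (B := A)] at h2
      have := size_erase (G := G) hv
      omega
  push Not at hleaf
  by_cases hreg : ∀ v ∈ A, G.degIn A v = 2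
  · obtain ⟨v, hv⟩ := hA.1
    have hsize : G.size A = A.card := by
      have h1 := two_mul_size (G := G) A
      unfold links at h1
      rw [Finset.sum_congr rfl hreg] at h1
      simp at h1
      omega
    have hhit : G.HitsCores 3 A {v} := by
      intro S hS hc
      have : S = A := by
        refine hA.2 S hS hc.1 fun s hs a ha hsa => ?_
        have h1 := hc.2 s hs
        have h2 := hreg s (hS hs)
        have h3 := Finset.eq_of_subset_of_card_le (Finset.filter_subset_filter (G.Adj s) hS)
          (by unfold degIn at h1 h2; omega)
        have : a ∈ A.filter (G.Adj s) := by simp [ha, hsa]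
        rw [← h3] at this
        exact (Finset.mem_filter.1 this).1
      exact Hits.of_mem (Finset.mem_singleton_self v) (this ▸ hv)
    have h3 : 3 ≤ A.card := by
      have := degIn_add_one_le (G := G) hv
      have := hreg v hv
      omega
    have hne3 : A.card ≠ 3 := by
      intro h
      by_cases hK : G.IsKClique 3 A
      · exact hfree A subset_rfl hK
      · have := two_mul_size_of_not_isKClique h hK
        omega
    by_cases h4 : A.card = 4
    · refine ⟨{v}, hhit, Or.inr ⟨?_, Or.inr (Or.inr ⟨rfl, isCyc_four_of_regular hfree hreg h4⟩)⟩⟩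
      rw [h5, hsize, h4, Finset.card_singleton]
    · refine ⟨{v}, hhit, Or.inl ?_⟩
      rw [h5, hsize, Finset.card_singleton]
      omega
  push Not at hreg
  obtain ⟨v, hv, hdv⟩ := hreg
  have hdv3 : 3 ≤ G.degIn A v := by have := hleaf v hv; omega
  set X := insert v (A.filter (G.Adj v)) with hX
  have hXA : X ⊆ A := Finset.insert_subset hv (Finset.filter_subset _ _)
  have hXne : X.Nonempty := Finset.insert_nonempty _ _
  have hex : ∀ C ∈ G.pieces (A \ X), ∃ D, G.HitsCores 3 C D ∧
      5 * D.card + 1 ≤ G.size C + G.links X C ∧ 5 * D.card ≤ G.size C + 1 := by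
    intro C hC
    have hlp := hA.links_piece_pos hXA hXne hC
    obtain ⟨D, hD, h⟩ := ih C (pieces_ssubset hXA hXne hC) (mem_pieces.1 hC).2.1
    rw [h5] at h
    refine ⟨D, hD, ?_⟩
    rcases h with h | ⟨h, hE⟩
    · omega
    -- Every component has positive surplus: a pure special graph contains a triangle, and a 4-cycle
    -- with one link would be pendant.
    · have hl1 : G.links X C ≠ 1 := by
        intro hl1
        have hCA := (mem_pieces.1 hC).1.trans Finset.sdiff_subset
        rcases hE with ⟨R, W, a, hR⟩ | ⟨h2, -⟩ | ⟨-, hcyc⟩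
        · obtain ⟨r, hr⟩ := hR.conn.1
          exact hfree _ ((hR.clique_subset hr).trans hCA) (hR.clique hr)
        · omega
        · obtain ⟨x, hx, hCx⟩ := mem_pieces_singleton hXA hC hl1
          exact hpend x hx C hCx hcyc
      omega
  choose! D hD hle hle1 using hex
  have hXsize : G.degIn A v ≤ G.size X := by
    rw [hX, size_insert (by simp)]
    have : G.degIn (A.filter (G.Adj v)) v = G.degIn A v := by
      unfold degIn
      rw [Finset.filter_filter]
      simp
    omega
  -- Each neighbour of `v` has a second neighbour, which lies outside `X` for want of triangles.
  have hlinks : 3 ≤ G.links X (A \ X) := by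
    have h1 : ∀ x ∈ A.filter (G.Adj v), 1 ≤ G.degIn (A \ X) x := by
      intro x hx
      rw [Finset.mem_filter] at hx
      have hcard := hleaf x hx.1
      obtain ⟨w, hw, hwv⟩ : ∃ w ∈ A.filter (G.Adj x), w ≠ v :=
        Finset.exists_mem_ne hcard v
      rw [Finset.mem_filter] at hw
      refine degIn_pos.2 ⟨w, Finset.mem_sdiff.2 ⟨hw.1, fun hwX => ?_⟩, hw.2⟩
      have hvw := (Finset.mem_filter.1 ((Finset.mem_insert.1 hwX).resolve_left hwv)).2
      refine hfree {v, x, w} (fun z hz => ?_) (isKClique_triple hx.2 hw.2 hvw)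
      simp only [Finset.mem_insert, Finset.mem_singleton] at hz
      rcases hz with rfl | rfl | rfl
      exacts [hv, hx.1, hw.1]
    have h2 := Finset.card_nsmul_le_sum _ _ 1 h1
    have h3 := links_mono (G := G) (Finset.subset_insert v (A.filter (G.Adj v)))
      (subset_refl (A \ X))
    rw [← hX] at h3
    simp only [smul_eq_mul, mul_one] at h2
    unfold links at h3 ⊢
    exact (hdv3.trans h2).trans h3
  have hsize := size_eq_add_sum_pieces (G := G) hXA
  -- The missing 2 comes from two components, or from the three or more links of a single one.
  have hfin : ∑ C ∈ G.pieces (A \ X), 5 * (D C).card + 2 ≤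
      ∑ C ∈ G.pieces (A \ X), (G.size C + G.links X C) := by
    have hle' : ∀ C ∈ G.pieces (A \ X), 5 * (D C).card ≤ G.size C + G.links X C := fun C hC => by
      have := hle C hC
      omega
    rw [links_pieces] at hlinks
    obtain ⟨C₁, hC₁⟩ : (G.pieces (A \ X)).Nonempty := by
      by_contra hemp
      rw [Finset.not_nonempty_iff_eq_empty.1 hemp] at hlinks
      simp at hlinks
    by_cases hoth : ∃ C₂ ∈ G.pieces (A \ X), C₂ ≠ C₁
    · obtain ⟨C₂, hC₂, hne⟩ := hoth
      have hm : C₂ ∈ (G.pieces (A \ X)).erase C₁ := Finset.mem_erase.2 ⟨hne, hC₂⟩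
      rw [← Finset.add_sum_erase _ _ hC₁, ← Finset.add_sum_erase _ _ hC₁,
        ← Finset.add_sum_erase _ _ hm, ← Finset.add_sum_erase _ _ hm]
      have h4 := Finset.sum_le_sum (s := ((G.pieces (A \ X)).erase C₁).erase C₂)
        fun C hC => hle' C (Finset.mem_of_mem_erase (Finset.mem_of_mem_erase hC))
      have := hle C₁ hC₁
      have := hle C₂ hC₂
      omega
    · push Not at hoth
      have hP : G.pieces (A \ X) = {C₁} := Finset.eq_singleton_iff_unique_mem.2 ⟨hC₁, hoth⟩
      rw [hP, Finset.sum_singleton] at hlinks ⊢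
      rw [Finset.sum_singleton]
      have := hle1 C₁ hC₁
      omega
  refine ⟨insert v ((G.pieces (A \ X)).biUnion D), ?_, Or.inl ?_⟩
  · refine HitsCores.of_closedNbhd hv ?_
    refine hitsCores_of_pieces (X := ∅) (fun S _ _ h => absurd (Finset.disjoint_empty_right S) h) ?_
    rw [Finset.sdiff_empty]
    exact fun C hC => (hD C hC).mono subset_rfl (Finset.subset_biUnion_of_mem D hC)
  · rw [h5]
    have h3 := mul_card_biUnion_le 5 (G.pieces (A \ X)) D
    have h4 := Finset.card_insert_le v ((G.pieces (A \ X)).biUnion D)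
    omega

/-- The isolation bound for induced connected subgraphs. -/
theorem Conn.bounded (hk : 1 ≤ k) (A : Finset V) (hA : G.Conn A) (hnA : ¬ G.IsKClique k A) :
    G.Bounded k A := by
  induction A using Finset.strongInduction with
  | H A ih =>
  by_cases hcl : ∃ U ⊆ A, G.IsKClique k U
  · obtain ⟨U, hUA, hU⟩ := hcl
    exact bounded_of_clique hk (fun B hB hBc hBn => ih B hB hBc hBn) hA hnA hUA hU
  push Not at hcl
  rcases (show k = 1 ∨ k = 2 ∨ k = 3 ∨ 4 ≤ k by omega) with rfl | rfl | rfl | hk4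
  · obtain ⟨v, hv⟩ := hA.1
    refine absurd ⟨rfl, fun x hx y hy hne => ?_⟩ (hcl {v} (by simpa using hv))
    rw [Finset.mem_singleton] at hx hy
    exact absurd (hx.trans hy.symm) hne
  · refine ⟨∅, fun S hS hc => ?_, Or.inl (by simp)⟩
    obtain ⟨s, hs, s', hs', hss⟩ := hc.exists_adj
    refine absurd (isKClique_pair hss) (hcl _ fun w hw => ?_)
    simp only [Finset.mem_insert, Finset.mem_singleton] at hw
    rcases hw with rfl | rfl
    exacts [hS hs, hS hs']
  · exact bounded_of_triangleFree hA hcl fun B hB hBc => ih B hB hBc (hcl B hB.1)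
  · obtain ⟨D, hD, hc⟩ := exists_hitsCores_of_cliqueFree hk4 A hcl
    exact ⟨D, hD, Or.inl hc⟩

end Isolation

/-! ### From cores to isolation numbers -/

section Isolation

open scoped Classical

variable {V : Type u} {G : SimpleGraph V} {k l m n q r : ℕ}

/-! ### Cores and the isolation families -/

lemma IsCore.image {W : Type*} {H : SimpleGraph W} {T : Finset W} (hT : H.IsCore k T) {f : W → V}
    (hf : Function.Injective f) (hadj : ∀ a b, H.Adj a b → G.Adj (f a) (f b)) :
    G.IsCore k (T.image f) := by
  refine ⟨hT.1.image f, fun s hs => ?_⟩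
  obtain ⟨w, hw, rfl⟩ := Finset.mem_image.1 hs
  refine (hT.2 w hw).trans (Nat.add_le_add_right ?_ 1)
  unfold degIn
  rw [← Finset.card_image_of_injective _ hf]
  refine Finset.card_le_card fun x hx => ?_
  obtain ⟨y, hy, rfl⟩ := Finset.mem_image.1 hx
  rw [Finset.mem_filter] at hy ⊢
  exact ⟨Finset.mem_image_of_mem f hy.1, hadj w y hy.2⟩

/-- Greedy colouring: a graph without `k`-cores is `(k - 1)`-colourable. -/
lemma colorable_of_no_core {W : Type*} [Fintype W] {H : SimpleGraph W}
    (h : ∀ T, ¬ H.IsCore k T) : H.Colorable (k - 1) := by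
  have key : ∀ T : Finset W, ∃ c : W → ℕ, (∀ w ∈ T, c w < k - 1) ∧
      ∀ w ∈ T, ∀ w' ∈ T, H.Adj w w' → c w ≠ c w' := by
    intro T
    induction T using Finset.strongInduction with
    | H T ih =>
    rcases T.eq_empty_or_nonempty with rfl | hne
    · exact ⟨fun _ => 0, by simp, by simp⟩
    · have hT := h T
      simp only [IsCore, hne, true_and] at hT
      push Not at hT
      obtain ⟨w, hw, hdeg⟩ := hT
      obtain ⟨c, hc, hproper⟩ := ih (T.erase w) (Finset.erase_ssubset hw)
      obtain ⟨j, hj, hjn⟩ : ∃ j ∈ Finset.range (k - 1), j ∉ (T.filter (H.Adj w)).image c := by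
        refine Finset.exists_mem_notMem_of_card_lt_card ?_
        refine Finset.card_image_le.trans_lt ?_
        rw [Finset.card_range]
        unfold degIn at hdeg
        omega
      rw [Finset.mem_range] at hj
      have hjn' : ∀ x ∈ T, H.Adj w x → c x ≠ j := fun x hx hwx he =>
        hjn (Finset.mem_image.2 ⟨x, by simp [hx, hwx], he⟩)
      refine ⟨Function.update c w j, fun x hx => ?_, fun x hx y hy hxy => ?_⟩
      · by_cases hxw : x = w
        · subst hxw; simpa using hj
        · rw [Function.update_of_ne hxw]
          exact hc x (Finset.mem_erase.2 ⟨hxw, hx⟩)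
      · by_cases hxw : x = w
        · subst hxw
          rw [Function.update_self, Function.update_of_ne hxy.ne']
          exact (hjn' y hy hxy).symm
        · by_cases hyw : y = w
          · subst hyw
            rw [Function.update_self, Function.update_of_ne hxw]
            exact hjn' x hx hxy.symm
          · rw [Function.update_of_ne hxw, Function.update_of_ne hyw]
            exact hproper x (Finset.mem_erase.2 ⟨hxw, hx⟩) y (Finset.mem_erase.2 ⟨hyw, hy⟩) hxy
  obtain ⟨c, hc, hproper⟩ := key Finset.univ
  exact ⟨Coloring.mk (fun w => (⟨c w, hc w (Finset.mem_univ w)⟩ : Fin (k - 1))) fun {w w'} hww he =>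
    hproper w (Finset.mem_univ _) w' (Finset.mem_univ _) hww (by simpa using he)⟩

lemma regularFamily.exists_core {W : Type u} [Fintype W] {H : SimpleGraph W}
    (h : regularFamily k W H) : ∃ T, H.IsCore k T := by
  obtain ⟨hne, d, hd, hreg⟩ := h
  refine ⟨Finset.univ, Finset.univ_nonempty, fun w _ => ?_⟩
  have : H.degIn Finset.univ w = d := by
    rw [← hreg.degree_eq w, ← card_neighborFinset_eq_degree, degIn]
    congr 1
    ext x
    simp
  omega

lemma chromaticFamily.exists_core (hk : 1 ≤ k) {W : Type u} [Fintype W] {H : SimpleGraph W}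
    (h : chromaticFamily k W H) : ∃ T, H.IsCore k T := by
  by_contra hcon
  push Not at hcon
  have h1 := h.2.trans (colorable_of_no_core hcon).chromaticNumber_le
  rw [Nat.cast_le] at h1
  omega

lemma HitsCores.isIsolating [Fintype V] (hk : 1 ≤ k) {D : Finset V}
    (h : G.HitsCores k Finset.univ D) : G.IsIsolating (isolationFamily l k) D := by
  intro W _ H hF hcont
  have hcore : ∃ T, H.IsCore k T := by
    unfold isolationFamily at hF
    split at hF
    · exact regularFamily.exists_core hF
    · exact chromaticFamily.exists_core hk hF
    · exact hF.elim regularFamily.exists_core (chromaticFamily.exists_core hk)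
    · exact hF.elim
  obtain ⟨T, hT⟩ := hcore
  obtain ⟨f⟩ := hcont
  have hS : G.IsCore k (T.image fun w => (f w).1) :=
    hT.image (Subtype.val_injective.comp f.injective) fun a b hab => f.toHom.map_adj hab
  obtain ⟨s, hs, d, hd, hsd⟩ := h _ (Finset.subset_univ _) hS
  obtain ⟨w, -, rfl⟩ := Finset.mem_image.1 hs
  exact (f w).2 ⟨d, hd, hsd⟩

lemma isolationNumber_le {F : GraphFamily.{u}} {D : Finset V} (h : G.IsIsolating F (D : Set V)) :
    G.isolationNumber F ≤ D.card := Nat.sInf_le ⟨D, h, rfl⟩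

lemma le_isolationNumber [Fintype V]
    (h : ∀ D : Finset V, G.IsIsolating (isolationFamily l k) (D : Set V) → n ≤ D.card) :
    n ≤ G.isolationNumber (isolationFamily l k) := by
  -- An infimum over the empty set would be 0; the whole vertex set shows that the minimum is
  -- attained.
  obtain ⟨D, hD, hc⟩ := Nat.sInf_mem (s := {n | ∃ D : Finset V,
    G.IsIsolating (isolationFamily l k) (D : Set V) ∧ D.card = n})
    ⟨_, Finset.univ, by simpa using G.isIsolating_univ l k, rfl⟩
  unfold isolationNumber
  rw [← hc]
  exact h D hD

/-- Every `k`-clique is hit by an isolating set. -/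
lemma IsIsolating.exists_mem_clique (hl : l = 1 ∨ l = 2 ∨ l = 3) (hk : 1 ≤ k) {D : Set V}
    (h : G.IsIsolating (isolationFamily l k) D) {U : Finset V} (hU : G.IsKClique k U) :
    ∃ u ∈ U, u ∈ G.closedNbhd D := by
  by_contra hcon
  push Not at hcon
  have hcard : Fintype.card U = k := by rw [Fintype.card_coe, hU.1]
  have hne : Nonempty U := Fintype.card_pos_iff.1 (by omega)
  have h1 : regularFamily k U (⊤ : SimpleGraph U) := by
    refine ⟨hne, k - 1, by omega, fun v => ?_⟩
    have := hcard ▸ complete_graph_degree v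
    convert this
  have h2 : chromaticFamily k U (⊤ : SimpleGraph U) := by
    refine ⟨hne, ?_⟩
    rw [chromaticNumber_top, hcard]
  refine h U ⊤ ?_ ⟨⟨⟨fun u => ⟨u.1, hcon u.1 u.2⟩, fun {a b} hab => ?_⟩, fun a b hab => ?_⟩⟩
  · rcases hl with rfl | rfl | rfl
    exacts [h1, h2, Or.inl h1]
  · exact hU.2 a a.2 b b.2 fun h => hab.ne (Subtype.ext h)
  · exact Subtype.ext (congrArg (fun x => x.1) hab)

/-! ### The whole vertex set -/

lemma Connected.conn_univ [Fintype V] (h : G.Connected) : G.Conn Finset.univ := by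
  obtain ⟨v⟩ := h.nonempty
  refine ⟨⟨v, Finset.mem_univ v⟩, fun S _ hne hcl => Finset.eq_univ_iff_forall.2 fun w => ?_⟩
  obtain ⟨s, hs⟩ := hne
  obtain ⟨p⟩ := h.preconnected s w
  by_contra hw
  obtain ⟨d, -, h1, h2⟩ := p.exists_boundary_dart (S : Set V) hs hw
  exact h2 (hcl d.fst h1 d.snd (Finset.mem_univ _) d.adj)

lemma size_univ [Fintype V] : G.size Finset.univ = G.edgeSet.ncard := by
  have h1 := two_mul_size (G := G) Finset.univ
  have h2 := G.sum_degrees_eq_twice_card_edges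
  have h3 : G.edgeSet.ncard = G.edgeFinset.card := by
    rw [Set.ncard_eq_toFinset_card']
    rfl
  have h4 : G.links Finset.univ Finset.univ = ∑ v, G.degree v := by
    unfold links
    refine Finset.sum_congr rfl fun v _ => ?_
    rw [← card_neighborFinset_eq_degree, degIn]
    congr 1
    ext x
    simp
  omega

lemma IsKClique.nonempty_iso [Fintype V] (h : G.IsKClique k Finset.univ) :
    Nonempty (G ≃g (⊤ : SimpleGraph (Fin k))) := by
  have hcard : Fintype.card V = k := h.1
  let e : V ≃ Fin k := Fintype.equivFinOfCardEq hcard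
  refine ⟨⟨e, fun {a b} => ?_⟩⟩
  rw [top_adj]
  constructor
  · intro hab
    exact h.2 a (Finset.mem_univ _) b (Finset.mem_univ _) fun he => hab (by rw [he])
  · intro hab he
    exact hab.ne (e.injective he)

lemma IsCyc.nonempty_iso [Fintype V] (h : G.IsCyc n Finset.univ) :
    Nonempty (G ≃g cycleGraph n) := by
  obtain ⟨c, hinj, hsurj, hadj⟩ := h
  have hbij : Function.Bijective c := by
    refine ⟨hinj, fun v => ?_⟩
    have : v ∈ Finset.univ.image c := hsurj ▸ Finset.mem_univ v
    simpa using this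
  exact ⟨(⟨Equiv.ofBijective c hbij, fun {i j} => hadj i j⟩ : cycleGraph n ≃g G).symm⟩

lemma isCyc_of_iso [Fintype V] (φ : G ≃g cycleGraph n) : G.IsCyc n Finset.univ := by
  refine ⟨φ.symm, φ.symm.injective, ?_, fun i j => φ.symm.map_adj_iff⟩
  ext v
  simp only [Finset.mem_univ, Finset.mem_image, true_and, true_iff]
  exact ⟨φ v, φ.symm_apply_apply v⟩

/-! ### Cycles -/

lemma two_le_isolationNumber_of_iso [Fintype V] (hl : l = 1 ∨ l = 2 ∨ l = 3)
    (φ : G ≃g cycleGraph 5) : 2 ≤ G.isolationNumber (isolationFamily l 2) := by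
  refine le_isolationNumber fun D hD => ?_
  by_contra hlt
  have : Nonempty V := ⟨φ.symm 0⟩
  obtain ⟨d, hd⟩ := Finset.card_le_one_iff_subset_singleton.1 (show D.card ≤ 1 by omega)
  -- The edge opposite to a vertex is disjoint from its closed neighbourhood.
  have key : ∀ i : Fin 5, (cycleGraph 5).Adj (i + 2) (i + 3) ∧ i + 2 ≠ i ∧ i + 3 ≠ i ∧
      ¬ (cycleGraph 5).Adj i (i + 2) ∧ ¬ (cycleGraph 5).Adj i (i + 3) := by decide
  obtain ⟨h1, h2, h3, h4, h5⟩ := key (φ d)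
  obtain ⟨u, hu, d', hd', hdu⟩ := hD.exists_mem_clique hl (by omega)
    (isKClique_pair (φ.symm.map_adj_iff.2 h1))
  have hdd : d' = d := by simpa using hd hd'
  subst hdd
  simp only [Finset.mem_insert, Finset.mem_singleton] at hu
  rcases hdu with rfl | hdu
  · rcases hu with hu | hu
    · exact h2 (by conv_rhs => rw [hu, φ.apply_symm_apply])
    · exact h3 (by conv_rhs => rw [hu, φ.apply_symm_apply])
  · rw [← φ.map_adj_iff] at hdu
    rcases hu with rfl | rfl
    · rw [φ.apply_symm_apply] at hdu; exact h4 hdu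
    · rw [φ.apply_symm_apply] at hdu; exact h5 hdu

/-- The 4-cycle is itself 2-regular, so the empty set does not isolate it. -/
lemma one_le_isolationNumber_of_iso [Fintype V] (hl : l = 1 ∨ l = 3)
    (φ : G ≃g cycleGraph 4) : 1 ≤ G.isolationNumber (isolationFamily l 3) := by
  refine le_isolationNumber fun D hD => ?_
  by_contra hlt
  have hD0 : D = ∅ := Finset.card_eq_zero.1 (by omega)
  subst hD0
  have h1 : regularFamily 3 V G := by
    refine ⟨⟨φ.symm 0⟩, 2, le_rfl, fun v => ?_⟩
    have h4 : ∀ i : Fin 4, (cycleGraph 4).degree i = 2 := by decide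
    rw [← h4 (φ v), ← φ.degree_eq v]
  have hF : isolationFamily l 3 V G := by
    rcases hl with rfl | rfl
    exacts [h1, Or.inl h1]
  have hnot : ∀ v, v ∉ G.closedNbhd ((∅ : Finset V) : Set V) := by
    rintro v ⟨d, hd, -⟩
    simp at hd
  exact hD V G hF ⟨⟨⟨fun v => ⟨v, hnot v⟩, fun h => h⟩, fun a b hab =>
    congrArg Subtype.val hab⟩⟩

/-- The 4-cycle is bipartite, hence so are all its subgraphs. -/
lemma isolationNumber_chromatic_of_iso (φ : G ≃g cycleGraph 4) :
    G.isolationNumber (isolationFamily 2 3) = 0 := by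
  refine Nat.le_zero.1 (isolationNumber_le (D := ∅) fun W _ H hF hcont => ?_)
  obtain ⟨f⟩ := hcont
  have hc : (cycleGraph 4).Colorable 2 :=
    ⟨Coloring.mk (fun i => if i = 0 ∨ i = 2 then (0 : Fin 2) else 1) (by decide)⟩
  have hH : H.Colorable 2 :=
    hc.of_hom ((φ.toHom.comp (Embedding.induce _).toHom).comp f.toHom)
  have := hF.2.trans hH.chromaticNumber_le
  rw [Nat.cast_le] at this
  omega

/-! ### Special graphs -/

/-- A vertex of `U i` has neighbours only in `U i` and possibly `v i`. An isolating set dominates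
some vertex of each `U i`, so it meets each of the disjoint sets `U i ∪ {v i}`. -/
lemma IsSpecialUnion.le_isolationNumber [Fintype V] (hl : l = 1 ∨ l = 2 ∨ l = 3) (hk : 1 ≤ k)
    (h : G.IsSpecialUnion k q r) : q ≤ G.isolationNumber (isolationFamily l k) := by
  obtain ⟨v, U, A, T, T', i₀, hv, hU, hvU, hA, hT, -, -, -, hT', -, hE⟩ := h
  refine SimpleGraph.le_isolationNumber fun D hD => ?_
  have hex : ∀ i, ∃ d ∈ D, d ∈ U i ∨ d = v i := by
    intro i
    obtain ⟨hUk, hvi, hverts, u₁, hu₁, hadj⟩ := hA i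
    have hcl : G.IsKClique k (U i) := ⟨hUk, fun x hx y hy hxy =>
      (A i).adj_sub ((hadj x y).2 (Or.inl ⟨hx, hy, hxy⟩))⟩
    obtain ⟨u, hu, d, hd, hdu⟩ := hD.exists_mem_clique hl hk hcl
    refine ⟨d, hd, ?_⟩
    rcases hdu with rfl | hdu
    · exact Or.inl hu
    have hmem : s(d, u) ∈ G.edgeSet := hdu
    rw [← hE] at hmem
    rcases hmem with (hmem | hmem) | hmem
    · have : u ∈ T.verts := T.edge_vert (Subgraph.mem_edgeSet.1 hmem).symm
      rw [hT] at this
      obtain ⟨j, rfl⟩ := this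
      exact absurd hu (hvU j i)
    · have h1 : u ∈ T'.verts := T'.edge_vert (Subgraph.mem_edgeSet.1 hmem).symm
      have h2 : u ∈ T'.verts ∩ ⋃ i, (A i).verts :=
        ⟨h1, Set.mem_iUnion.2 ⟨i, by rw [hverts]; exact Or.inr hu⟩⟩
      rw [hT'] at h2
      rw [Set.mem_singleton_iff.1 h2] at hu
      exact absurd hu (hvU i₀ i)
    · obtain ⟨j, hj⟩ := Set.mem_iUnion.1 hmem
      have hj' : (A j).Adj d u := Subgraph.mem_edgeSet.1 hj
      obtain ⟨-, -, hvertsj, w, hw, hadjj⟩ := hA j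
      have huj : u ∈ (A j).verts := (A j).edge_vert hj'.symm
      rw [hvertsj] at huj
      have hij : i = j := by
        by_contra hne
        rcases huj with rfl | huj
        · exact hvU j i hu
        · exact Finset.disjoint_left.1 (hU i j hne) hu huj
      subst hij
      rcases (hadjj d u).1 hj' with h1 | h1 | h1
      · exact Or.inl h1.1
      · exact absurd (h1.2 ▸ hu) hvi
      · exact Or.inr h1.1
  choose d hd hdU using hex
  have hinj : Function.Injective d := by
    intro i j hij
    by_contra hne
    have h1 := hdU i
    have h2 := hdU j
    rw [← hij] at h2
    rcases h1 with h1 | h1 <;> rcases h2 with h2 | h2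
    · exact Finset.disjoint_left.1 (hU i j hne) h1 h2
    · exact hvU j i (h2 ▸ h1)
    · exact hvU i j (h1 ▸ h2)
    · exact hne (hv (h1.symm.trans h2))
  calc q = (Finset.univ.image d).card := by
        rw [Finset.card_image_of_injective _ hinj, Finset.card_univ, Fintype.card_fin]
    _ ≤ D.card := Finset.card_le_card fun x hx => by
        obtain ⟨i, -, rfl⟩ := Finset.mem_image.1 hx
        exact hd i

lemma size_image {W : Type*} {H : SimpleGraph W} {f : W → V} (hf : Function.Injective f)
    (hadj : ∀ a b, G.Adj (f a) (f b) ↔ H.Adj a b) (T : Finset W) :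
    G.size (T.image f) = H.size T := by
  unfold size links
  rw [Finset.sum_image fun _ _ _ _ h => hf h]
  congr 1
  refine Finset.sum_congr rfl fun a _ => ?_
  unfold degIn
  rw [Finset.filter_image, Finset.card_image_of_injective _ hf]
  simp only [hadj]

lemma Conn.isTree_coe {R : Finset V} (h : G.Conn R) (hsize : G.size R + 1 = R.card)
    {T : G.Subgraph} (hT : T.verts = R) (hadj : ∀ a b : T.verts, T.coe.Adj a b ↔ G.Adj a b) :
    T.coe.IsTree := by
  have hmem : ∀ {x}, x ∈ T.verts ↔ x ∈ R := fun {x} => by rw [hT, Finset.mem_coe]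
  have hfin : Fintype T.verts := Fintype.ofFinset R fun _ => hmem.symm
  rw [isTree_iff_connected_and_card]
  constructor
  · obtain ⟨r, hr⟩ := h.1
    have hreach : ∀ b, T.coe.Reachable ⟨r, hmem.2 hr⟩ b := by
      set S := R.filter fun b => ∃ hb : b ∈ T.verts, T.coe.Reachable ⟨r, hmem.2 hr⟩ ⟨b, hb⟩ with hS
      have hSR : S = R := by
        refine h.2 S (Finset.filter_subset _ _) ⟨r, ?_⟩ fun s hs a ha hsa => ?_
        · exact Finset.mem_filter.2 ⟨hr, hmem.2 hr, Reachable.refl _⟩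
        · obtain ⟨-, hs', hreach⟩ := Finset.mem_filter.1 hs
          refine Finset.mem_filter.2 ⟨ha, hmem.2 ha, hreach.trans (Adj.reachable ?_)⟩
          exact (hadj ⟨s, hs'⟩ ⟨a, hmem.2 ha⟩).2 hsa
      intro b
      have hb : (b : V) ∈ S := by rw [hSR]; exact hmem.1 b.2
      exact (Finset.mem_filter.1 hb).2.2
    have : Nonempty T.verts := ⟨⟨r, hmem.2 hr⟩⟩
    exact ⟨fun a b => (hreach a).symm.trans (hreach b)⟩
  · have h1 := size_image (G := G) (H := T.coe) (f := Subtype.val) Subtype.val_injective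
      (fun a b => (hadj a b).symm) Finset.univ
    have h2 : Finset.univ.image (Subtype.val : T.verts → V) = R := by
      ext x
      simp [hmem]
    rw [h2, size_univ] at h1
    have h3 : Nat.card T.verts = R.card := by
      rw [Nat.card_coe_set_eq, hT, Set.ncard_coe_finset]
    rw [Nat.card_coe_set_eq, ← h1, h3, hsize]

lemma IsPure.isPureSpecialGraph [Fintype V] {R : Finset V} (h : G.IsPure k R Finset.univ)
    (hm : G.edgeSet.ncard = m) : G.IsPureSpecialGraph m k := by
  obtain ⟨U, a, h⟩ := h
  have hsize := h.size_eq
  rw [size_univ, hm] at hsize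
  have hpos : 0 < R.card := Finset.card_pos.2 h.conn.1
  refine ⟨R.card, by omega, by omega, Or.inr ⟨hpos, ?_⟩⟩
  let e : Fin R.card ≃ R := R.equivFin.symm
  have heR : ∀ i, (e i : V) ∈ R := fun i => (e i).2
  have hrU : ∀ {r r'}, r ∈ R → r' ∈ R → r' ∉ U r := fun hr hr' hrU =>
    Finset.disjoint_left.1 (h.disj_roots _ hr) hrU hr'
  let A : Fin R.card → G.Subgraph := fun i =>
    { verts := insert (e i : V) (U (e i) : Set V)
      Adj := fun x y => (x ∈ U (e i) ∧ y ∈ U (e i) ∧ x ≠ y) ∨ (x = a (e i) ∧ y = e i) ∨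
        (x = e i ∧ y = a (e i))
      adj_sub := by
        rintro x y (⟨hx, hy, hxy⟩ | ⟨rfl, rfl⟩ | ⟨rfl, rfl⟩)
        · exact (h.clique (heR i)).2 x hx y hy hxy
        · exact h.adj_att (heR i)
        · exact (h.adj_att (heR i)).symm
      edge_vert := by
        rintro x y (⟨hx, hy, hxy⟩ | ⟨rfl, rfl⟩ | ⟨rfl, rfl⟩)
        · exact Or.inr hx
        · exact Or.inr (h.att_mem _ (heR i))
        · exact Or.inl rfl
      symm := ⟨by
        rintro x y (⟨hx, hy, hxy⟩ | ⟨rfl, rfl⟩ | ⟨rfl, rfl⟩)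
        · exact Or.inl ⟨hy, hx, hxy.symm⟩
        · exact Or.inr (Or.inr ⟨rfl, rfl⟩)
        · exact Or.inr (Or.inl ⟨rfl, rfl⟩)⟩ }
  have hsurj : ∀ {r}, r ∈ R → ∃ i, (e i : V) = r := fun {r} hr =>
    ⟨e.symm ⟨r, hr⟩, by rw [e.apply_symm_apply]⟩
  -- The tree on the roots is `G[R]`; the remainder tree is the single vertex `e 0`, as `r = 0`.
  refine ⟨fun i => e i, fun i => U (e i), A, (⊤ : G.Subgraph).induce (R : Set V),
    G.singletonSubgraph (e ⟨0, hpos⟩ : V), ⟨0, hpos⟩, Subtype.val_injective.comp e.injective,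
    fun i j hij => ?_, fun i j => hrU (heR j) (heR i), fun i => ?_, ?_,
    h.conn.isTree_coe h.size_roots rfl (fun x y => ⟨fun hxy => hxy.2.2, fun hxy => ⟨x.2, y.2, hxy⟩⟩), ?_, ?_, ?_, ?_, ?_⟩
  · exact h.disj _ (heR i) _ (heR j) fun he => hij (e.injective (Subtype.ext he))
  · exact ⟨h.card_eq _ (heR i), hrU (heR i) (heR i), rfl, a (e i), h.att_mem _ (heR i),
      fun _ _ => Iff.rfl⟩
  · ext x
    simp only [Subgraph.induce_verts, Finset.mem_coe, Set.mem_range]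
    exact ⟨hsurj, by rintro ⟨i, rfl⟩; exact heR i⟩
  · have : Subsingleton (G.singletonSubgraph (e ⟨0, hpos⟩ : V)).verts :=
      ⟨fun x y => Subtype.ext (x.2.trans y.2.symm)⟩
    have : Nonempty (G.singletonSubgraph (e ⟨0, hpos⟩ : V)).verts := ⟨⟨_, rfl⟩⟩
    exact IsTree.of_subsingleton
  · simp
  · ext x
    simp only [singletonSubgraph_verts, Set.mem_inter_iff, Set.mem_singleton_iff, Set.mem_iUnion,
      and_iff_left_iff_imp]
    rintro rfl
    exact ⟨⟨0, hpos⟩, Or.inl rfl⟩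
  · refine Set.eq_univ_iff_forall.2 fun x => Or.inr (Set.mem_iUnion.2 ?_)
    rcases h.mem_cases (Finset.mem_univ x) with hx | ⟨r, hr, hx⟩
    · obtain ⟨i, rfl⟩ := hsurj hx
      exact ⟨i, Or.inl rfl⟩
    · obtain ⟨i, rfl⟩ := hsurj hr
      exact ⟨i, Or.inr hx⟩
  · refine Set.Subset.antisymm ?_ fun z => ?_
    · refine Set.union_subset (Set.union_subset ?_ ?_) (Set.iUnion_subset fun i => ?_)
      all_goals exact Subgraph.edgeSet_subset _
    · induction z using Sym2.ind with
      | _ x y =>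
      intro hxy
      have hxy' : G.Adj x y := hxy
      have hclique : ∀ {x y : V}, G.Adj x y → (∃ r ∈ R, x ∈ U r) → ∃ i, (A i).Adj x y := by
        rintro x y hxy ⟨r, hr, hx⟩
        obtain ⟨i, rfl⟩ := hsurj hr
        refine ⟨i, ?_⟩
        rcases (h.adj_iff _ hr x hx y (Finset.mem_univ y)).1 hxy with h1 | h1
        · exact Or.inl ⟨hx, h1.1, h1.2.symm⟩
        · exact Or.inr (Or.inl h1)
      rcases h.mem_cases (Finset.mem_univ x) with hx | hx
      · rcases h.mem_cases (Finset.mem_univ y) with hy | hy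
        · exact Or.inl (Or.inl (Subgraph.mem_edgeSet.2 ⟨hx, hy, hxy'⟩))
        · obtain ⟨i, hi⟩ := hclique hxy'.symm hy
          exact Or.inr (Set.mem_iUnion.2 ⟨i, Subgraph.mem_edgeSet.2 hi.symm⟩)
      · obtain ⟨i, hi⟩ := hclique hxy' hx
        exact Or.inr (Set.mem_iUnion.2 ⟨i, Subgraph.mem_edgeSet.2 hi⟩)

end Isolation

end SimpleGraph

/-! ### The theorem -/

theorem mainTheorem1 {V : Type u} [Finite V] (G : SimpleGraph V) (k l m : ℕ)
    (hk : 1 ≤ k) (hl : l = 1 ∨ l = 2 ∨ l = 3) (hG : G.Connected)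
    (hm : G.edgeSet.ncard = m)
    (hclique : ¬ Nonempty (G ≃g (⊤ : SimpleGraph (Fin k)))) :
    (G.isolationNumber (isolationFamily l k) : ℚ) ≤ ((m : ℚ) + 1) / ((k.choose 2 : ℚ) + 2) ∧
    ((G.isolationNumber (isolationFamily l k) : ℚ) = ((m : ℚ) + 1) / ((k.choose 2 : ℚ) + 2) ↔
      G.IsPureSpecialGraph m k ∨
      (k = 2 ∧ Nonempty (G ≃g SimpleGraph.cycleGraph 5)) ∨
      (k = 3 ∧ (l = 1 ∨ l = 3) ∧ Nonempty (G ≃g SimpleGraph.cycleGraph 4))) ∧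
    (G.IsSpecialGraph m k →
      G.isolationNumber (isolationFamily l k) =
        ⌊((m : ℚ) + 1) / ((k.choose 2 : ℚ) + 2)⌋₊) := by
  have := Fintype.ofFinite V
  obtain ⟨D, hD, hbound⟩ := SimpleGraph.Conn.bounded hk Finset.univ hG.conn_univ
    fun h => hclique h.nonempty_iso
  rw [SimpleGraph.size_univ, hm] at hbound
  have hle : G.isolationNumber (isolationFamily l k) ≤ D.card :=
    SimpleGraph.isolationNumber_le (hD.isIsolating hk)
  set ι := G.isolationNumber (isolationFamily l k) with hι
  have hmul : (k.choose 2 + 2) * ι ≤ m + 1 := by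
    have := Nat.mul_le_mul_left (k.choose 2 + 2) hle
    rcases hbound with h | ⟨h, -⟩ <;> omega
  have htpos : (0 : ℚ) < (k.choose 2 : ℚ) + 2 := by positivity
  have hspecial : ∀ q r, G.IsSpecialGraphWith m k q r → q ≤ ι := by
    rintro q r ⟨-, -, ⟨rfl, -⟩ | ⟨-, h⟩⟩
    · exact Nat.zero_le _
    · exact h.le_isolationNumber hl hk
  have heq : (ι : ℚ) = ((m : ℚ) + 1) / ((k.choose 2 : ℚ) + 2) ↔ (k.choose 2 + 2) * ι = m + 1 := by
    rw [eq_div_iff htpos.ne', mul_comm]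
    exact_mod_cast Iff.rfl
  refine ⟨?_, ?_, ?_⟩
  · rw [le_div_iff₀ htpos, mul_comm]
    exact_mod_cast hmul
  · rw [heq]
    constructor
    · intro h
      have h1 := Nat.mul_le_mul_left (k.choose 2 + 2) hle
      -- Equality makes `D` too large for the first alternative, so `G` is extremal; a 4-cycle with
      -- `l = 2` drops out because its isolation number is 0.
      rcases hbound with h2 | ⟨-, ⟨R, hR⟩ | ⟨rfl, hcyc⟩ | ⟨rfl, hcyc⟩⟩
      · omega
      · exact Or.inl (hR.isPureSpecialGraph hm)
      · exact Or.inr (Or.inl ⟨rfl, hcyc.nonempty_iso⟩)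
      · obtain ⟨φ⟩ := hcyc.nonempty_iso
        refine Or.inr (Or.inr ⟨rfl, ?_, ⟨φ⟩⟩)
        rcases hl with rfl | rfl | rfl
        · exact Or.inl rfl
        · rw [SimpleGraph.isolationNumber_chromatic_of_iso φ] at hι
          rw [hι] at h
          omega
        · exact Or.inr rfl
    · rintro (⟨q, hq⟩ | ⟨rfl, ⟨φ⟩⟩ | ⟨rfl, hl', ⟨φ⟩⟩)
      · have h1 := Nat.mul_le_mul_left (k.choose 2 + 2) (hspecial q 0 hq)
        have h2 := hq.1
        rw [mul_comm] at h2
        omega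
      · have h1 := (SimpleGraph.isCyc_of_iso φ).size_five
        rw [SimpleGraph.size_univ, hm] at h1
        have h2 := SimpleGraph.two_le_isolationNumber_of_iso hl φ
        simp only [Nat.choose_self] at hmul ⊢
        omega
      · have h1 := (SimpleGraph.isCyc_of_iso φ).size_four
        rw [SimpleGraph.size_univ, hm] at h1
        have h2 := SimpleGraph.one_le_isolationNumber_of_iso hl' φ
        rw [show Nat.choose 3 2 + 2 = 5 from rfl] at hmul ⊢
        omega
  · rintro ⟨q, r, h⟩
    have h1 := hspecial q r h
    have h2 := h.1
    have h3 := h.2.1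
    -- Since `r < (k.choose 2) + 2`, the value `q + 1` would exceed the upper bound `hmul`.
    have hιq : ι = q := by
      refine le_antisymm (Nat.lt_succ_iff.1 ?_) h1
      by_contra hcon
      have h4 := Nat.mul_le_mul_left (k.choose 2 + 2) (not_lt.1 hcon)
      rw [Nat.mul_succ, mul_comm _ q] at h4
      omega
    rw [hιq]
    symm
    rw [Nat.floor_eq_iff (by positivity), le_div_iff₀ htpos, div_lt_iff₀ htpos]
    constructor
    · have : q * (k.choose 2 + 2) ≤ m + 1 := by omega
      exact_mod_cast this
    · have : m + 1 < (q + 1) * (k.choose 2 + 2) := by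
        rw [add_mul]
        omega
      exact_mod_cast this
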